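/- **Setting.** A vocabulary $\sigma$ is a finite set of relation symbols of positive arity. Formulas of $\mathrm{FO}(\perp,\mathrm{dep},\subseteq)$ are built from $x=y$, $x\neq y$, $R(\bar x)$, $\neg R(\bar x)$, dependence atoms $\mathrm{dep}(\bar x,\bar y)$, inclusion atoms $\bar x\subseteq\bar y$ (tuples of equal length) and independence atoms $\bar x\perp_{\bar z}\bar y$ by $\wedge,\vee,\exists x,\forall x$. A team $X$ of a structure $\mathcal A$ with universe $A$ is a set of assignments $s\colon D\to A$ with a common finite domain $D$ of variables. Lax team semantics: an $\mathrm{FO}$-literal holds in $X$ iff it holds under every $s\in X$; $\mathcal A\models_X\varphi\wedge\psi$ iff $\mathcal A\models_X\varphi$ and $\mathcal A\models_X\psi$; $\mathcal A\models_X\varphi\vee\psi$ iff $X=Y\cup Z$ with $\mathcal A\models_Y\varphi$ and $\mathcal A\models_Z\psi$; $\mathcal A\models_X\forall x\,\varphi$ iff $\mathcal A\models_{X'}\varphi$ for $X'=\{s(a/x): s\in X, a\in A\}$; $\mathcal A\models_X\exists x\,\varphi$ iff there is $F\colon X\to\mathcal P(A)\setminus\{\emptyset\}$ with $\mathcal A\models_{X'}\varphi$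 for $X'=\{s(a/x): s\in X, a\in F(s)\}$; $\mathcal A\models_X\mathrm{dep}(\bar x,\bar y)$ iff all $s,t\in X$ with $s(\bar x)=t(\bar x)$ satisfy $s(\bar y)=t(\bar y)$; $\mathcal A\models_X\bar x\subseteq\bar y$ iff for every $s\in X$ there is $t\in X$ with $s(\bar x)=t(\bar y)$; $\mathcal A\models_X\bar x\perp_{\bar z}\bar y$ iff for all $s,t\in X$ with $s(\bar z)=t(\bar z)$ there is $u\in X$ with $u(\bar x)=s(\bar x)$, $u(\bar y)=t(\bar y)$, $u(\bar z)=s(\bar z)$. An enumeration problem assigns to each input word $x$ a set $S(x)$ of words (the solutions). It belongs to $\mathrm{DelNP}$ iff there are a language $L\in\mathrm{NP}$, a random access machine $M$ with oracle $L$ (unit-cost addition and subtraction, indirect addressing) and a polynomial $p$ such that on every input $x$ the machine outputs each element of $S(x)$ exactly once and nothing else and then halts; the times before the first output, between two consecutive outputs, and between the last output (or the start, if there is none) and halting are at most $p(|x|)$; every oracle question has length at most $p(|x|)$; and all register contents have at most $p(|x|)$ bits. **Theorem.** Let $\sigma$ be a vocabulary and let $\varphi\in\mathrm{FO}(\perp,\mathrm{dep},\subseteq)$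 be a fixed formula over $\sigma$. Then the following enumeration problem belongs to $\mathrm{DelNP}$: given (the encoding of) a finite $\sigma$-structure $\mathcal A$, enumerate (the encodings of) all teams $X\neq\emptyset$ of $\mathcal A$, with domain the set of free variables of $\varphi$, such that $\mathcal A\models_X\varphi$ and $\mathcal A\not\models_{X'}\varphi$ for every team $X'$ over the same domain with $|X'|>|X|$. (Structures on $\{0,\dots,n-1\}$ are encoded by $n$ in unary followed by the characteristic words of their relations, teams by their characteristic words; words that encode no structure have no solutions.) -/

import Mathlib

namespace TeamEnum

/-! ## First-order team logic -/

/-- A vocabulary: finitely many relation symbols `0, …, numRel - 1` with positive arities. -/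
structure Vocabulary where
  numRel : ℕ
  arity : Fin numRel → ℕ
  arity_pos : ∀ i, 0 < arity i

/-- A `σ`-structure with universe `A`. -/
structure Structure (σ : Vocabulary) (A : Type*) where
  rel : ∀ i : Fin σ.numRel, Set (Fin (σ.arity i) → A)

/-- Formulas of `FO(⊥, dep, ⊆)` over `σ`. First-order variables are natural numbers and a tuple of
`k` variables is a function `Fin k → ℕ`. -/
inductive Formula (σ : Vocabulary) : Type
  | eq (x y : ℕ)
  | neq (x y : ℕ)
  | rel (i : Fin σ.numRel) (xs : Fin (σ.arity i) → ℕ)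
  | nrel (i : Fin σ.numRel) (xs : Fin (σ.arity i) → ℕ)
  | and (φ ψ : Formula σ)
  | or (φ ψ : Formula σ)
  | ex (x : ℕ) (φ : Formula σ)
  | all (x : ℕ) (φ : Formula σ)
  /-- the dependence atom `dep(xs, ys)` -/
  | dep {k l : ℕ} (xs : Fin k → ℕ) (ys : Fin l → ℕ)
  /-- the inclusion atom `xs ⊆ ys` -/
  | inc {k : ℕ} (xs ys : Fin k → ℕ)
  /-- the independence atom `xs ⊥_zs ys` -/
  | indep {k l m : ℕ} (xs : Fin k → ℕ) (ys : Fin l → ℕ) (zs : Fin m → ℕ)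

/-- The variables occurring in a tuple. -/
def tupleVars {k : ℕ} (xs : Fin k → ℕ) : Finset ℕ := Finset.univ.image xs

/-- The free variables of a formula. -/
def Formula.free {σ : Vocabulary} : Formula σ → Finset ℕ
  | .eq x y => {x, y}
  | .neq x y => {x, y}
  | .rel _ xs => tupleVars xs
  | .nrel _ xs => tupleVars xs
  | .and φ ψ => φ.free ∪ ψ.free
  | .or φ ψ => φ.free ∪ ψ.free
  | .ex x φ => φ.free.erase x
  | .all x φ => φ.free.erase x
  | .dep xs ys => tupleVars xs ∪ tupleVars ys
  | .inc xs ys => tupleVars xs ∪ tupleVars ys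
  | .indep xs ys zs => tupleVars xs ∪ tupleVars ys ∪ tupleVars zs

/-- An assignment with values in `A` is a partial function from variables to `A`; its domain is
the set of variables at which it is not `none`. -/
abbrev Assignment (A : Type*) := ℕ → Option A

/-- `s(a/x)`. -/
def Assignment.subst {A : Type*} (s : Assignment A) (a : A) (x : ℕ) : Assignment A :=
  Function.update s x (some a)

/-- `X` is a set of assignments which all have domain `D`. -/
def IsTeam {A : Type*} (D : Finset ℕ) (X : Set (Assignment A)) : Prop :=
  ∀ s ∈ X, ∀ x, (s x).isSome = true ↔ x ∈ D

/-- `X[F/x]`. -/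
def supplement {A : Type*} (X : Set (Assignment A)) (F : Assignment A → Set A) (x : ℕ) :
    Set (Assignment A) :=
  {t | ∃ s ∈ X, ∃ a ∈ F s, t = s.subst a x}

/-- `X[A/x]`. -/
def duplicate {A : Type*} (X : Set (Assignment A)) (x : ℕ) : Set (Assignment A) :=
  {t | ∃ s ∈ X, ∃ a : A, t = s.subst a x}

/-- (Lax) team semantics: `Sat 𝔄 φ X` is `𝔄 ⊨_X φ`. The value of a tuple `xs` under `s` is
`s ∘ xs`. -/
def Sat {σ : Vocabulary} {A : Type*} (𝔄 : Structure σ A) :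
    Formula σ → Set (Assignment A) → Prop
  | .eq x y, X => ∀ s ∈ X, s x = s y
  | .neq x y, X => ∀ s ∈ X, s x ≠ s y
  | .rel i xs, X => ∀ s ∈ X, ∃ a ∈ 𝔄.rel i, s ∘ xs = some ∘ a
  | .nrel i xs, X => ∀ s ∈ X, ∃ a ∉ 𝔄.rel i, s ∘ xs = some ∘ a
  | .and φ ψ, X => Sat 𝔄 φ X ∧ Sat 𝔄 ψ X
  | .or φ ψ, X => ∃ Y Z : Set (Assignment A), Y ∪ Z = X ∧ Sat 𝔄 φ Y ∧ Sat 𝔄 ψ Z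
  | .ex x φ, X => ∃ F : Assignment A → Set A,
      (∀ s ∈ X, (F s).Nonempty) ∧ Sat 𝔄 φ (supplement X F x)
  | .all x φ, X => Sat 𝔄 φ (duplicate X x)
  | .dep xs ys, X => ∀ s ∈ X, ∀ t ∈ X, s ∘ xs = t ∘ xs → s ∘ ys = t ∘ ys
  | .inc xs ys, X => ∀ s ∈ X, ∃ t ∈ X, s ∘ xs = t ∘ ys
  | .indep xs ys zs, X => ∀ s ∈ X, ∀ t ∈ X, s ∘ zs = t ∘ zs →
      ∃ u ∈ X, u ∘ xs = s ∘ xs ∧ u ∘ ys = t ∘ ys ∧ u ∘ zs = s ∘ zs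

/-! ## Random access machines with an oracle -/

/-- Instructions of a random access machine with registers `R 0, R 1, …` over `ℕ`, a read-only
input word, an oracle question word and an output word (which are written bit by bit). -/
inductive Instr : Type
  /-- `R r := k` -/
  | const (r k : ℕ)
  /-- `R r := R a + R b` -/
  | add (r a b : ℕ)
  /-- `R r := R a - R b` (truncated) -/
  | sub (r a b : ℕ)
  /-- `R r := R (R a)` -/
  | load (r a : ℕ)
  /-- `R (R a) := R b` -/
  | store (a b : ℕ)
  /-- if `R a = 0` then jump to instruction `l` -/
  | jz (a l : ℕ)
  /-- `R r := ` length of the input -/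
  | inputLength (r : ℕ)
  /-- `R r := ` bit number `R a` of the input -/
  | input (r a : ℕ)
  /-- append the bit `R a ≠ 0` to the oracle question -/
  | writeQuery (a : ℕ)
  /-- `R r := ` oracle answer to the current question; the question is cleared -/
  | ask (r : ℕ)
  /-- append the bit `R a ≠ 0` to the output word -/
  | writeOutput (a : ℕ)
  /-- output the current output word as the next solution; the output word is cleared -/
  | output

/-- A configuration: program counter, register contents, oracle question, output word. -/
structure Config where
  pc : ℕ
  reg : ℕ → ℕ
  query : List Bool
  out : List Bool

/-- The initial configuration. -/
def Config.init : Config := ⟨0, fun _ => 0, [], []⟩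

/-- `R r := v`, and proceed to the next instruction. -/
def Config.set (c : Config) (r v : ℕ) : Config :=
  { c with pc := c.pc + 1, reg := Function.update c.reg r v }

open Classical in
/-- The effect of one instruction, for the oracle `L` and the input `x`. -/
noncomputable def exec (L : Language Bool) (x : List Bool) (c : Config) : Instr → Config
  | .const r k => c.set r k
  | .add r a b => c.set r (c.reg a + c.reg b)
  | .sub r a b => c.set r (c.reg a - c.reg b)
  | .load r a => c.set r (c.reg (c.reg a))
  | .store a b => c.set (c.reg a) (c.reg b)
  | .jz a l => { c with pc := if c.reg a = 0 then l else c.pc + 1 }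
  | .inputLength r => c.set r x.length
  | .input r a => c.set r (if x[c.reg a]? = some true then 1 else 0)
  | .writeQuery a => { c with pc := c.pc + 1, query := c.query ++ [decide (c.reg a ≠ 0)] }
  | .ask r => { c.set r (if c.query ∈ L then 1 else 0) with query := [] }
  | .writeOutput a => { c with pc := c.pc + 1, out := c.out ++ [decide (c.reg a ≠ 0)] }
  | .output => { c with pc := c.pc + 1, out := [] }

/-- A program; the machine halts when the program counter leaves the program. -/
abbrev Program := List Instr

/-- One step (the identity on halted configurations). -/
noncomputable def step (M : Program) (L : Language Bool) (x : List Bool) (c : Config) : Config :=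
  match M[c.pc]? with
  | none => c
  | some i => exec L x c i

/-- The configuration of `M` with oracle `L` on input `x` after `t` steps. -/
noncomputable def run (M : Program) (L : Language Bool) (x : List Bool) (t : ℕ) : Config :=
  (step M L x)^[t] Config.init

/-- The machine has halted in the configuration `c`. -/
def Halted (M : Program) (c : Config) : Prop := M[c.pc]? = none

/-- The next step outputs the solution `y`. -/
def Outputs (M : Program) (c : Config) (y : List Bool) : Prop :=
  M[c.pc]? = some .output ∧ c.out = y

/-- The next step asks the oracle the question `q`. -/
def Asks (M : Program) (c : Config) (q : List Bool) : Prop :=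
  (∃ r, M[c.pc]? = some (.ask r)) ∧ c.query = q

/-! ## Complexity classes -/

/-- Polynomial time: the machine (with the empty oracle) halts within `p(|x|)` steps, and it accepts
iff register `0` is then nonzero. -/
def PTIME : Set (Language Bool) :=
  {L | ∃ (M : Program) (p : Polynomial ℕ), ∀ x : List Bool, ∃ t ≤ p.eval x.length,
    Halted M (run M 0 x t) ∧ (x ∈ L ↔ (run M 0 x t).reg 0 ≠ 0)}

/-- The pair of two words, as one word: the bits of `x` doubled, a separator, and `w`. -/
def pairWord (x w : List Bool) : List Bool :=
  x.flatMap (fun b => [b, b]) ++ [false, true] ++ w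

/-- Nondeterministic polynomial time, by polynomially bounded certificates that are verified in
polynomial time. -/
def NP : Set (Language Bool) :=
  {L | ∃ V ∈ PTIME, ∃ p : Polynomial ℕ, ∀ x : List Bool,
    x ∈ L ↔ ∃ w : List Bool, w.length ≤ p.eval x.length ∧ pairWord x w ∈ V}

/-- An enumeration problem assigns to each input word the set of its solutions. -/
abbrev EnumProblem := List Bool → Set (List Bool)

/-- On input `x`, the program `M` with oracle `L` outputs exactly the elements of `S`, each of them
once, and halts; the time before the first output, between two consecutive outputs, and between
the last output and halting is at most `d`. -/
def EnumeratesWithDelay (M : Program) (L : Language Bool) (x : List Bool) (S : Set (List Bool))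
    (d : ℕ) : Prop :=
  (∀ y, y ∈ S ↔ ∃ t, Outputs M (run M L x t) y) ∧
  (∀ y t t', Outputs M (run M L x t) y → Outputs M (run M L x t') y → t = t') ∧
  (∃ t, Halted M (run M L x t)) ∧
  (∀ t, ∃ t', t ≤ t' ∧ t' < t + d ∧
    (Halted M (run M L x t') ∨ ∃ y, Outputs M (run M L x t') y))

/-- The enumeration class `DelC` of a class `C` of decision problems: enumeration with polynomial
delay by a random access machine with an oracle in `C`, whose oracle questions have polynomial
length and whose registers contain numbers of polynomially many bits. -/
def Del (C : Set (Language Bool)) : Set EnumProblem :=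
  {E | ∃ L ∈ C, ∃ (M : Program) (p : Polynomial ℕ), ∀ x : List Bool,
    EnumeratesWithDelay M L x (E x) (p.eval x.length) ∧
    (∀ t q, Asks M (run M L x t) q → q.length ≤ p.eval x.length) ∧
    (∀ t r, (run M L x t).reg r < 2 ^ p.eval x.length)}

/-! ## The enumeration problem -/

open Classical in
/-- A `k`-ary relation on `{0, …, n - 1}` as a word of length `n ^ k`: the bit number
`∑ i, a i * n ^ i` tells whether the tuple `a` belongs to the relation. -/
noncomputable def encodeRel {n k : ℕ} (R : Set (Fin k → Fin n)) : List Bool :=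
  List.ofFn fun j : Fin (n ^ k) => decide (finFunctionFinEquiv.symm j ∈ R)

/-- A structure with universe `{0, …, n - 1}` as a word: `n` in unary, followed by its relations. -/
noncomputable def encodeStructure {σ : Vocabulary} {n : ℕ} (𝔄 : Structure σ (Fin n)) : List Bool :=
  List.replicate n true ++ [false] ++ (List.ofFn fun i => encodeRel (𝔄.rel i)).flatten

/-- A team with domain `D` as a word: it is read as a `|D|`-ary relation, with the variables
in increasing order. -/
noncomputable def encodeTeam {n : ℕ} (D : Finset ℕ) (X : Set (Assignment (Fin n))) : List Bool :=
  encodeRel {a : Fin D.card → Fin n | ∃ s ∈ X, s ∘ D.orderEmbOfFin rfl = some ∘ a}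

/-- `X` is a nonempty satisfying team (with the free variables of `φ` as its domain) of maximum
cardinality. -/
def IsMaxCardTeam {σ : Vocabulary} {n : ℕ} (φ : Formula σ) (𝔄 : Structure σ (Fin n))
    (X : Set (Assignment (Fin n))) : Prop :=
  IsTeam φ.free X ∧ Sat 𝔄 φ X ∧ X ≠ ∅ ∧
  ∀ X' : Set (Assignment (Fin n)), IsTeam φ.free X' → X.ncard < X'.ncard → ¬ Sat 𝔄 φ X'

/-- Enumeration of the nonempty satisfying teams of maximum cardinality of the fixed formula `φ` in a
given structure (a word that encodes no structure has no solutions). -/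
def ECardMaxSat {σ : Vocabulary} (φ : Formula σ) : EnumProblem := fun w =>
  {y | ∃ (n : ℕ) (𝔄 : Structure σ (Fin n)) (X : Set (Assignment (Fin n))),
    w = encodeStructure 𝔄 ∧ IsMaxCardTeam φ 𝔄 X ∧ y = encodeTeam φ.free X}

/-! ## Well-definedness of the encodings -/

theorem IsTeam.finite {n : ℕ} {D : Finset ℕ} {X : Set (Assignment (Fin n))} (h : IsTeam D X) :
    X.Finite := by
  refine Set.Finite.of_injOn (f := fun s (i : D) => s i) (t := Set.univ)
    (fun _ _ => Set.mem_univ _) ?_ Set.finite_univ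
  intro s hs t ht hst
  funext x
  by_cases hx : x ∈ D
  · exact congrFun hst ⟨x, hx⟩
  · have h1 := mt (h s hs x).1 hx
    have h2 := mt (h t ht x).1 hx
    simp only [Bool.not_eq_true, Option.isSome_eq_false_iff, Option.isNone_iff_eq_none] at h1 h2
    rw [h1, h2]

theorem encodeRel_injective {n k : ℕ} :
    Function.Injective (encodeRel : Set (Fin k → Fin n) → List Bool) := by
  intro R S h
  ext a
  have := congrFun (List.ofFn_injective h) (finFunctionFinEquiv a)
  simpa using this

theorem encodeRel_length {n k : ℕ} (R : Set (Fin k → Fin n)) :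
    (encodeRel R).length = n ^ k := by
  simp [encodeRel]

theorem encodeTeam_injOn {n : ℕ} (D : Finset ℕ) :
    Set.InjOn (encodeTeam (n := n) D) {X | IsTeam D X} := by
  have key : ∀ X Y : Set (Assignment (Fin n)), IsTeam D X → IsTeam D Y →
      encodeTeam D X = encodeTeam D Y → X ⊆ Y := by
    intro X Y hX hY h s hs
    have h' := encodeRel_injective h
    have hD : ∀ i, ∃ a, s (D.orderEmbOfFin rfl i) = some a := fun i =>
      Option.isSome_iff_exists.1 ((hX s hs _).2 (Finset.orderEmbOfFin_mem D rfl i))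
    choose a ha using hD
    have hmem : a ∈ {a : Fin D.card → Fin n | ∃ s ∈ X, s ∘ D.orderEmbOfFin rfl = some ∘ a} :=
      ⟨s, hs, funext ha⟩
    rw [h'] at hmem
    obtain ⟨t, ht, hta⟩ := hmem
    have : s = t := by
      funext x
      by_cases hx : x ∈ D
      · have : x ∈ Set.range (D.orderEmbOfFin rfl) := by simpa using hx
        obtain ⟨i, rfl⟩ := this
        rw [ha i]
        exact (congrFun hta i).symm
      · have h1 := mt (hX s hs x).1 hx
        have h2 := mt (hY t ht x).1 hx
        simp only [Bool.not_eq_true, Option.isSome_eq_false_iff,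
          Option.isNone_iff_eq_none] at h1 h2
        rw [h1, h2]
    exact this ▸ ht
  intro X hX Y hY h
  exact Set.Subset.antisymm (key X Y hX hY h) (key Y X hY hX h.symm)

theorem flatten_ofFn_injective {α : Type*} : ∀ {m : ℕ} (f g : Fin m → List α),
    (∀ i, (f i).length = (g i).length) →
    (List.ofFn f).flatten = (List.ofFn g).flatten → f = g := by
  intro m
  induction m with
  | zero => intro f g _ _; exact Subsingleton.elim _ _
  | succ m ih =>
    intro f g hl h
    rw [List.ofFn_succ, List.ofFn_succ, List.flatten_cons, List.flatten_cons] at h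
    obtain ⟨h0, h1⟩ := List.append_inj h (hl 0)
    have h2 := ih _ _ (fun i => hl i.succ) h1
    funext i
    refine Fin.cases h0 (fun j => congrFun h2 j) i

theorem encodeStructure_injective {σ : Vocabulary} :
    Function.Injective (fun p : Σ n, Structure σ (Fin n) => encodeStructure p.2) := by
  have hn : ∀ (n m : ℕ) (a b : List Bool), List.replicate n true ++ [false] ++ a =
      List.replicate m true ++ [false] ++ b → n = m ∧ a = b := by
    intro n
    induction n with
    | zero => intro m a b h; cases m <;> simp_all [List.replicate_succ]
    | succ n ih =>
      intro m a b h
      cases m with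
      | zero => simp [List.replicate_succ] at h
      | succ m =>
        have := ih m a b (by simpa [List.replicate_succ] using h)
        exact ⟨by omega, this.2⟩
  rintro ⟨n, ⟨R⟩⟩ ⟨m, ⟨S⟩⟩ h
  obtain ⟨rfl, h⟩ := hn _ _ _ _ h
  have h' := flatten_ofFn_injective _ _ (fun i => by simp [encodeRel_length]) h
  have : R = S := funext fun i => encodeRel_injective (congrFun h' i)
  rw [this]

end TeamEnum

/-!
If `φ` has `k` free variables, the teams of a structure with `n` elements are encoded by words of
length `N = n ^ k`. The machine works in rounds. It keeps an array of `3 * N` bits: the maximal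
cardinality of a satisfying team in unary, the last solution, and the new solution; initially they
are zero. In each round all bits are recomputed in turn, each by one oracle question. For the first
block the question is whether there is a satisfying team with more than `i` elements. For the third
block it is whether some satisfying team of maximal cardinality, lexicographically smaller than the
last solution if there is one, extends the part of the new solution that has been fixed so far by
the bit `1`. The second block is copied from the third one, with the help of questions whose answer
is visible in the question itself. So each round finds the lexicographically largest solution below
the last one; if there is none, the new solution is the zero word, and the machine stops.

The questions are in `NP`: besides the team itself, a certificate provides a team for each
subformula of `φ`, such that the teams of a subformula and of its immediate subformulas are related
as the semantics demands. As `φ` is fixed, these are polynomially many bits, and they can be checked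
by loops over pairs and triples of assignments.

Running times are bounded compositionally: functions computed by program fragments in polynomial
time, and predicates decided by them, are closed under arithmetic, Boolean operations and bounded
quantification.
-/

namespace TeamEnum

/-! ## Program fragments -/

/-- A configuration without its program counter: the data on which a program fragment acts. -/
structure Store where
  reg : ℕ → ℕ
  query : List Bool
  out : List Bool

/-- The configuration with store `s` and program counter `p`. -/
def Store.config (s : Store) (p : ℕ) : Config := ⟨p, s.reg, s.query, s.out⟩

/-- `R r := v` -/
def Store.set (s : Store) (r v : ℕ) : Store := { s with reg := Function.update s.reg r v }

/-- The effect of one instruction on the store. -/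
noncomputable def Store.exec (L : Language Bool) (x : List Bool) (s : Store) (i : Instr) : Store :=
  let c := TeamEnum.exec L x (s.config 0) i
  ⟨c.reg, c.query, c.out⟩

/-- The instructions that neither jump nor output a solution. -/
def Instr.isStraight : Instr → Bool
  | .jz _ _ => false
  | .output => false
  | _ => true

/-- The code `P` stands at position `p` of the program `M`. -/
def CodeAt (M : Program) (p : ℕ) (P : List Instr) : Prop := P <+: M.drop p

/-- In the configuration `c`, the next step neither halts nor outputs a solution. -/
def Quiet (M : Program) (c : Config) : Prop := ∃ i, M[c.pc]? = some i ∧ i ≠ .output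

/-- `M` moves from `c` to `c'` in at most `τ` steps without halting or outputting a solution. -/
def Reaches (M : Program) (L : Language Bool) (x : List Bool) (c : Config) (τ : ℕ) (c' : Config) :
    Prop :=
  ∃ t ≤ τ, (step M L x)^[t] c = c' ∧ ∀ s < t, Quiet M ((step M L x)^[s] c)

/-- A relocatable piece of code: since jumps are absolute, it depends on the position at which it
is placed. -/
def Fragment : Type := ℕ → List Instr

namespace Fragment

/-- Code without jumps, which may be placed anywhere. -/
def line (l : List Instr) : Fragment := fun _ => l

/-- `P` followed by `Q` -/
def seq (P Q : Fragment) : Fragment := fun p => P p ++ Q (p + (P p).length)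

/-- `for R i < R (i + 1) do P`, with the scratch register `R (i + 2)`. -/
def loop (i : ℕ) (P : Fragment) : Fragment := fun p =>
  [.const i 0, .sub (i + 2) (i + 1) i, .jz (i + 2) (p + 3 + (P (p + 3)).length + 4)] ++
    P (p + 3) ++ [.const (i + 2) 1, .add i i (i + 2), .const (i + 2) 0, .jz (i + 2) (p + 1)]

end Fragment

/-- Started in the store `s`, the fragment `P` runs to its end in at most `τ` steps, without
outputting a solution, and leaves the store `s'`. -/
def Executes (L : Language Bool) (x : List Bool) (P : Fragment) (s : Store) (τ : ℕ) (s' : Store) :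
    Prop :=
  ∀ M p, CodeAt M p (P p) → Reaches M L x (s.config p) τ (s'.config (p + (P p).length))

section Execution

variable {M : Program} {L : Language Bool} {x : List Bool}

theorem CodeAt.refl (P : List Instr) : CodeAt P 0 P := List.prefix_rfl

theorem CodeAt.left {p : ℕ} {P Q : List Instr} (h : CodeAt M p (P ++ Q)) : CodeAt M p P :=
  (List.prefix_append P Q).trans h

theorem CodeAt.right {p : ℕ} {P Q : List Instr} (h : CodeAt M p (P ++ Q)) :
    CodeAt M (p + P.length) Q := by
  have := List.IsPrefix.drop h P.length
  rwa [List.drop_left, List.drop_drop] at this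

theorem CodeAt.getElem? {p : ℕ} {i : Instr} {P : List Instr} (h : CodeAt M p (i :: P)) :
    M[p]? = some i := by
  obtain ⟨C, hC⟩ := h
  rw [← add_zero p, ← List.getElem?_drop, ← hC, List.cons_append, List.getElem?_cons_zero]

theorem CodeAt.tail {p : ℕ} {i : Instr} {P : List Instr} (h : CodeAt M p (i :: P)) :
    CodeAt M (p + 1) P := CodeAt.right (P := [i]) h

theorem step_eq_exec {c : Config} {i : Instr} (h : M[c.pc]? = some i) :
    step M L x c = exec L x c i := by
  simp only [step, h]

@[simp] theorem Store.reg_set (s : Store) (r v r' : ℕ) :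
    (s.set r v).reg r' = if r' = r then v else s.reg r' := Function.update_apply ..

@[simp] theorem Store.exec_const (s : Store) (r k : ℕ) : s.exec L x (.const r k) = s.set r k := rfl

@[simp] theorem Store.exec_add (s : Store) (r a b : ℕ) :
    s.exec L x (.add r a b) = s.set r (s.reg a + s.reg b) := rfl

@[simp] theorem Store.exec_sub (s : Store) (r a b : ℕ) :
    s.exec L x (.sub r a b) = s.set r (s.reg a - s.reg b) := rfl

@[simp] theorem Store.exec_load (s : Store) (r a : ℕ) :
    s.exec L x (.load r a) = s.set r (s.reg (s.reg a)) := rfl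

@[simp] theorem Store.exec_inputLength (s : Store) (r : ℕ) :
    s.exec L x (.inputLength r) = s.set r x.length := rfl

@[simp] theorem Store.exec_input (s : Store) (r a : ℕ) :
    s.exec L x (.input r a) = s.set r (if x[s.reg a]? = some true then 1 else 0) := rfl

theorem exec_config {i : Instr} (hi : i.isStraight) (s : Store) (p : ℕ) :
    exec L x (s.config p) i = (s.exec L x i).config (p + 1) := by
  cases i <;> first | rfl | cases hi

theorem Reaches.refl (c : Config) : Reaches M L x c 0 c :=
  ⟨0, le_rfl, rfl, fun _ h => (Nat.not_lt_zero _ h).elim⟩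

theorem Reaches.mono {c c' : Config} {τ τ' : ℕ} (h : Reaches M L x c τ c') (hτ : τ ≤ τ') :
    Reaches M L x c τ' c' :=
  let ⟨t, ht, h⟩ := h
  ⟨t, ht.trans hτ, h⟩

theorem Reaches.trans {c c' c'' : Config} {τ τ' : ℕ} (h : Reaches M L x c τ c')
    (h' : Reaches M L x c' τ' c'') : Reaches M L x c (τ + τ') c'' := by
  obtain ⟨t, ht, rfl, quiet⟩ := h
  obtain ⟨t', ht', rfl, quiet'⟩ := h'
  refine ⟨t + t', by omega, by rw [add_comm, Function.iterate_add_apply], fun s hs => ?_⟩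
  by_cases hst : s < t
  · exact quiet s hst
  · have := quiet' (s - t) (by omega)
    rwa [← Function.iterate_add_apply, Nat.sub_add_cancel (by omega)] at this

theorem Reaches.single {c : Config} {i : Instr} (h : M[c.pc]? = some i) (hi : i ≠ .output) :
    Reaches M L x c 1 (exec L x c i) := by
  refine ⟨1, le_rfl, step_eq_exec h, fun s hs => ?_⟩
  obtain rfl : s = 0 := by omega
  exact ⟨i, h, hi⟩

theorem Reaches.jump {s : Store} {p a l : ℕ} (h : M[p]? = some (.jz a l)) (ha : s.reg a = 0) :
    Reaches M L x (s.config p) 1 (s.config l) := by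
  simpa only [exec, Store.config, ha, if_true] using
    Reaches.single (L := L) (x := x) (c := s.config p) h Instr.noConfusion

theorem Reaches.no_jump {s : Store} {p a l : ℕ} (h : M[p]? = some (.jz a l)) (ha : s.reg a ≠ 0) :
    Reaches M L x (s.config p) 1 (s.config (p + 1)) := by
  simpa only [exec, Store.config, ha, if_false] using
    Reaches.single (L := L) (x := x) (c := s.config p) h Instr.noConfusion

theorem Executes.mono {P : Fragment} {s s' : Store} {τ τ' : ℕ} (h : Executes L x P s τ s')
    (hτ : τ ≤ τ') : Executes L x P s τ' s' :=
  fun M p hM => (h M p hM).mono hτ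

theorem Executes.seq {P Q : Fragment} {s s' s'' : Store} {τ τ' : ℕ} (h : Executes L x P s τ s')
    (h' : Executes L x Q s' τ' s'') : Executes L x (P.seq Q) s (τ + τ') s'' := by
  intro M p hM
  have := (h M p hM.left).trans (h' M _ hM.right)
  rwa [add_assoc, ← List.length_append] at this

theorem Executes.line {l : List Instr} (hl : l.all Instr.isStraight) (s : Store) :
    Executes L x (.line l) s l.length (l.foldl (Store.exec L x) s) := by
  induction l generalizing s with
  | nil => exact fun M p _ => Reaches.refl _
  | cons i l ih =>
    intro M p hM
    obtain ⟨hi, hl⟩ : i.isStraight ∧ l.all Instr.isStraight := by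
      simpa only [List.all_cons, Bool.and_eq_true] using hl
    have first : Reaches M L x (s.config p) 1 ((s.exec L x i).config (p + 1)) := by
      rw [← exec_config hi]
      exact Reaches.single hM.getElem? (by rintro rfl; cases hi)
    have rest := ih hl (s.exec L x i) M (p + 1) hM.tail
    simpa only [Fragment.line, List.length_cons, List.foldl_cons, add_comm, add_left_comm]
      using first.trans rest

end Execution

/-! ### Loops -/

section Loop

variable {L : Language Bool} {x : List Bool} {i : ℕ} {P : Fragment}

theorem Fragment.length_loop (p : ℕ) :
    (P.loop i p).length = 3 + (P (p + 3)).length + 4 := by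
  simp only [Fragment.loop, List.length_append, List.length_cons, List.length_nil]

theorem Reaches.loop_exit {M : Program} {p : ℕ} (hM : CodeAt M p (P.loop i p)) {s : Store}
    (h : s.reg (i + 1) = s.reg i) :
    Reaches M L x (s.config (p + 1)) 2
      ((s.set (i + 2) 0).config (p + (P.loop i p).length)) := by
  have test : Reaches M L x (s.config (p + 1)) 1 ((s.set (i + 2) 0).config (p + 2)) := by
    have := Reaches.single (L := L) (x := x) (c := s.config (p + 1)) hM.left.tail.getElem?
      Instr.noConfusion
    simpa [exec, Config.set, Store.config, Store.set, h] using this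
  have exit := Reaches.jump (L := L) (x := x) (s := s.set (i + 2) 0)
    hM.left.tail.tail.getElem? (by simp)
  rw [Fragment.length_loop]
  convert test.trans exit using 2
  omega

theorem Reaches.loop_enter {M : Program} {p : ℕ} (hM : CodeAt M p (P.loop i p)) {s : Store}
    (h : s.reg i < s.reg (i + 1)) :
    Reaches M L x (s.config (p + 1)) 2
      ((s.set (i + 2) (s.reg (i + 1) - s.reg i)).config (p + 3)) := by
  have test : Reaches M L x (s.config (p + 1)) 1
      ((s.set (i + 2) (s.reg (i + 1) - s.reg i)).config (p + 2)) :=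
    Reaches.single (c := s.config (p + 1)) hM.left.tail.getElem? Instr.noConfusion
  refine test.trans (Reaches.no_jump (s := s.set _ _) hM.left.tail.tail.getElem? ?_)
  simpa [Nat.sub_eq_zero_iff_le] using h

theorem Reaches.loop_next {M : Program} {p : ℕ} (hM : CodeAt M p (P.loop i p)) (s : Store) :
    Reaches M L x (s.config (p + 3 + (P (p + 3)).length)) 4
      (((s.set i (s.reg i + 1)).set (i + 2) 0).config (p + 1)) := by
  have code : CodeAt M (p + 3 + (P (p + 3)).length)
      ([.const (i + 2) 1, .add i i (i + 2), .const (i + 2) 0] ++ [.jz (i + 2) (p + 1)]) := by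
    have := hM.right
    rwa [List.length_append, ← add_assoc] at this
  have line := Executes.line (L := L) (x := x)
    (l := [.const (i + 2) 1, .add i i (i + 2), .const (i + 2) 0])
    rfl s M _ code.left
  have final : [Instr.const (i + 2) 1, .add i i (i + 2), .const (i + 2) 0].foldl
      (Store.exec L x) s =
      (s.set i (s.reg i + 1)).set (i + 2) 0 := by
    simp only [List.foldl_cons, List.foldl_nil, Store.exec_const, Store.exec_add, Store.set,
      Store.mk.injEq, and_true]
    funext r
    simp only [Function.update_apply]
    grind
  rw [final] at line
  exact line.trans (Reaches.jump code.right.getElem? (by simp))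

theorem Executes.loop {n τ : ℕ} (I : ℕ → Store → Prop)
    (stable : ∀ {k s r v}, r = i ∨ r = i + 2 → I k s → I k (s.set r v))
    (body : ∀ k < n, ∀ s : Store, s.reg i = k → s.reg (i + 1) = n → I k s →
      ∃ s', Executes L x P s τ s' ∧ s'.reg i = k ∧ s'.reg (i + 1) = n ∧ I (k + 1) s')
    {s : Store} (hn : s.reg (i + 1) = n) (h0 : I 0 s) :
    ∃ s', Executes L x (P.loop i) s (n * (τ + 6) + 3) s' ∧ I n s' := by
  have remaining : ∀ d k, k + d = n → ∀ s : Store, s.reg i = k → s.reg (i + 1) = n → I k s →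
      ∃ s', I n s' ∧ ∀ M p, CodeAt M p (P.loop i p) →
        Reaches M L x (s.config (p + 1)) (d * (τ + 6) + 2)
          (s'.config (p + (P.loop i p).length)) := by
    intro d
    induction d with
    | zero =>
      rintro k rfl s hk hn hI
      exact ⟨_, stable (.inr rfl) hI,
        fun M p hM => by simpa using Reaches.loop_exit hM (hn.trans hk.symm)⟩
    | succ d ih =>
      intro k hkd s hk hn hI
      obtain ⟨s₁, run₁, hk₁, hn₁, hI₁⟩ := body k (by omega) (s.set (i + 2) (n - k))
        (by simp [hk]) (by simp [hn]) (stable (.inr rfl) hI)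
      obtain ⟨s', hI', run'⟩ := ih (k + 1) (by omega) ((s₁.set i (k + 1)).set (i + 2) 0)
        (by simp) (by simp [hn₁])
        (stable (.inr rfl) (stable (.inl rfl) hI₁))
      refine ⟨s', hI', fun M p hM => ?_⟩
      have enter := Reaches.loop_enter (L := L) (x := x) hM (s := s) (by omega)
      have next := Reaches.loop_next (L := L) (x := x) hM s₁
      rw [hk, hn] at enter
      rw [hk₁] at next
      have code : CodeAt M (p + 3) (P (p + 3)) := hM.left.right
      exact (((enter.trans (run₁ M _ code)).trans next).trans (run' M p hM)).mono (by nlinarith)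
  obtain ⟨s', hI', run'⟩ := remaining n 0 (by omega) (s.set i 0) (by simp) (by simp [hn])
    (stable (.inl rfl) h0)
  refine ⟨s', fun M p hM => ?_, hI'⟩
  have start : Reaches M L x (s.config p) 1 ((s.set i 0).config (p + 1)) :=
    Reaches.single (c := s.config p) hM.left.left.getElem? Instr.noConfusion
  exact (start.trans (run' M p hM)).mono (by omega)

end Loop

/-! ## Polynomial-time functions -/

/-- The data a polynomial-time function may depend on: an input word, an infinite array of bits (of
which only polynomially many are ever read) and the values of finitely many variables. -/
class Context (Γ : Type) where
  input : Γ → List Bool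
  array : Γ → ℕ → Bool
  vars : Γ → List ℕ

namespace Context

instance : Context (List Bool × (ℕ → Bool)) where
  input c := c.1
  array c := c.2
  vars _ := []

instance {Γ : Type} [Context Γ] : Context (Γ × ℕ) where
  input c := input c.1
  array c := array c.1
  vars c := c.2 :: vars c.1

/-- The size of a context, in terms of which running times are measured. -/
def size {Γ : Type} [Context Γ] (c : Γ) : ℕ := (input c).length + (vars c).sum

theorem size_prod {Γ : Type} [Context Γ] (c : Γ × ℕ) : size c = size c.1 + c.2 := by
  simp only [size, input, vars, List.sum_cons]
  omega

end Context

open Context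

section PolyBounded

variable {Γ : Type} [Context Γ] {f g : Γ → ℕ}

/-- `f` is bounded by a polynomial in the size of the context. -/
def PolyBounded (f : Γ → ℕ) : Prop := ∃ k, ∀ c, f c ≤ (size c + 2) ^ k

namespace PolyBounded

theorem mono (hg : PolyBounded g) (h : ∀ c, f c ≤ g c) : PolyBounded f :=
  let ⟨k, hk⟩ := hg
  ⟨k, fun c => (h c).trans (hk c)⟩

theorem const (n : ℕ) : PolyBounded (fun _ : Γ => n) :=
  ⟨n, fun _ => Nat.lt_two_pow_self.le.trans (Nat.pow_le_pow_left (by omega) _)⟩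

theorem size : PolyBounded (fun c : Γ => size c) :=
  ⟨1, fun c => by rw [pow_one]; exact Nat.le_add_right _ 2⟩

theorem mul (hf : PolyBounded f) (hg : PolyBounded g) : PolyBounded (fun c => f c * g c) := by
  obtain ⟨k, hk⟩ := hf
  obtain ⟨l, hl⟩ := hg
  exact ⟨k + l, fun c => by rw [pow_add]; exact Nat.mul_le_mul (hk c) (hl c)⟩

theorem add (hf : PolyBounded f) (hg : PolyBounded g) : PolyBounded (fun c => f c + g c) := by
  obtain ⟨k, hk⟩ := hf
  obtain ⟨l, hl⟩ := hg
  refine ⟨k + l + 1, fun c => ?_⟩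
  calc f c + g c ≤ (Context.size c + 2) ^ (k + l) + (Context.size c + 2) ^ (k + l) :=
        add_le_add ((hk c).trans (Nat.pow_le_pow_right (by omega) (by omega)))
          ((hl c).trans (Nat.pow_le_pow_right (by omega) (by omega)))
    _ = (Context.size c + 2) ^ (k + l) * 2 := (mul_two _).symm
    _ ≤ (Context.size c + 2) ^ (k + l) * (Context.size c + 2) :=
        Nat.mul_le_mul_left _ (by omega)
    _ = (Context.size c + 2) ^ (k + l + 1) := (pow_succ _ _).symm

theorem pow (hf : PolyBounded f) (n : ℕ) : PolyBounded (fun c => f c ^ n) := by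
  obtain ⟨k, hk⟩ := hf
  exact ⟨k * n, fun c => by rw [pow_mul]; exact Nat.pow_le_pow_left (hk c) n⟩

theorem weaken (hf : PolyBounded f) : PolyBounded (fun c : Γ × ℕ => f c.1) := by
  obtain ⟨k, hk⟩ := hf
  exact ⟨k, fun c => (hk c.1).trans (Nat.pow_le_pow_left (by rw [size_prod]; omega) _)⟩

theorem exists_forall_le {h : Γ × ℕ → ℕ} {b : Γ → ℕ} (hh : PolyBounded h) (hb : PolyBounded b) :
    ∃ u : Γ → ℕ, PolyBounded u ∧ ∀ c, ∀ i ≤ b c, h (c, i) ≤ u c := by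
  obtain ⟨k, hk⟩ := hh
  refine ⟨fun c => (Context.size c + b c + 2) ^ k, ((size.add hb).add (const 2)).pow k,
    fun c i hi => (hk _).trans (Nat.pow_le_pow_left ?_ _)⟩
  rw [size_prod]
  exact Nat.add_le_add_right (Nat.add_le_add_left hi _) 2

end PolyBounded

end PolyBounded

/-! ### Computation by fragments -/

/-- The stores `s` and `s'` differ at most in the working registers `t, …, B - 1`. -/
structure Store.SameOutside (t B : ℕ) (s s' : Store) : Prop where
  reg : ∀ {r}, r < t ∨ B ≤ r → s'.reg r = s.reg r
  query : s'.query = s.query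
  out : s'.out = s.out

open Store (SameOutside)

/-- The store `s` represents the context `c`: its variables are in the registers `α`, which lie
below the register `t`, and its array starts at the register `B`. -/
structure Represents {Γ : Type} [Context Γ] (α : List ℕ) (t B : ℕ) (s : Store) (c : Γ) : Prop where
  lt : ∀ a ∈ α, a < t
  vars : α.map s.reg = Context.vars c
  array : ∀ j, s.reg (B + j) = (Context.array c j).toNat

/-- Code that is parametrized by the registers `α` of the variables, by the first working register
`t` and by the address `B` of the array. -/
abbrev Code : Type := List ℕ → ℕ → ℕ → Fragment

/-- The code computes `f` in time `τ` into its first working register, with `K` working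
registers. -/
def Computes {Γ : Type} [Context Γ] (f τ : Γ → ℕ) (K : ℕ) (code : Code) : Prop :=
  ∀ {α t B L c s}, t + K ≤ B → Represents α t B s c →
    ∃ s', Executes L (input c) (code α t B) s (τ c) s' ∧ s'.reg t = f c ∧ SameOutside t B s s'

/-- The function `f` of a context is computable in polynomial time. -/
def PolyTime {Γ : Type} [Context Γ] (f : Γ → ℕ) : Prop :=
  PolyBounded f ∧ ∃ τ K code, PolyBounded τ ∧ Computes f τ K code

open Classical in
/-- The property `p` of a context is decidable in polynomial time. -/
def PolyDecidable {Γ : Type} [Context Γ] (p : Γ → Prop) : Prop :=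
  PolyTime fun c => if p c then 1 else 0

namespace Store.SameOutside

variable {t t' B : ℕ} {s s' s'' : Store}

theorem refl : SameOutside t B s s := ⟨fun _ => rfl, rfl, rfl⟩

theorem trans (h : SameOutside t B s s') (h' : SameOutside t B s' s'') : SameOutside t B s s'' :=
  ⟨fun hr => (h'.reg hr).trans (h.reg hr), h'.query.trans h.query, h'.out.trans h.out⟩

theorem mono (h : SameOutside t' B s s') (ht : t ≤ t') : SameOutside t B s s' :=
  ⟨fun hr => h.reg (hr.imp_left fun hr => hr.trans_le ht), h.query, h.out⟩

theorem set (h : SameOutside t B s s') {r v : ℕ} (ht : t ≤ r) (hB : r < B) :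
    SameOutside t B s (s'.set r v) :=
  ⟨fun hr => by rw [reg_set, if_neg (by omega), h.reg hr], h.query, h.out⟩

end Store.SameOutside

section Computation

variable {Γ : Type} [Context Γ] {α : List ℕ} {t t' B : ℕ} {s s' : Store} {c : Γ}
  {L : Language Bool}

theorem Represents.mono (h : Represents α t B s c) (ht : t ≤ t') : Represents α t' B s c :=
  ⟨fun a ha => (h.lt a ha).trans_le ht, h.vars, h.array⟩

theorem Represents.congr_reg (h : Represents α t B s c)
    (hs : ∀ {r}, r < t ∨ B ≤ r → s'.reg r = s.reg r) : Represents α t B s' c where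
  lt := h.lt
  vars := (List.map_congr_left fun a ha => hs (.inl (h.lt a ha))).trans h.vars
  array j := (hs (.inr (Nat.le_add_right B j))).trans (h.array j)

theorem Represents.congr (h : Represents α t B s c) (hs : SameOutside t B s s') :
    Represents α t B s' c :=
  h.congr_reg hs.reg

theorem Represents.cons (h : Represents α t B s c) {i : ℕ} (hi : s.reg t = i) (ht : t < t') :
    Represents (t :: α) t' B s (c, i) where
  lt a ha := by
    rcases List.mem_cons.1 ha with rfl | ha
    · exact ht
    · exact (h.lt a ha).trans ht
  vars := congrArg₂ List.cons hi h.vars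
  array := h.array

/-- The code of `for i < b do P`, where `bound` computes `b` and `P` has the additional variable
`i`. -/
def Code.forLoop (bound P : Code) : Code := fun α t B =>
  (bound α (t + 1) B).seq ((P (t :: α) (t + 3) B).loop t)

theorem Computes.executes_forLoop {b τ : Γ → ℕ} {K σ : ℕ} {bound P : Code}
    (hb : Computes b τ K bound) (hB : t + 3 + K ≤ B) (hs : Represents α t B s c)
    (I : ℕ → Store → Prop)
    (stable : ∀ {k s s'}, SameOutside t B s s' → I k s → I k s')
    (body : ∀ k < b c, ∀ s, s.reg t = k → I k s →
      ∃ s', Executes L (input c) (P (t :: α) (t + 3) B) s σ s' ∧ s'.reg t = k ∧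
        s'.reg (t + 1) = s.reg (t + 1) ∧ I (k + 1) s')
    (h0 : I 0 s) :
    ∃ s', Executes L (input c) (bound.forLoop P α t B) s (τ c + (b c * (σ + 6) + 3)) s' ∧
      I (b c) s' := by
  obtain ⟨s₁, run₁, hs₁, same₁⟩ := hb (L := L) (t := t + 1) (by omega) (hs.mono (by omega))
  have stable_set {k : ℕ} {s : Store} {r v : ℕ} (hr : r = t ∨ r = t + 2) (h : I k s) :
      I k (s.set r v) :=
    stable (SameOutside.refl.set (by omega) (by omega)) h
  obtain ⟨s₂, run₂, h₂⟩ := Executes.loop (L := L) (x := input c) (n := b c) (τ := σ) I stable_set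
    (fun k hk s hi hn hI =>
      let ⟨s', run, hi', hn', hI'⟩ := body k hk s hi hI
      ⟨s', run, hi', hn'.trans hn, hI'⟩)
    hs₁ (stable (same₁.mono (by omega)) h0)
  exact ⟨s₂, run₁.seq run₂, h₂⟩

namespace PolyTime

variable {f g : Γ → ℕ}

theorem const (n : ℕ) : PolyTime (fun _ : Γ => n) := by
  refine ⟨.const n, fun _ => 1, 1, fun _ t _ => .line [.const t n], .const 1, ?_⟩
  intro α t B L c s hB _
  exact ⟨s.set t n, Executes.line rfl s, by simp, SameOutside.refl.set le_rfl hB⟩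

theorem weaken (hf : PolyTime f) : PolyTime (fun c : Γ × ℕ => f c.1) := by
  obtain ⟨hf, τ, K, code, hτ, computes⟩ := hf
  refine ⟨hf.weaken, _, K, fun α => code α.tail, hτ.weaken, ?_⟩
  rintro (_ | ⟨a, α⟩) t B L ⟨c, i⟩ s hB hs
  · cases hs.vars
  · exact computes hB ⟨fun r hr => hs.lt r (List.mem_cons_of_mem a hr),
      (List.cons.inj hs.vars).2, hs.array⟩

/-- Post-processing of a computed value by two-register straight-line code. -/
theorem line (hf : PolyTime f) (hg : PolyBounded g) {n : ℕ} (Q : List ℕ → ℕ → ℕ → List Instr)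
    (straight : ∀ α t B, (Q α t B).all Instr.isStraight)
    (length_le : ∀ α t B, (Q α t B).length ≤ n)
    (spec : ∀ {α t B L c s}, t + 2 ≤ B → Represents α t B s c → s.reg t = f c →
      ((Q α t B).foldl (Store.exec L (input c)) s).reg t = g c ∧
        SameOutside t B s ((Q α t B).foldl (Store.exec L (input c)) s)) : PolyTime g := by
  obtain ⟨-, τ, K, code, hτ, computes⟩ := hf
  refine ⟨hg, fun c => τ c + n, K + 2, fun α t B => (code α t B).seq (.line (Q α t B)),
    hτ.add (.const n), ?_⟩
  intro α t B L c s hB hs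
  obtain ⟨s₁, run₁, h₁, same₁⟩ := computes (L := L) (by omega) hs
  obtain ⟨h₂, same₂⟩ := spec (L := L) (by omega) (hs.congr same₁) h₁
  exact ⟨_, run₁.seq ((Executes.line (straight α t B) s₁).mono (length_le α t B)), h₂,
    same₁.trans same₂⟩

theorem var : PolyTime (fun c : Γ × ℕ => c.2) := by
  refine (const 0).line (n := 1) (PolyBounded.size.mono fun c => by rw [size_prod]; omega)
    (fun α t _ => [.add t t (α.headD 0)]) (fun _ _ _ => rfl) (fun _ _ _ => le_rfl) ?_
  rintro (_ | ⟨a, α⟩) t B L ⟨c, i⟩ s hB hs h0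
  · cases hs.vars
  · have hi : s.reg a = i := (List.cons.inj hs.vars).1
    exact ⟨by simp [h0, hi], SameOutside.refl.set le_rfl (by omega)⟩

theorem length : PolyTime (fun c : Γ => (input c).length) := by
  refine (const 0).line (n := 1) (PolyBounded.size.mono fun c => Nat.le_add_right _ _)
    (fun _ t _ => [.inputLength t]) (fun _ _ _ => rfl) (fun _ _ _ => le_rfl) ?_
  intro α t B L c s hB _ _
  exact ⟨by simp, SameOutside.refl.set le_rfl (by omega)⟩

theorem input_bit (hf : PolyTime f) :
    PolyTime (fun c => if (input c)[f c]? = some true then 1 else 0) := by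
  refine hf.line (n := 1) ((PolyBounded.const 1).mono fun c => by split_ifs <;> omega)
    (fun _ t _ => [.input t t]) (fun _ _ _ => rfl) (fun _ _ _ => le_rfl) ?_
  intro α t B L c s hB _ h
  exact ⟨by simp [h], SameOutside.refl.set le_rfl (by omega)⟩

theorem array_bit (hf : PolyTime f) : PolyTime (fun c => (array c (f c)).toNat) := by
  refine hf.line (n := 3) ((PolyBounded.const 1).mono fun c => Bool.toNat_le _)
    (fun _ t B => [.const (t + 1) B, .add t (t + 1) t, .load t t]) (fun _ _ _ => rfl)
    (fun _ _ _ => le_rfl) ?_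
  intro α t B L c s hB hs h
  have htf : B + f c ≠ t := by omega
  have htf' : B + f c ≠ t + 1 := by omega
  refine ⟨by simp [h, htf, htf', hs.array], ?_⟩
  exact ((SameOutside.refl.set (by omega) (by omega)).set (by omega) (by omega)).set
    (by omega) (by omega)

theorem binary (hf : PolyTime f) (hg : PolyTime g) {h : Γ → ℕ} (hh : PolyBounded h)
    (i : ℕ → Instr) (straight : ∀ t, (i t).isStraight)
    (spec : ∀ {t L c} {s : Store}, s.reg t = f c → s.reg (t + 1) = g c →
      s.exec L (input c) (i t) = s.set t (h c)) : PolyTime h := by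
  obtain ⟨-, τ, K, code, hτ, computes⟩ := hf
  obtain ⟨-, τ', K', code', hτ', computes'⟩ := hg
  refine ⟨hh, fun c => τ c + τ' c + 1, K + K' + 1, fun α t B =>
    ((code α t B).seq (code' α (t + 1) B)).seq (.line [i t]), (hτ.add hτ').add (.const 1), ?_⟩
  intro α t B L c s hB hs
  obtain ⟨s₁, run₁, h₁, same₁⟩ := computes (L := L) (by omega) hs
  obtain ⟨s₂, run₂, h₂, same₂⟩ := computes' (L := L) (t := t + 1) (by omega)
    ((hs.congr same₁).mono (by omega))
  have run₃ := Executes.line (L := L) (x := input c) (l := [i t])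
    (by simp only [List.all_cons, straight, List.all_nil, Bool.and_self]) s₂
  rw [List.foldl_cons, List.foldl_nil, spec ((same₂.reg (by omega)).trans h₁) h₂] at run₃
  exact ⟨_, (run₁.seq run₂).seq run₃, by simp,
    (same₁.trans (same₂.mono (by omega))).set le_rfl (by omega)⟩

theorem add (hf : PolyTime f) (hg : PolyTime g) : PolyTime (fun c => f c + g c) :=
  hf.binary hg (hf.1.add hg.1) (fun t => .add t t (t + 1)) (fun _ => rfl)
    fun h h' => by rw [Store.exec_add, h, h']

theorem sub (hf : PolyTime f) (hg : PolyTime g) : PolyTime (fun c => f c - g c) :=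
  hf.binary hg (hf.1.mono fun _ => Nat.sub_le _ _) (fun t => .sub t t (t + 1)) (fun _ => rfl)
    fun h h' => by rw [Store.exec_sub, h, h']

theorem sum {b : Γ → ℕ} {g : Γ → ℕ → ℕ} (hb : PolyTime b)
    (hg : PolyTime (fun c : Γ × ℕ => g c.1 c.2)) :
    PolyTime (fun c => ∑ i ∈ Finset.range (b c), g c i) := by
  obtain ⟨hb, τ, K, code, hτ, computes⟩ := hb
  obtain ⟨hg, τ', K', code', hτ', computes'⟩ := hg
  obtain ⟨u, hu, le_u⟩ := hg.exists_forall_le hb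
  obtain ⟨σ, hσ, le_σ⟩ := hτ'.exists_forall_le hb
  have bounded : PolyBounded fun c => ∑ i ∈ Finset.range (b c), g c i :=
    (hb.mul hu).mono fun c => (Finset.sum_le_card_nsmul _ _ (u c) fun i hi =>
      le_u c i (Finset.mem_range.1 hi).le).trans_eq (by rw [Finset.card_range, smul_eq_mul])
  refine ⟨bounded, fun c => 1 + (τ c + (b c * (σ c + 1 + 6) + 3)), K + K' + 5, fun α t B =>
    Fragment.seq (.line [.const t 0]) (Code.forLoop code
      (fun α i B => (code' α i B).seq (.line [.add t t i])) α (t + 1) B),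
    (PolyBounded.const 1).add (hτ.add ((hb.mul ((hσ.add (.const 1)).add (.const 6))).add
      (.const 3))), ?_⟩
  intro α t B L c s hB hs
  have zeroed : SameOutside t B s (s.set t 0) := SameOutside.refl.set le_rfl (by omega)
  obtain ⟨s', run, acc, same⟩ := computes.executes_forLoop (L := L) (σ := σ c + 1) (by omega)
    ((hs.congr zeroed).mono (Nat.le_succ t))
    (P := fun α i B => (code' α i B).seq (.line [.add t t i]))
    (fun k s' => s'.reg t = ∑ i ∈ Finset.range k, g c i ∧ SameOutside t B s s')
    (fun same h => ⟨(same.reg (by omega)).trans h.1, h.2.trans (same.mono (by omega))⟩)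
    (fun k hk s' hi ⟨acc, same⟩ => by
      obtain ⟨s₁, run₁, h₁, same₁⟩ := computes' (L := L) (t := t + 1 + 3) (by omega)
        (((hs.congr same).mono (Nat.le_succ t)).cons hi (by omega))
      refine ⟨_, (run₁.mono (le_σ c k hk.le)).seq (Executes.line rfl s₁), ?_, ?_, ?_,
        (same.trans (same₁.mono (by omega))).set le_rfl (by omega)⟩
      · rw [List.foldl_cons, List.foldl_nil, Store.exec_add, Store.reg_set, if_neg (by omega),
          same₁.reg (by omega), hi]
      · rw [List.foldl_cons, List.foldl_nil, Store.exec_add, Store.reg_set, if_neg (by omega),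
          same₁.reg (by omega)]
      · rw [List.foldl_cons, List.foldl_nil, Store.exec_add, Store.reg_set, if_pos rfl,
          same₁.reg (by omega), acc, h₁, Finset.sum_range_succ])
    ⟨by simp, zeroed⟩
  exact ⟨s', (Executes.line rfl s).seq run, acc, same⟩

end PolyTime

end Computation

theorem PolyTime.setOf_ne_zero_mem_PTIME {f : List Bool × (ℕ → Bool) → ℕ} (hf : PolyTime f) :
    ({v | f (v, fun _ => false) ≠ 0} : Language Bool) ∈ PTIME := by
  obtain ⟨-, τ, K, code, ⟨k, hk⟩, computes⟩ := hf
  refine ⟨code [] 0 K 0, (Polynomial.X + Polynomial.C 2) ^ k, fun v => ?_⟩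
  obtain ⟨s, run, hs, -⟩ := computes (α := []) (t := 0) (B := K) (L := 0)
    (c := (v, fun _ => false)) (s := ⟨fun _ => 0, [], []⟩) (by omega)
    ⟨fun _ h => (List.not_mem_nil h).elim, rfl, fun _ => rfl⟩
  obtain ⟨n, hn, final, -⟩ := run _ 0 (CodeAt.refl _)
  refine ⟨n, hn.trans ((hk _).trans_eq (by simp [Context.size, input, vars])), ?_⟩
  have final : TeamEnum.run (code [] 0 K 0) 0 v n = s.config (0 + (code [] 0 K 0).length) := final
  rw [final]
  refine ⟨by simp [Halted, Store.config], ?_⟩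
  simp only [Store.config, hs]
  rfl

/-! ### Closure properties -/

section Closure

variable {Γ : Type} [Context Γ]

open Classical in
/-- The length of the longest prefix of the bits `p 0, …, p (b - 1)` that consists of `true`s. -/
noncomputable def leadingLength (b : ℕ) (p : ℕ → Prop) : ℕ :=
  ∑ i ∈ Finset.range b, if ∀ j < i + 1, p j then 1 else 0

theorem leadingLength_eq {b n : ℕ} {p : ℕ → Prop} (hn : n < b) (h : ∀ j < n, p j) (h' : ¬ p n) :
    leadingLength b p = n := by
  classical
  have prefixes : (Finset.range b).filter (fun i => ∀ j < i + 1, p j) = Finset.range n := by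
    ext i
    simp only [Finset.mem_filter, Finset.mem_range]
    refine ⟨fun ⟨_, hi⟩ => ?_, fun hi => ⟨by omega, fun j hj => h j (by omega)⟩⟩
    by_contra hni
    exact h' (hi n (by omega))
  rw [leadingLength, ← Finset.sum_filter, ← Finset.card_eq_sum_ones, prefixes, Finset.card_range]

theorem leadingLength_spec {b : ℕ} {p : ℕ → Prop} (h : leadingLength b p < b) :
    (∀ j < leadingLength b p, p j) ∧ ¬ p (leadingLength b p) := by
  classical
  have failure : ∃ j, j < b ∧ ¬ p j := by
    by_contra! all
    have leading_eq : leadingLength b p = b := by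
      rw [leadingLength, Finset.sum_congr rfl fun i hi => if_pos fun j hj =>
        all j (hj.trans_le (Finset.mem_range.1 hi)), Finset.sum_const, Finset.card_range,
        smul_eq_mul, mul_one]
    exact h.ne leading_eq
  obtain ⟨lt, not_p⟩ := Nat.find_spec failure
  have before (j) (hj : j < Nat.find failure) : p j :=
    by_contra fun hpj => Nat.find_min failure hj ⟨hj.trans lt, hpj⟩
  rw [leadingLength_eq lt before not_p]
  exact ⟨before, not_p⟩

namespace PolyTime

variable {f g : Γ → ℕ}

theorem congr (hf : PolyTime f) (h : ∀ c, g c = f c) : PolyTime g := by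
  rwa [funext h]

theorem mul (hf : PolyTime f) (hg : PolyTime g) : PolyTime (fun c => f c * g c) :=
  (hf.sum (g := fun c _ => g c) hg.weaken).congr fun c => by
    rw [Finset.sum_const, Finset.card_range, smul_eq_mul]

theorem pow (hf : PolyTime f) (k : ℕ) : PolyTime (fun c => f c ^ k) := by
  induction k with
  | zero => exact const 1
  | succ k ih => exact (ih.mul hf).congr fun c => pow_succ _ _

theorem finset_sum {ι : Type*} (s : Finset ι) {f : ι → Γ → ℕ} (hf : ∀ i ∈ s, PolyTime (f i)) :
    PolyTime (fun c => ∑ i ∈ s, f i c) := by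
  classical
  induction s using Finset.induction_on with
  | empty => exact const 0
  | insert i s hi ih =>
    exact ((hf i (s.mem_insert_self i)).add
      (ih fun j hj => hf j (Finset.mem_insert_of_mem hj))).congr fun c => Finset.sum_insert hi

theorem var₁ : PolyTime (fun c : (Γ × ℕ) × ℕ => c.1.2) := var.weaken

theorem var₂ : PolyTime (fun c : ((Γ × ℕ) × ℕ) × ℕ => c.1.1.2) := var₁.weaken

end PolyTime

namespace PolyDecidable

variable {f g : Γ → ℕ} {p q : Γ → Prop}

theorem congr (hp : PolyDecidable p) (h : ∀ c, q c ↔ p c) : PolyDecidable q := by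
  rwa [funext fun c => propext (h c)]

theorem polyTime_ite_one [DecidablePred p] (hp : PolyDecidable p) :
    PolyTime (fun c => if p c then 1 else 0) :=
  PolyTime.congr hp fun c => by congr

theorem lt (hf : PolyTime f) (hg : PolyTime g) : PolyDecidable (fun c => f c < g c) :=
  ((PolyTime.const 1).sub ((PolyTime.const 1).sub (hg.sub hf))).congr fun c => by
    split_ifs <;> omega

theorem le (hf : PolyTime f) (hg : PolyTime g) : PolyDecidable (fun c => f c ≤ g c) :=
  (lt hf (hg.add (.const 1))).congr fun _ => Nat.lt_succ_iff.symm

theorem not (hp : PolyDecidable p) : PolyDecidable (fun c => ¬ p c) :=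
  ((PolyTime.const 1).sub hp).congr fun c => by by_cases h : p c <;> simp [h]

theorem and (hp : PolyDecidable p) (hq : PolyDecidable q) : PolyDecidable (fun c => p c ∧ q c) :=
  (PolyTime.mul hp hq).congr fun c => by
    by_cases hp : p c <;> by_cases hq : q c <;> simp [hp, hq]

theorem or (hp : PolyDecidable p) (hq : PolyDecidable q) : PolyDecidable (fun c => p c ∨ q c) :=
  (hp.not.and hq.not).not.congr fun _ => or_iff_not_and_not

theorem imp (hp : PolyDecidable p) (hq : PolyDecidable q) : PolyDecidable (fun c => p c → q c) :=
  (hp.not.or hq).congr fun _ => imp_iff_not_or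

theorem iff (hp : PolyDecidable p) (hq : PolyDecidable q) : PolyDecidable (fun c => p c ↔ q c) :=
  ((hp.imp hq).and (hq.imp hp)).congr fun _ => iff_iff_implies_and_implies

theorem eq (hf : PolyTime f) (hg : PolyTime g) : PolyDecidable (fun c => f c = g c) :=
  ((le hf hg).and (le hg hf)).congr fun _ => le_antisymm_iff

theorem input_bit (hf : PolyTime f) : PolyDecidable (fun c => (input c)[f c]? = some true) :=
  hf.input_bit.congr fun c => by congr

theorem array_bit (hf : PolyTime f) : PolyDecidable (fun c => array c (f c) = true) :=
  hf.array_bit.congr fun c => by cases h : array c (f c) <;> simp [h]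

theorem exists_lt {b : Γ → ℕ} {p : Γ → ℕ → Prop} (hb : PolyTime b)
    (hp : PolyDecidable (fun c : Γ × ℕ => p c.1 c.2)) :
    PolyDecidable (fun c => ∃ i < b c, p c i) := by
  classical
  refine (lt (.const 0) (hb.sum (g := fun c i => if p c i then 1 else 0)
    hp.polyTime_ite_one)).congr fun c => ?_
  simp only [Finset.sum_pos_iff, Finset.mem_range]
  refine exists_congr fun i => and_congr_right fun _ => ?_
  split_ifs with h <;> simp only [h, Nat.zero_lt_one, lt_irrefl]

theorem forall_lt {b : Γ → ℕ} {p : Γ → ℕ → Prop} (hb : PolyTime b)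
    (hp : PolyDecidable (fun c : Γ × ℕ => p c.1 c.2)) : PolyDecidable (fun c => ∀ i < b c, p c i) :=
  (exists_lt hb (p := fun c i => ¬ p c i) hp.not).not.congr fun c => by
    simp only [not_exists, not_and, not_not]

theorem finset_forall {ι : Type*} (s : Finset ι) {p : ι → Γ → Prop}
    (hp : ∀ i ∈ s, PolyDecidable (p i)) : PolyDecidable (fun c => ∀ i ∈ s, p i c) := by
  classical
  induction s using Finset.induction_on with
  | empty => exact (le (.const 0) (.const 0)).congr fun c => by simp
  | insert i s _ ih =>
    exact ((hp i (s.mem_insert_self i)).and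
      (ih fun j hj => hp j (Finset.mem_insert_of_mem hj))).congr
        fun c => Finset.forall_mem_insert ..

theorem forall_fin {k : ℕ} {p : Fin k → Γ → Prop} (hp : ∀ i, PolyDecidable (p i)) :
    PolyDecidable (fun c => ∀ i, p i c) :=
  (finset_forall Finset.univ fun i _ => hp i).congr fun c => by
    simp only [Finset.mem_univ, forall_const]

end PolyDecidable

namespace PolyTime

variable {f g : Γ → ℕ}

theorem ite {p : Γ → Prop} [DecidablePred p] (hp : PolyDecidable p) (hf : PolyTime f)
    (hg : PolyTime g) : PolyTime (fun c => if p c then f c else g c) :=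
  ((mul hp hf).add (mul hp.not hg)).congr fun c => by by_cases h : p c <;> simp [h]

theorem div (hf : PolyTime f) (hg : PolyTime g) : PolyTime (fun c => f c / g c) := by
  refine (hf.sum (g := fun c i => if 0 < g c ∧ (i + 1) * g c ≤ f c then 1 else 0)
    ((PolyDecidable.lt (const 0) hg.weaken).and
      (.le ((var.add (const 1)).mul hg.weaken) hf.weaken)).polyTime_ite_one).congr fun c => ?_
  rw [← Finset.sum_filter, ← Finset.card_eq_sum_ones]
  rcases Nat.eq_zero_or_pos (g c) with h | h
  · simp [h]
  · have multiples : (Finset.range (f c)).filter (fun i => 0 < g c ∧ (i + 1) * g c ≤ f c) =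
        Finset.range (f c / g c) := by
      ext i
      simp only [Finset.mem_filter, Finset.mem_range, h, true_and, ← Nat.le_div_iff_mul_le h]
      have := Nat.div_le_self (f c) (g c)
      omega
    rw [multiples, Finset.card_range]

theorem mod (hf : PolyTime f) (hg : PolyTime g) : PolyTime (fun c => f c % g c) :=
  (hf.sub (hg.mul (hf.div hg))).congr fun c =>
    Nat.eq_sub_of_add_eq (Nat.mod_add_div (f c) (g c))

theorem leadingLength {b : Γ → ℕ} {p : Γ → ℕ → Prop} (hb : PolyTime b)
    (hp : PolyDecidable (fun c : (Γ × ℕ) × ℕ => p c.1.1 c.2)) :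
    PolyTime (fun c => leadingLength (b c) (p c)) := by
  classical
  refine hb.sum (g := fun c i => if ∀ j < i + 1, p c j then 1 else 0) ?_
  exact (PolyDecidable.forall_lt (p := fun (c : Γ × ℕ) j => p c.1 j) (var.add (const 1))
    hp).polyTime_ite_one

end PolyTime

end Closure

/-! ### Writing words -/

/-- The oracle question and the output word, both of which are written bit by bit. -/
inductive Tape : Type
  | query
  | output

/-- The instruction that appends a bit to a tape. -/
def Tape.write : Tape → ℕ → Instr
  | query => .writeQuery
  | output => .writeOutput

/-- The store after the word `w` has been written on a tape. -/
def Store.append (s : Store) : Tape → List Bool → Store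
  | .query, w => { s with query := s.query ++ w }
  | .output, w => { s with out := s.out ++ w }

namespace Store

variable {s s' : Store} {T : Tape} {t B : ℕ}

theorem reg_append (w : List Bool) : (s.append T w).reg = s.reg := by
  cases T <;> rfl

theorem append_nil : s.append T [] = s := by
  cases T <;> simp only [append, List.append_nil]

theorem append_append (v w : List Bool) : (s.append T v).append T w = s.append T (v ++ w) := by
  cases T <;> simp only [append, List.append_assoc]

theorem exec_write (L : Language Bool) (x : List Bool) (r : ℕ) :
    s.exec L x (T.write r) = s.append T [decide (s.reg r ≠ 0)] := by
  cases T <;> rfl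

theorem SameOutside.append (h : SameOutside t B s s') (w : List Bool) :
    SameOutside t B (s.append T w) (s'.append T w) := by
  cases T
  · exact ⟨h.reg, congrArg (· ++ w) h.query, h.out⟩
  · exact ⟨h.reg, h.query, congrArg (· ++ w) h.out⟩

end Store

section Emission

variable {Γ : Type} [Context Γ] {w : Γ → List Bool}

/-- The word `w` of a context can be written down in polynomial time. -/
def PolyWritable (w : Γ → List Bool) : Prop :=
  PolyTime (fun c => (w c).length) ∧
    PolyDecidable (fun c : Γ × ℕ => (w c.1)[c.2]? = some true)

/-- The code writes `w` on the tape `T` in time `τ`, with `K` working registers. -/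
def Emits (T : Tape) (w : Γ → List Bool) (τ : Γ → ℕ) (K : ℕ) (code : Code) : Prop :=
  ∀ {α t B L c s}, t + K ≤ B → Represents α t B s c →
    ∃ s', Executes L (input c) (code α t B) s (τ c) s' ∧ SameOutside t B (s.append T (w c)) s'

theorem take_succ_eq_append {v : List Bool} {k : ℕ} (hk : k < v.length) :
    v.take (k + 1) = v.take k ++ [decide (v[k]? = some true)] := by
  rw [List.take_succ_eq_append_getElem hk, List.getElem?_eq_getElem hk]
  simp only [Option.some.injEq, Bool.decide_eq_true]

theorem PolyWritable.exists_emits (hw : PolyWritable w) (T : Tape) :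
    ∃ τ K code, PolyBounded τ ∧ Emits T w τ K code := by
  obtain ⟨⟨hb, τ, K, code, hτ, computes⟩, -, τ', K', code', hτ', computes'⟩ := hw
  obtain ⟨σ, hσ, le_σ⟩ := hτ'.exists_forall_le hb
  refine ⟨fun c => τ c + ((w c).length * (σ c + 1 + 6) + 3), K + K' + 4, Code.forLoop code
    (fun α t B => (code' α t B).seq (.line [T.write t])),
    hτ.add ((hb.mul ((hσ.add (.const 1)).add (.const 6))).add (.const 3)), ?_⟩
  intro α t B L c s hB hs
  obtain ⟨s', run, same⟩ := computes.executes_forLoop (L := L) (σ := σ c + 1) (by omega) hs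
    (P := fun α t B => (code' α t B).seq (.line [T.write t]))
    (fun k s' => SameOutside t B (s.append T ((w c).take k)) s')
    (fun same h => h.trans same)
    (fun k hk s' hi same => by
      have rep : Represents α t B s' c :=
        hs.congr_reg fun hr => by simpa only [Store.reg_append] using same.reg hr
      obtain ⟨s₁, run₁, h₁, same₁⟩ := computes' (L := L) (t := t + 3) (by omega)
        (rep.cons hi (by omega))
      have straight : [T.write (t + 3)].all Instr.isStraight := by cases T <;> rfl
      refine ⟨_, (run₁.mono (le_σ c k hk.le)).seq (Executes.line straight s₁), ?_, ?_, ?_⟩ <;>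
        rw [List.foldl_cons, List.foldl_nil, Store.exec_write]
      · rw [Store.reg_append, same₁.reg (by omega), hi]
      · rw [Store.reg_append, same₁.reg (by omega)]
      · have bit : decide (s₁.reg (t + 3) ≠ 0) = decide ((w c)[k]? = some true) := by
          rw [h₁]
          by_cases h : (w c)[k]? = some true <;> simp [h]
        rw [bit, take_succ_eq_append hk, ← Store.append_append]
        exact (same.trans (same₁.mono (by omega))).append _)
    (by simpa only [List.take_zero, Store.append_nil] using SameOutside.refl)
  exact ⟨s', run, by rwa [List.take_length] at same⟩

end Emission

/-! ## Rounds of oracle questions -/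

/-- The input word and the array of bits that a machine carries from one round to the next. -/
abbrev State : Type := List Bool × (ℕ → Bool)

/-- An enumeration algorithm that works in rounds. A round replaces the first `numBits` bits of the
array, one after the other, by the answers to oracle questions, where `question (c, i)` is the
question for bit `i` in the current state `c`; afterwards the round outputs a word, or stops the
machine. -/
structure RoundScheme where
  numBits : State → ℕ
  question : State × ℕ → List Bool
  continues : State → Prop
  output : State → List Bool
  polyTime_numBits : PolyTime numBits
  polyWritable_question : PolyWritable question
  polyDecidable_continues : PolyDecidable continues
  polyWritable_output : PolyWritable output

open Classical in
/-- The bits number `0, …, k - 1` of the array `a` are replaced, one after the other, by the truth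
values of `P`. -/
noncomputable def fill (P : (ℕ → Bool) → ℕ → Prop) (a : ℕ → Bool) : ℕ → ℕ → Bool
  | 0 => a
  | k + 1 => Function.update (fill P a k) k (decide (P (fill P a k) k))

namespace RoundScheme

variable (R : RoundScheme) (L : Language Bool) (x : List Bool)

/-- The array after a round that starts with the array `a`. -/
noncomputable def next (a : ℕ → Bool) : ℕ → Bool :=
  fill (fun a i => R.question ((x, a), i) ∈ L) a (R.numBits (x, a))

/-- Started with an array, the rounds output the words of a list and then stop. -/
def Yields : (ℕ → Bool) → List (List Bool) → Prop
  | a, [] => ¬ R.continues (x, R.next L x a)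
  | a, w :: ws => R.continues (x, R.next L x a) ∧ R.output (x, R.next L x a) = w ∧
      Yields (R.next L x a) ws

end RoundScheme

/-! ### The machine of a round scheme -/

/-- The array `a` is stored from register `B` on, and both tapes are empty. -/
structure Store.Holds (B : ℕ) (a : ℕ → Bool) (s : Store) : Prop where
  array : ∀ j, s.reg (B + j) = (a j).toNat
  query : s.query = []
  out : s.out = []

/-- The store at the beginning of a round. -/
def roundStore (B : ℕ) (a : ℕ → Bool) : Store :=
  ⟨fun r => if r < B then 0 else (a (r - B)).toNat, [], []⟩

section RoundMachine

variable {B t : ℕ} {a : ℕ → Bool} {s s' : Store} {L : Language Bool} {x : List Bool}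

theorem Store.Holds.represents (h : s.Holds B a) : Represents [] t B s (x, a) :=
  ⟨fun _ h => (List.not_mem_nil h).elim, rfl, h.array⟩

theorem Store.Holds.congr (h : s.Holds B a) (hs : SameOutside t B s s') : s'.Holds B a :=
  ⟨fun j => (hs.reg (.inr (Nat.le_add_right B j))).trans (h.array j), hs.query.trans h.query,
    hs.out.trans h.out⟩

theorem holds_roundStore : (roundStore B a).Holds B a :=
  ⟨fun j => by simp [roundStore], rfl, rfl⟩

theorem roundStore_zero : (roundStore B fun _ => false).config 0 = Config.init := by
  simp [roundStore, Store.config, Config.init]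

/-- Ask the oracle and store the answer as bit number `R i` of the array. -/
def answerCode (i t B : ℕ) : List Instr :=
  [.ask t, .const (t + 1) B, .add (t + 1) (t + 1) i, .store (t + 1) t]

open Classical in
theorem foldl_answerCode {i : ℕ} (hi : i < t) (hB : t + 2 ≤ B) {q : List Bool}
    (hs : SameOutside t B (s.append .query q) s') (h : s.Holds B a) :
    ((answerCode i t B).foldl (Store.exec L x) s').Holds B
      (Function.update a (s.reg i) (decide (q ∈ L))) ∧
    ∀ r < t, ((answerCode i t B).foldl (Store.exec L x) s').reg r = s.reg r := by
  have hq : s'.query = q := by rw [hs.query, Store.append, h.query, List.nil_append]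
  have hreg (r : ℕ) (hr : r < t ∨ B ≤ r) : s'.reg r = s.reg r := hs.reg hr
  have hit : i ≠ t := hi.ne
  have hit' : i ≠ t + 1 := by omega
  have final : (answerCode i t B).foldl (Store.exec L x) s' =
      ⟨Function.update (Function.update (Function.update s'.reg t (if q ∈ L then 1 else 0)) (t + 1)
        (B + s.reg i)) (B + s.reg i) (if q ∈ L then 1 else 0), [], s'.out⟩ := by
    simp [answerCode, Store.exec, Store.config, TeamEnum.exec, Config.set, hq, hit, hit', hreg,
      hi]
  rw [final]
  refine ⟨⟨fun j => ?_, rfl, hs.out.trans h.out⟩, fun r hr => ?_⟩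
  · by_cases hj : j = s.reg i
    · subst hj
      by_cases hL : q ∈ L <;> simp [hL]
    · have ht : B + j ≠ t := by omega
      have ht' : B + j ≠ t + 1 := by omega
      simp [hj, ht, ht', hreg, h.array]
  · have ht' : r ≠ t + 1 := by omega
    have hBr : r ≠ B + s.reg i := by omega
    simp [hr.ne, ht', hBr, hreg, hr]

end RoundMachine

section RoundMachine

variable {B t : ℕ} {a : ℕ → Bool} {s s' : Store} {L : Language Bool} {x : List Bool}

theorem RoundScheme.exists_executes_next (R : RoundScheme) :
    ∃ (k K : ℕ) (P : ℕ → Fragment), ∀ {B L x a s}, K ≤ B → s.Holds B a →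
      ∃ s', Executes L x (P B) s ((x.length + 2) ^ k) s' ∧ s'.Holds B (R.next L x a) := by
  obtain ⟨hb, τ, K, code, hτ, computes⟩ := R.polyTime_numBits
  obtain ⟨τ', K', code', ⟨k', hτ'⟩, emits⟩ := R.polyWritable_question.exists_emits .query
  let body : Code := fun α t B => (code' α t B).seq (.line (answerCode (α.headD 0) t B))
  obtain ⟨k, hk⟩ : PolyBounded fun c : State =>
      τ c + (R.numBits c * ((size c + R.numBits c + 2) ^ k' + 4 + 6) + 3) :=
    hτ.add ((hb.mul (((((PolyBounded.size.add hb).add (.const 2)).pow k').add (.const 4)).add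
      (.const 6))).add (.const 3))
  refine ⟨k, K + K' + 5, fun B => code.forLoop body [] 0 B, fun {B L x a s} hB hs => ?_⟩
  obtain ⟨s', run, holds⟩ := computes.executes_forLoop (L := L) (t := 0) (c := (x, a)) (P := body)
    (σ := (size (x, a) + R.numBits (x, a) + 2) ^ k' + 4) (by omega) hs.represents
    (fun k s' => s'.Holds B (fill (fun a i => R.question ((x, a), i) ∈ L) a k))
    (fun same h => h.congr same)
    (fun k hk s₀ hi h => by
      obtain ⟨s₁, run₁, same₁⟩ := emits (L := L) (t := 3) (by omega)
        ((h.represents (x := x) (t := 0)).cons hi (by omega))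
      obtain ⟨holds, regs⟩ := foldl_answerCode (x := x) (L := L) (t := 3) (i := 0) (by omega)
        (by omega) same₁ h
      rw [hi] at holds
      refine ⟨_, (run₁.mono ((hτ' _).trans (Nat.pow_le_pow_left ?_ k'))).seq
        (Executes.line rfl s₁), (regs 0 (by omega)).trans hi, regs 1 (by omega), holds⟩
      rw [size_prod]
      exact Nat.add_le_add_right (Nat.add_le_add_left hk.le (size (x, a))) 2)
    hs
  exact ⟨s', run.mono (hk (x, a)), holds⟩

/-- Set the registers `0, …, B - 1` to `0`. -/
def clearCode (B : ℕ) : List Instr := (List.range B).map fun r => .const r 0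

theorem foldl_clearCode :
    (clearCode B).foldl (Store.exec L x) s =
      { s with reg := fun r => if r < B then 0 else s.reg r } := by
  induction B with
  | zero => rfl
  | succ B ih =>
    have split : clearCode (B + 1) = clearCode B ++ [.const B 0] := by
      simp only [clearCode, List.range_succ, List.map_append, List.map_cons, List.map_nil]
    rw [split, List.foldl_append, ih, List.foldl_cons, List.foldl_nil, Store.exec_const]
    simp only [Store.set, Store.mk.injEq, and_true]
    funext r
    simp only [Function.update_apply]
    grind

/-- The program that repeats: execute `P`; halt if register `0` is zero; execute `Q`; output a
solution; clear the registers below `B`. -/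
def roundProgram (P Q : Fragment) (B : ℕ) : Program :=
  P 0 ++ ([.jz 0 ((P 0).length + 1 + (Q ((P 0).length + 1)).length + 1 + B + 1)] ++
    (Q ((P 0).length + 1) ++ ([.output] ++ (clearCode B ++ [.jz 0 0]))))

theorem length_clearCode : (clearCode B).length = B := by
  rw [clearCode, List.length_map, List.length_range]

/-- The program `M` performs the rounds of `R`, with at most `D` steps before and after the output
of each round. -/
structure RoundScheme.Implements (R : RoundScheme) (M : Program) (B : ℕ) (L : Language Bool)
    (x : List Bool) (D : ℕ) : Prop where
  halts : ∀ a, ¬ R.continues (x, R.next L x a) →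
    ∃ c, Reaches M L x ((roundStore B a).config 0) D c ∧ Halted M c
  output : ∀ a, R.continues (x, R.next L x a) →
    ∃ c, Reaches M L x ((roundStore B a).config 0) D c ∧ Outputs M c (R.output (x, R.next L x a)) ∧
      Reaches M L x (step M L x c) D ((roundStore B (R.next L x a)).config 0)

theorem reaches_roundStore {P Q : Fragment} (hB : 0 < B)
    (hs : ∀ j, s.reg (B + j) = (a j).toNat) (hq : s.query = []) {M : Program}
    (hM : M = roundProgram P Q B) {p : ℕ}
    (hp : p = (P 0).length + 1 + (Q ((P 0).length + 1)).length) :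
    Outputs M (s.config p) s.out ∧
      Reaches M L x (step M L x (s.config p)) (B + 1) ((roundStore B a).config 0) := by
  have code : CodeAt M p ([.output] ++ (clearCode B ++ [.jz 0 0])) := by
    rw [hM, hp]
    have := ((CodeAt.refl (roundProgram P Q B)).right.right).right
    rwa [zero_add, List.length_singleton] at this
  have cleared : (clearCode B).foldl (Store.exec L x) { s with out := [] } = roundStore B a := by
    rw [foldl_clearCode, roundStore, hq]
    simp only [Store.mk.injEq, and_true]
    funext r
    split_ifs with hr
    · rfl
    · obtain ⟨j, rfl⟩ := Nat.exists_eq_add_of_le (not_lt.1 hr)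
      rw [hs, Nat.add_sub_cancel_left]
  have straight : (clearCode B).all Instr.isStraight := by
    simp [clearCode, Instr.isStraight]
  have clear := Executes.line (L := L) (x := x) straight { s with out := [] } M (p + 1)
    code.right.left
  rw [cleared, length_clearCode] at clear
  have repeated := Reaches.jump (L := L) (x := x) (s := roundStore B a)
    code.right.right.getElem? (by simp [roundStore, hB])
  refine ⟨⟨code.getElem?, rfl⟩, ?_⟩
  rw [step_eq_exec (i := .output) (c := s.config p) code.getElem?]
  exact clear.trans repeated

theorem RoundScheme.exists_reaches_decision (R : RoundScheme) :
    ∃ (k K : ℕ) (P : ℕ → Fragment), ∀ {M : Program} {B : ℕ}, K ≤ B → CodeAt M 0 (P B 0) →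
      ∀ L x a, ∃ s : Store, Reaches M L x ((roundStore B a).config 0) ((x.length + 2) ^ k)
        (s.config (P B 0).length) ∧ s.Holds B (R.next L x a) ∧
        (s.reg 0 = 0 ↔ ¬ R.continues (x, R.next L x a)) := by
  obtain ⟨k₁, K₁, P₁, hP₁⟩ := R.exists_executes_next
  obtain ⟨-, τ, K₂, P₂, hτ, hP₂⟩ := R.polyDecidable_continues
  obtain ⟨k, hk⟩ : PolyBounded fun c : State => (size c + 2) ^ k₁ + τ c :=
    ((PolyBounded.size.add (.const 2)).pow k₁).add hτ
  refine ⟨k, K₁ + K₂, fun B => (P₁ B).seq (P₂ [] 0 B), fun {M B} hB code L x a => ?_⟩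
  obtain ⟨s₁, run₁, holds₁⟩ := hP₁ (L := L) (x := x) (show K₁ ≤ B by omega) holds_roundStore
  obtain ⟨s₂, run₂, value, same⟩ := hP₂ (L := L) (t := 0) (show 0 + K₂ ≤ B by omega)
    (holds₁.represents (x := x))
  have reach := (run₁.seq run₂) M 0 code
  rw [zero_add] at reach
  refine ⟨s₂, reach.mono (hk (x, R.next L x a)), holds₁.congr same, ?_⟩
  rw [value]
  by_cases h : R.continues (x, R.next L x a) <;> simp [h]

theorem RoundScheme.exists_implements (R : RoundScheme) :
    ∃ (M : Program) (B k : ℕ), ∀ L x, R.Implements M B L x ((x.length + 2) ^ k) := by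
  obtain ⟨k₁, K₁, P₁, hP⟩ := R.exists_reaches_decision
  obtain ⟨τ, K₂, P₂, hτ, hQ⟩ := R.polyWritable_output.exists_emits .output
  let B := K₁ + K₂ + 1
  let P := P₁ B
  let Q := P₂ [] 0 B
  obtain ⟨k, hk⟩ : PolyBounded fun c : State => (size c + 2) ^ k₁ + 1 + τ c + (B + 1) :=
    ((((PolyBounded.size.add (.const 2)).pow k₁).add (.const 1)).add hτ).add (.const (B + 1))
  let M := roundProgram P Q B
  have code := (CodeAt.refl M).right
  rw [zero_add] at code
  refine ⟨M, B, k, fun L x => ⟨fun a stops => ?_, fun a continues => ?_⟩⟩ <;>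
    obtain ⟨s, reach, holds, hs⟩ := hP (show K₁ ≤ B by omega) (CodeAt.refl M).left L x a <;>
    have bound : (x.length + 2) ^ k₁ + 1 + τ (x, R.next L x a) + (B + 1) ≤ (x.length + 2) ^ k :=
      hk (x, R.next L x a)
  · refine ⟨_, (reach.trans (Reaches.jump code.left.getElem? (hs.2 stops))).mono (by omega), ?_⟩
    simp only [Halted, Store.config, M, roundProgram, List.getElem?_eq_none_iff, List.length_append,
      List.length_singleton, length_clearCode]
    omega
  · obtain ⟨s', run, same⟩ := hQ (L := L) (t := 0) (show 0 + K₂ ≤ B by omega)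
      (holds.represents (x := x))
    have enter := Reaches.no_jump (L := L) (x := x) (s := s) code.left.getElem?
      (fun h => hs.1 h continues)
    obtain ⟨outputs, back⟩ := reaches_roundStore (L := L) (x := x) (s := s') (a := R.next L x a)
      (show 0 < B by omega) (fun j => (same.reg (by omega)).trans (holds.array j))
      (same.query.trans holds.query) (M := M) (P := P) (Q := Q) rfl rfl
    have out : s'.out = R.output (x, R.next L x a) := by
      rw [same.out, Store.append, holds.out, List.nil_append]
    exact ⟨_, ((reach.trans enter).trans (run M _ code.right.left)).mono (by omega), out ▸ outputs,
      back.mono (by omega)⟩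

end RoundMachine

/-! ## Enumeration with polynomial delay -/

section Delay

variable {M : Program} {L : Language Bool} {x : List Bool} {c c' : Config} {D : ℕ}

theorem Reaches.exists_outputs_iff (h : Reaches M L x c D c') :
    ∃ t ≤ D, (step M L x)^[t] c = c' ∧ ∀ u y, Outputs M ((step M L x)^[u] c) y ↔
      ∃ v, u = v + t ∧ Outputs M ((step M L x)^[v] c') y := by
  obtain ⟨t, ht, rfl, quiet⟩ := h
  refine ⟨t, ht, rfl, fun u y => ⟨fun hu => ?_, ?_⟩⟩
  · have htu : t ≤ u := by
      by_contra! hut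
      obtain ⟨i, hi, not_output⟩ := quiet u hut
      exact not_output (Option.some.inj (hi.symm.trans hu.1))
    refine ⟨u - t, (Nat.sub_add_cancel htu).symm, ?_⟩
    rwa [← Function.iterate_add_apply, Nat.sub_add_cancel htu]
  · rintro ⟨v, rfl, hv⟩
    rwa [Function.iterate_add_apply]

theorem Halted.isFixedPt (h : Halted M c) : Function.IsFixedPt (step M L x) c := by
  rw [Halted] at h
  simp only [Function.IsFixedPt, step, h]

theorem Halted.iterate (h : Halted M c) (t : ℕ) : (step M L x)^[t] c = c :=
  Function.iterate_fixed h.isFixedPt t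

theorem Halted.not_outputs (h : Halted M c) (y : List Bool) : ¬ Outputs M c y := by
  rintro ⟨output, -⟩
  rw [h] at output
  cases output

variable (M L x D) in
/-- Starting in a configuration, the machine outputs the words of a list, with at most `D` steps
before each of them, and halts within another `D` steps. -/
def Produces : Config → List (List Bool) → Prop
  | c, [] => ∃ c', Reaches M L x c D c' ∧ Halted M c'
  | c, w :: ws => ∃ c', Reaches M L x c D c' ∧ Outputs M c' w ∧ Produces (step M L x c') ws

namespace Produces

theorem cons_iff_outputs {w y : List Bool} {t u : ℕ} (hw : Outputs M c' w)
    (ht : ∀ u y, Outputs M ((step M L x)^[u] c) y ↔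
      ∃ v, u = v + t ∧ Outputs M ((step M L x)^[v] c') y) :
    Outputs M ((step M L x)^[u] c) y ↔
      u = t ∧ y = w ∨ ∃ v, u = v + 1 + t ∧ Outputs M ((step M L x)^[v] (step M L x c')) y := by
  rw [ht]
  constructor
  · rintro ⟨_ | v, rfl, hv⟩
    · exact .inl ⟨zero_add t, hv.2.symm.trans hw.2⟩
    · exact .inr ⟨v, rfl, hv⟩
  · rintro (⟨rfl, rfl⟩ | ⟨v, rfl, hv⟩)
    · exact ⟨0, (zero_add u).symm, hw⟩
    · exact ⟨v + 1, rfl, hv⟩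

theorem mem_iff {ws : List (List Bool)} (h : Produces M L x D c ws) {y : List Bool} :
    y ∈ ws ↔ ∃ t, Outputs M ((step M L x)^[t] c) y := by
  induction ws generalizing c with
  | nil =>
    obtain ⟨c', reach, halted⟩ := h
    obtain ⟨t, -, -, outputs⟩ := reach.exists_outputs_iff
    simp only [List.not_mem_nil, false_iff, not_exists, outputs, not_and, halted.iterate]
    exact fun _ _ _ => halted.not_outputs y
  | cons w ws ih =>
    obtain ⟨c', reach, hw, rest⟩ := h
    obtain ⟨t₀, -, -, outputs⟩ := reach.exists_outputs_iff
    simp only [List.mem_cons, ih rest, cons_iff_outputs hw outputs]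
    grind

theorem unique {ws : List (List Bool)} (h : Produces M L x D c ws) (nodup : ws.Nodup)
    (y : List Bool) {t t' : ℕ} (ht : Outputs M ((step M L x)^[t] c) y)
    (ht' : Outputs M ((step M L x)^[t'] c) y) : t = t' := by
  induction ws generalizing c t t' with
  | nil => exact (List.not_mem_nil (h.mem_iff.2 ⟨t, ht⟩)).elim
  | cons w ws ih =>
    obtain ⟨c', reach, hw, rest⟩ := h
    obtain ⟨not_mem, nodup⟩ := List.nodup_cons.1 nodup
    obtain ⟨t₀, -, -, outputs⟩ := reach.exists_outputs_iff
    rw [cons_iff_outputs hw outputs] at ht ht'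
    rcases ht with ⟨rfl, rfl⟩ | ⟨v, rfl, hv⟩ <;> rcases ht' with ⟨rfl, hy⟩ | ⟨v', rfl, hv'⟩
    · rfl
    · exact (not_mem (rest.mem_iff.2 ⟨v', hv'⟩)).elim
    · exact (not_mem (hy ▸ rest.mem_iff.2 ⟨v, hv⟩)).elim
    · rw [ih rest nodup hv hv']

theorem exists_halted {ws : List (List Bool)} (h : Produces M L x D c ws) :
    ∃ t, Halted M ((step M L x)^[t] c) := by
  induction ws generalizing c with
  | nil =>
    obtain ⟨c', ⟨t, -, rfl, -⟩, halted⟩ := h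
    exact ⟨t, halted⟩
  | cons w ws ih =>
    obtain ⟨c', ⟨t, -, rfl, -⟩, -, rest⟩ := h
    obtain ⟨t', halted⟩ := ih rest
    refine ⟨t' + 1 + t, ?_⟩
    rwa [Function.iterate_add_apply, Function.iterate_succ_apply]

theorem exists_halted_or_outputs {ws : List (List Bool)} (h : Produces M L x D c ws) (t : ℕ) :
    ∃ t', t ≤ t' ∧ t' ≤ t + D ∧
      (Halted M ((step M L x)^[t'] c) ∨ ∃ y, Outputs M ((step M L x)^[t'] c) y) := by
  induction ws generalizing c t with
  | nil =>
    obtain ⟨c', ⟨u, hu, rfl, -⟩, halted⟩ := h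
    refine ⟨max u t, le_max_right u t, by omega, .inl ?_⟩
    rwa [← Nat.sub_add_cancel (le_max_left u t), Function.iterate_add_apply, halted.iterate]
  | cons w ws ih =>
    obtain ⟨c', ⟨u, hu, rfl, -⟩, hw, rest⟩ := h
    by_cases htu : t ≤ u
    · exact ⟨u, htu, by omega, .inr ⟨w, hw⟩⟩
    · obtain ⟨t', h₁, h₂, found⟩ := ih rest (t - u - 1)
      refine ⟨t' + 1 + u, by omega, by omega, ?_⟩
      rwa [Function.iterate_add_apply, Function.iterate_succ_apply]

theorem enumeratesWithDelay {ws : List (List Bool)} {S : Set (List Bool)}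
    (h : Produces M L x D Config.init ws) (nodup : ws.Nodup) (hS : ∀ y, y ∈ S ↔ y ∈ ws) {d : ℕ}
    (hd : D < d) : EnumeratesWithDelay M L x S d := by
  refine ⟨fun y => (hS y).trans h.mem_iff, fun y t t' => h.unique nodup y, h.exists_halted,
    fun t => ?_⟩
  obtain ⟨t', h₁, h₂, found⟩ := h.exists_halted_or_outputs t
  exact ⟨t', h₁, by omega, found⟩

end Produces

theorem RoundScheme.Yields.produces {R : RoundScheme} {B : ℕ} {a : ℕ → Bool}
    {ws : List (List Bool)} (h : R.Yields L x a ws) (hM : R.Implements M B L x D)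
    (hc : Reaches M L x c D ((roundStore B a).config 0)) : Produces M L x (D + D) c ws := by
  induction ws generalizing a c with
  | nil =>
    obtain ⟨c', reach, halted⟩ := hM.halts a h
    exact ⟨c', hc.trans reach, halted⟩
  | cons w ws ih =>
    obtain ⟨continues, rfl, rest⟩ := h
    obtain ⟨c', reach, outputs, back⟩ := hM.output a continues
    exact ⟨c', hc.trans reach, outputs, ih rest back⟩

/-! ### Space bounds -/

theorem step_reg_lt {b : ℕ} (hM : ∀ r k, Instr.const r k ∈ M → k < 2 ^ b) (hx : x.length < 2 ^ b)
    (hc : ∀ r, c.reg r < 2 ^ b) (r : ℕ) : (step M L x c).reg r < 2 ^ (b + 1) := by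
  have one_le : 1 ≤ 2 ^ b := Nat.one_le_two_pow
  have reg_lt (r : ℕ) : c.reg r < 2 ^ (b + 1) := by have := hc r; omega
  have set_lt {q v : ℕ} (hv : v < 2 ^ (b + 1)) : (c.set q v).reg r < 2 ^ (b + 1) := by
    simp only [Config.set, Function.update_apply]
    split_ifs
    exacts [hv, reg_lt r]
  cases hi : M[c.pc]? with
  | none => simpa only [step, hi] using reg_lt r
  | some i =>
    rw [step_eq_exec hi]
    cases i with
    | const q k => exact set_lt (by have := hM q k (List.mem_of_getElem? hi); omega)
    | add q a a' => exact set_lt (by have := hc a; have := hc a'; omega)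
    | sub q a a' => exact set_lt (by have := hc a; omega)
    | load q a => exact set_lt (reg_lt _)
    | store a a' => exact set_lt (reg_lt _)
    | inputLength q => exact set_lt (by omega)
    | input q a => exact set_lt (by split_ifs <;> omega)
    | ask q => exact set_lt (by split_ifs <;> omega)
    | jz | writeQuery | writeOutput | output => exact reg_lt r

theorem length_query_step : (step M L x c).query.length ≤ c.query.length + 1 := by
  cases hi : M[c.pc]? with
  | none => simp only [step, hi, Nat.le_succ]
  | some i =>
    rw [step_eq_exec hi]
    cases i <;> simp [exec, Config.set]

theorem iterate_reg_lt {b : ℕ} (hM : ∀ r k, Instr.const r k ∈ M → k < 2 ^ b)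
    (hx : x.length < 2 ^ b) (hc : ∀ r, c.reg r < 2 ^ b) (t r : ℕ) :
    ((step M L x)^[t] c).reg r < 2 ^ (b + t) := by
  induction t generalizing r with
  | zero => exact hc r
  | succ t ih =>
    have le : 2 ^ b ≤ 2 ^ (b + t) := Nat.pow_le_pow_right two_pos (Nat.le_add_right b t)
    rw [Function.iterate_succ_apply']
    exact step_reg_lt (b := b + t) (fun r k hk => (hM r k hk).trans_le le) (hx.trans_le le) ih r

theorem length_query_iterate (t : ℕ) :
    ((step M L x)^[t] c).query.length ≤ c.query.length + t := by
  induction t with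
  | zero => exact le_rfl
  | succ t ih =>
    rw [Function.iterate_succ_apply']
    exact length_query_step.trans (Nat.succ_le_succ ih)

theorem exists_const_lt (M : Program) : ∃ b, ∀ r k, Instr.const r k ∈ M → k < b := by
  induction M with
  | nil => exact ⟨0, fun _ _ h => (List.not_mem_nil h).elim⟩
  | cons i M ih =>
    obtain ⟨b, hb⟩ := ih
    obtain ⟨b', hb'⟩ : ∃ b', ∀ r k, Instr.const r k = i → k < b' := by
      cases i with
      | const r k => exact ⟨k + 1, by rintro _ _ ⟨⟩; exact Nat.lt_succ_self k⟩
      | _ => exact ⟨0, fun _ _ h => Instr.noConfusion h⟩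
    refine ⟨max b b', fun r k hk => lt_max_iff.2 ?_⟩
    exact (List.mem_cons.1 hk).symm.imp (hb r k) (hb' r k)

end Delay

theorem exists_iterate_eq_of_return {α : Type*} {f : α → α} {s : Set α} {D : ℕ}
    (h : ∀ a ∈ s, ∃ t ≤ D, Function.IsFixedPt f (f^[t] a) ∨ 0 < t ∧ f^[t] a ∈ s) {a : α}
    (ha : a ∈ s) (n : ℕ) : ∃ b ∈ s, ∃ t ≤ D, f^[n] a = f^[t] b := by
  induction n using Nat.strong_induction_on generalizing a with
  | h n ih =>
    by_cases hn : n ≤ D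
    · exact ⟨a, ha, n, hn, rfl⟩
    obtain ⟨t, ht, fixed | ⟨pos, returned⟩⟩ := h a ha <;>
      have split : f^[n] a = f^[n - t] (f^[t] a) := by
        rw [← Function.iterate_add_apply, Nat.sub_add_cancel (by omega)]
    · exact ⟨a, ha, t, ht, split.trans (Function.iterate_fixed fixed (n - t))⟩
    · rw [split]
      exact ih (n - t) (by omega) returned

/-- This bounds the space: register contents at most double in each step, and they are reset at the
beginning of each round. -/
theorem RoundScheme.Implements.exists_run_eq {R : RoundScheme} {M : Program} {B D : ℕ}
    {L : Language Bool} {x : List Bool} (hM : R.Implements M B L x D) (t : ℕ) :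
    ∃ a, ∃ u ≤ D + 1 + D, run M L x t = (step M L x)^[u] ((roundStore B a).config 0) := by
  obtain ⟨_, ⟨a, rfl⟩, u, hu, eq⟩ := exists_iterate_eq_of_return (f := step M L x)
    (s := Set.range fun a => (roundStore B a).config 0) (D := D + 1 + D) (by
      rintro _ ⟨a, rfl⟩
      by_cases continues : R.continues (x, R.next L x a)
      · obtain ⟨_, ⟨u, hu, rfl, -⟩, -, v, hv, back, -⟩ := hM.output a continues
        refine ⟨v + 1 + u, by omega, .inr ⟨by omega, R.next L x a, ?_⟩⟩
        rw [Function.iterate_add_apply, Function.iterate_succ_apply, back]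
      · obtain ⟨_, ⟨u, hu, rfl, -⟩, halted⟩ := hM.halts a continues
        exact ⟨u, by omega, .inl halted.isFixedPt⟩)
    ⟨fun _ => false, roundStore_zero⟩ t
  exact ⟨a, u, hu, eq⟩

theorem RoundScheme.mem_Del (R : RoundScheme) {C : Set (Language Bool)} {L : Language Bool}
    (hL : L ∈ C) {E : EnumProblem}
    (hE : ∀ x, ∃ ws : List (List Bool), ws.Nodup ∧ (∀ y, y ∈ E x ↔ y ∈ ws) ∧
      R.Yields L x (fun _ => false) ws) : E ∈ Del C := by
  obtain ⟨M, B, k, hM⟩ := R.exists_implements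
  obtain ⟨b, hb⟩ := exists_const_lt M
  refine ⟨L, hL, M, 2 * (.X + 2) ^ k + .X + .C (b + 2), fun x => ?_⟩
  have eval : (2 * (.X + 2) ^ k + .X + .C (b + 2) : Polynomial ℕ).eval x.length =
      2 * (x.length + 2) ^ k + x.length + (b + 2) := by
    simp only [Polynomial.eval_add, Polynomial.eval_mul, Polynomial.eval_pow, Polynomial.eval_C,
      Polynomial.eval_X, Polynomial.eval_ofNat]
  rw [eval]
  refine ⟨?_, ?_, fun t r => ?_⟩
  · obtain ⟨ws, nodup, mem, yields⟩ := hE x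
    refine (yields.produces (hM L x) ?_).enumeratesWithDelay nodup mem (by omega)
    exact roundStore_zero ▸ (Reaches.refl _).mono (Nat.zero_le _)
  · rintro t q ⟨-, rfl⟩
    obtain ⟨a, u, hu, eq⟩ := (hM L x).exists_run_eq t
    rw [eq]
    refine (length_query_iterate u).trans ?_
    simp only [roundStore, Store.config, List.length_nil]
    omega
  · obtain ⟨a, u, hu, eq⟩ := (hM L x).exists_run_eq t
    have le {m : ℕ} (hm : m ≤ b + x.length + 1) : m < 2 ^ (b + x.length + 1) :=
      hm.trans_lt Nat.lt_two_pow_self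
    rw [eq]
    refine (iterate_reg_lt (fun r k hk => le (by have := hb r k hk; omega)) (le (by omega))
      (fun r => le ?_) u r).trans_le (Nat.pow_le_pow_right two_pos (by omega))
    simp only [roundStore, Store.config]
    split_ifs
    · omega
    · have := Bool.toNat_le (a (r - B))
      omega

/-! ## Search for the next solution -/

section Fill

variable {P : (ℕ → Bool) → ℕ → Prop} {a : ℕ → Bool} {i k l : ℕ}

theorem fill_of_le (h : k ≤ i) : fill P a k i = a i := by
  induction k with
  | zero => rfl
  | succ k ih => rw [fill, Function.update_of_ne (by omega), ih (by omega)]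

open Classical in
theorem fill_of_lt (h : i < k) : fill P a k i = true ↔ P (fill P a i) i := by
  induction k with
  | zero => exact (Nat.not_lt_zero i h).elim
  | succ k ih =>
    rw [fill]
    obtain rfl | hi := eq_or_ne i k
    · rw [Function.update_self, decide_eq_true_iff]
    · rw [Function.update_of_ne hi, ih (by omega)]

theorem fill_eq_of_lt (h : i < k) (hl : i < l) : fill P a k i = fill P a l i := by
  rw [Bool.eq_iff_iff, fill_of_lt h, fill_of_lt hl]

end Fill

/-- Entry number `j` of the `k`-th block of length `N` of the array `a`. -/
def block (N : ℕ) (a : ℕ → Bool) (k : ℕ) : Fin N → Bool := fun j => a (k * N + j)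

/-- The number of ones in a word. -/
def weight {N : ℕ} (z : Fin N → Bool) : ℕ := ∑ j, (z j).toNat

theorem weight_le {N : ℕ} (z : Fin N → Bool) : weight z ≤ N := by
  simpa only [weight, Finset.card_univ, Fintype.card_fin, smul_eq_mul, mul_one] using
    Finset.sum_le_card_nsmul Finset.univ (fun j => (z j).toNat) 1 fun j _ => Bool.toNat_le (z j)

/-- The part of the oracle question number `i` for the array `a` that concerns a solution `z`. The
array consists of three blocks, which are filled in this order: the maximum weight in unary, the
last solution, and the new solution. The last solution is zero in the first round. -/
def Supports {N : ℕ} (a : ℕ → Bool) (i : ℕ) (z : Fin N → Bool) : Prop :=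
  i < N ∧ i < weight z ∨
  (N ≤ i ∧ i < 2 * N) ∧ a (i + N) = true ∨
  ∃ p : Fin N, i = 2 * N + p ∧ z p = true ∧ (∀ q < p, z q = block N a 2 q) ∧
    (∀ j, block N a 0 j = true → j < weight z) ∧
    (block N a 1 = ⊥ ∨ toLex z < toLex (block N a 1))

/-- The nonzero words of maximum weight in `S`, and only those that precede `y` lexicographically
if `y` is nonzero. -/
def candidates {N : ℕ} (S : Set (Fin N → Bool)) (y : Fin N → Bool) : Set (Lex (Fin N → Bool)) :=
  {z | (ofLex z ∈ S ∧ ofLex z ≠ ⊥ ∧ ∀ z' ∈ S, weight z' ≤ weight (ofLex z)) ∧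
    (y = ⊥ ∨ z < toLex y)}

theorem mem_candidates_of_mem {N : ℕ} {S : Set (Fin N → Bool)} {y : Fin N → Bool}
    {m z : Lex (Fin N → Bool)} (hm : m ∈ candidates S y) :
    z ∈ candidates S (ofLex m) ↔ z ∈ candidates S y ∧ z < m := by
  obtain ⟨⟨-, hm, -⟩, hy⟩ := hm
  refine (and_congr_right fun _ => or_iff_right hm).trans ?_
  exact ⟨fun ⟨hz, lt⟩ => ⟨⟨hz, hy.imp_right lt.trans⟩, lt⟩, fun ⟨⟨hz, _⟩, lt⟩ => ⟨hz, lt⟩⟩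

theorem eq_of_isGreatest {N : ℕ} {C : Set (Lex (Fin N → Bool))} {m : Lex (Fin N → Bool)}
    (hm : IsGreatest C m) {y : Fin N → Bool}
    (hy : ∀ p, y p = true ↔ ∃ z ∈ C, (∀ q < p, ofLex z q = y q) ∧ ofLex z p = true) :
    y = ofLex m := by
  funext p
  induction p using WellFoundedLT.induction with
  | ind p ih =>
    rw [Bool.eq_iff_iff, hy]
    refine ⟨?_, fun hp => ⟨m, hm.1, fun q hq => (ih q hq).symm, hp⟩⟩
    rintro ⟨z, hz, prefix_eq, hp⟩
    by_contra hmp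
    refine (hm.2 hz).not_gt (show m < z from ⟨p, fun q hq => ?_, ?_⟩)
    · exact (ih q hq).symm.trans (prefix_eq q hq).symm
    · exact Bool.lt_iff.2 ⟨Bool.eq_false_of_not_eq_true hmp, hp⟩

section Round

variable {N : ℕ} {S : Set (Fin N → Bool)} {P : (ℕ → Bool) → ℕ → Prop} {a : ℕ → Bool} {t : ℕ}

theorem block_zero_fill (hP : ∀ a, ∀ i < 3 * N, P a i ↔ ∃ z ∈ S, Supports a i z)
    (ht : N ≤ t) (j : Fin N) :
    block N (fill P a t) 0 j = true ↔ ∃ z ∈ S, j < weight z := by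
  have hj := j.isLt
  rw [block, zero_mul, zero_add, fill_of_lt (by omega), hP _ _ (by omega)]
  refine exists_congr fun z => and_congr_right fun _ => ⟨?_, fun h => .inl ⟨hj, h⟩⟩
  rintro (⟨-, h⟩ | ⟨h, -⟩ | ⟨p, h, -⟩)
  · exact h
  all_goals omega

theorem forall_lt_weight_iff (hP : ∀ a, ∀ i < 3 * N, P a i ↔ ∃ z ∈ S, Supports a i z)
    (ht : N ≤ t) (z : Fin N → Bool) :
    (∀ j, block N (fill P a t) 0 j = true → j < weight z) ↔
      ∀ z' ∈ S, weight z' ≤ weight z := by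
  simp only [block_zero_fill hP ht]
  refine ⟨fun h z' hz' => ?_, fun h j ⟨z', hz', hj⟩ => hj.trans_le (h z' hz')⟩
  by_contra! lt
  exact lt_irrefl _ (h ⟨weight z, lt.trans_le (weight_le z')⟩ ⟨z', hz', lt⟩)

theorem block_one_fill (hP : ∀ a, ∀ i < 3 * N, P a i ↔ ∃ z ∈ S, Supports a i z)
    (ht : 2 * N ≤ t) (hS : S.Nonempty) :
    block N (fill P a t) 1 = block N a 2 := by
  funext j
  have hj := j.isLt
  have last : block N a 2 j = fill P a (1 * N + j) (1 * N + j + N) := by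
    rw [fill_of_le (by omega), block]
    congr 1
    omega
  rw [last, Bool.eq_iff_iff, block, fill_of_lt (by omega), hP _ _ (by omega)]
  constructor
  · rintro ⟨z, -, ⟨h, -⟩ | ⟨-, h⟩ | ⟨p, h, -⟩⟩
    · omega
    · exact h
    · omega
  · exact fun h => hS.imp fun z hz => ⟨hz, .inr (.inl ⟨by omega, h⟩)⟩

theorem block_two_fill (hP : ∀ a, ∀ i < 3 * N, P a i ↔ ∃ z ∈ S, Supports a i z)
    (p : Fin N) :
    block N (fill P a (3 * N)) 2 p = true ↔ ∃ z ∈ candidates S (block N a 2),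
      (∀ q < p, ofLex z q = block N (fill P a (3 * N)) 2 q) ∧ ofLex z p = true := by
  have hp := p.isLt
  have agree (q : Fin N) (hq : q < p) :
      block N (fill P a (2 * N + p)) 2 q = block N (fill P a (3 * N)) 2 q :=
    fill_eq_of_lt (Nat.add_lt_add_left hq _) (by have := q.isLt; omega)
  rw [block, fill_of_lt (by omega), hP _ _ (by omega), toLex.surjective.exists]
  refine exists_congr fun z => ⟨?_, ?_⟩
  · rintro ⟨hz, ⟨h, -⟩ | ⟨⟨-, h⟩, -⟩ | ⟨p', h, hzp, prefix_eq, maximal, precedes⟩⟩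
    · omega
    · omega
    · obtain rfl : p = p' := Fin.ext (by omega)
      rw [block_one_fill hP (by omega) ⟨z, hz⟩] at precedes
      refine ⟨⟨⟨hz, ?_, (forall_lt_weight_iff hP (by omega) z).1 maximal⟩, precedes⟩,
        fun q hq => (prefix_eq q hq).trans (agree q hq), hzp⟩
      rintro (rfl : z = ⊥)
      cases hzp
  · rintro ⟨⟨⟨hz, -, maximal⟩, precedes⟩, prefix_eq, hzp⟩
    refine ⟨hz, .inr (.inr ⟨p, rfl, hzp, fun q hq => (prefix_eq q hq).trans (agree q hq).symm,
      (forall_lt_weight_iff hP (by omega) z).2 maximal, ?_⟩)⟩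
    rwa [block_one_fill hP (by omega) ⟨_, hz⟩]

theorem block_two_fill_of_eq_empty (hP : ∀ a, ∀ i < 3 * N, P a i ↔ ∃ z ∈ S, Supports a i z)
    (h : candidates S (block N a 2) = ∅) :
    block N (fill P a (3 * N)) 2 = ⊥ := by
  funext p
  refine Bool.eq_false_of_not_eq_true fun hp => ?_
  obtain ⟨z, hz, -⟩ := (block_two_fill hP p).1 hp
  rwa [h] at hz

end Round

namespace RoundScheme

variable {R : RoundScheme} {L : Language Bool} {x : List Bool} {N : ℕ} {S : Set (Fin N → Bool)}

theorem yields_of_sortedGT (numBits : ∀ a, R.numBits (x, a) = 3 * N)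
    (question : ∀ a, ∀ i < 3 * N, R.question ((x, a), i) ∈ L ↔ ∃ z ∈ S, Supports a i z)
    (continues : ∀ a, R.continues (x, a) ↔ block N a 2 ≠ ⊥)
    (output : ∀ a, R.output (x, a) = List.ofFn (block N a 2))
    {ws : List (Lex (Fin N → Bool))} (sorted : ws.SortedGT) {a : ℕ → Bool}
    (mem : ∀ z, z ∈ ws ↔ z ∈ candidates S (block N a 2)) :
    R.Yields L x a (ws.map fun z => List.ofFn (ofLex z)) := by
  induction ws generalizing a with
  | nil =>
    have empty : candidates S (block N a 2) = ∅ := by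
      ext z
      simp [← mem]
    rw [List.map_nil, Yields, continues, not_not, next, numBits]
    exact block_two_fill_of_eq_empty question empty
  | cons m ws ih =>
    obtain ⟨m_gt, sorted⟩ := List.pairwise_cons.1 sorted.pairwise
    have hm : m ∈ candidates S (block N a 2) := (mem m).1 List.mem_cons_self
    have greatest : IsGreatest (candidates S (block N a 2)) m := by
      refine ⟨hm, fun z hz => ?_⟩
      obtain rfl | hz := List.mem_cons.1 ((mem z).2 hz)
      exacts [le_rfl, (m_gt z hz).le]
    have new : block N (R.next L x a) 2 = ofLex m := by
      rw [next, numBits]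
      exact eq_of_isGreatest greatest (block_two_fill question)
    refine ⟨(continues _).2 (new ▸ hm.1.2.1), by rw [output, new],
      ih sorted.sortedGT fun z => ?_⟩
    rw [new, mem_candidates_of_mem hm, ← mem, List.mem_cons]
    refine ⟨fun hz => ⟨.inr hz, m_gt z hz⟩, ?_⟩
    rintro ⟨rfl | hz, lt⟩
    exacts [(lt_irrefl _ lt).elim, hz]

theorem exists_yields (numBits : ∀ a, R.numBits (x, a) = 3 * N)
    (question : ∀ a, ∀ i < 3 * N, R.question ((x, a), i) ∈ L ↔ ∃ z ∈ S, Supports a i z)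
    (continues : ∀ a, R.continues (x, a) ↔ block N a 2 ≠ ⊥)
    (output : ∀ a, R.output (x, a) = List.ofFn (block N a 2)) :
    ∃ ws : List (List Bool), ws.Nodup ∧ R.Yields L x (fun _ => false) ws ∧
      ∀ w, w ∈ ws ↔ ∃ z ∈ S, z ≠ ⊥ ∧ (∀ z' ∈ S, weight z' ≤ weight z) ∧ w = List.ofFn z := by
  classical
  let C : Finset (Lex (Fin N → Bool)) := {z | z ∈ candidates S ⊥}
  have mem (z : Lex (Fin N → Bool)) : z ∈ C.sort (· ≥ ·) ↔ z ∈ candidates S ⊥ := by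
    simp only [Finset.mem_sort, C, Finset.mem_filter_univ]
  refine ⟨_, ?_, yields_of_sortedGT numBits question continues output C.sortedGT_sort mem,
    fun w => ?_⟩
  · exact (Finset.sort_nodup C _).map (List.ofFn_injective.comp ofLex.injective)
  · simp only [List.mem_map, mem, candidates, Set.mem_ofPred_eq, true_or, and_true, and_assoc,
      eq_comm (a := w)]
    rfl

end RoundScheme

/-! ## Assignments as numbers -/

/-- Digit number `x` of `j` in base `b`, starting with the least significant digit. -/
def digit (b j x : ℕ) : ℕ := j / b ^ x % b

/-- The assignment with code `j`, whose domain is contained in `{0, …, m - 1}`: digit number `x` of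
`j` in base `n + 1` is `0` if `x` has no value, and `a + 1` if `x` has the value `a`. -/
def codedAssignment (n m j : ℕ) : Assignment (Fin n) := fun x =>
  if x < m then finSuccEquiv n (Fin.ofNat (n + 1) (j / (n + 1) ^ x)) else none

section

variable {n m k i j x y : ℕ}

theorem codedAssignment_of_lt (hx : x < m) :
    codedAssignment n m j x = finSuccEquiv n (Fin.ofNat (n + 1) (j / (n + 1) ^ x)) :=
  if_pos hx

theorem codedAssignment_of_le (hx : m ≤ x) : codedAssignment n m j x = none := if_neg hx.not_gt

theorem codedAssignment_eq_iff (hx : x < m) (hy : y < m) :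
    codedAssignment n m i x = codedAssignment n m j y ↔ digit (n + 1) i x = digit (n + 1) j y := by
  rw [codedAssignment_of_lt hx, codedAssignment_of_lt hy, EmbeddingLike.apply_eq_iff_eq,
    Fin.ext_iff]
  rfl

theorem codedAssignment_eq_some_iff (hx : x < m) (a : Fin n) :
    codedAssignment n m j x = some a ↔ digit (n + 1) j x = a + 1 := by
  rw [codedAssignment_of_lt hx, finSuccEquiv_eq_some, Fin.ext_iff]
  rfl

theorem exists_codedAssignment_eq_some_iff (hx : x < m) :
    (∃ a, codedAssignment n m j x = some a) ↔ 1 ≤ digit (n + 1) j x := by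
  have digit_lt : digit (n + 1) j x < n + 1 := Nat.mod_lt _ n.succ_pos
  simp only [codedAssignment_eq_some_iff hx]
  exact ⟨fun ⟨a, ha⟩ => by omega, fun h => ⟨⟨digit (n + 1) j x - 1, by omega⟩, by simp only; omega⟩⟩

theorem codedAssignment_comp_eq_iff {xs ys : Fin k → ℕ} (hx : ∀ l, xs l < m) (hy : ∀ l, ys l < m) :
    codedAssignment n m i ∘ xs = codedAssignment n m j ∘ ys ↔
      ∀ l, digit (n + 1) i (xs l) = digit (n + 1) j (ys l) :=
  funext_iff.trans <| forall_congr' fun l => codedAssignment_eq_iff (hx l) (hy l)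

theorem exists_codedAssignment_comp_eq_iff {xs : Fin k → ℕ} (hx : ∀ l, xs l < m) (w : ℕ → Prop) :
    (∃ a : Fin k → Fin n, w (finFunctionFinEquiv a) ∧ codedAssignment n m j ∘ xs = some ∘ a) ↔
      (∀ l, 1 ≤ digit (n + 1) j (xs l)) ∧
        w (∑ l, (digit (n + 1) j (xs l) - 1) * n ^ (l : ℕ)) := by
  have comp_eq_iff (a : Fin k → Fin n) : codedAssignment n m j ∘ xs = some ∘ a ↔
      ∀ l, digit (n + 1) j (xs l) = a l + 1 :=
    funext_iff.trans <| forall_congr' fun l => codedAssignment_eq_some_iff (hx l) (a l)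
  simp only [← exists_codedAssignment_eq_some_iff (hx _), comp_eq_iff, finFunctionFinEquiv_apply]
  constructor
  · rintro ⟨a, ha, h⟩
    refine ⟨fun l => ⟨a l, (codedAssignment_eq_some_iff (hx l) (a l)).2 (h l)⟩, ?_⟩
    simpa only [h, Nat.add_sub_cancel] using ha
  · rintro ⟨h, hw⟩
    choose a ha using h
    have digit_eq l := (codedAssignment_eq_some_iff (hx l) (a l)).1 (ha l)
    simp only [digit_eq, Nat.add_sub_cancel] at hw
    exact ⟨a, hw, digit_eq⟩

theorem codedAssignment_mod :
    codedAssignment n m (j % (n + 1) ^ m) = codedAssignment n m j := by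
  funext x
  obtain hx | hx := lt_or_ge x m
  · rw [codedAssignment_eq_iff hx hx, digit, digit, ← Nat.add_sub_cancel' hx.le, pow_add,
      Nat.mod_mul_right_div_self, Nat.mod_mod_of_dvd _ (dvd_pow_self _ (by omega))]
  · rw [codedAssignment_of_le hx, codedAssignment_of_le hx]

theorem injOn_codedAssignment : Set.InjOn (codedAssignment n m) (Set.Iio ((n + 1) ^ m)) := by
  intro i hi j hj h
  have digits_eq : finFunctionFinEquiv.symm (⟨i, hi⟩ : Fin ((n + 1) ^ m)) =
      finFunctionFinEquiv.symm ⟨j, hj⟩ :=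
    funext fun x => Fin.ext ((codedAssignment_eq_iff x.2 x.2).1 (congrFun h x))
  exact congrArg Fin.val (finFunctionFinEquiv.symm.injective digits_eq)

theorem exists_codedAssignment_eq {s : Assignment (Fin n)} (hs : ∀ x, m ≤ x → s x = none) :
    ∃ j < (n + 1) ^ m, codedAssignment n m j = s := by
  let c : Fin m → Fin (n + 1) := fun x => (finSuccEquiv n).symm (s x)
  refine ⟨finFunctionFinEquiv c, (finFunctionFinEquiv c).2, funext fun x => ?_⟩
  obtain hx | hx := lt_or_ge x m
  · have digit_eq : Fin.ofNat (n + 1) (finFunctionFinEquiv c / (n + 1) ^ x) = c ⟨x, hx⟩ :=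
      congrFun (finFunctionFinEquiv.symm_apply_apply c) ⟨x, hx⟩
    rw [codedAssignment_of_lt hx, digit_eq, Equiv.apply_symm_apply]
  · rw [codedAssignment_of_le hx, hs x hx]

end

/-- All assignments in `X` have their domain in `{0, …, m - 1}`. -/
def SupportedIn {A : Type*} (m : ℕ) (X : Set (Assignment A)) : Prop :=
  ∀ s ∈ X, ∀ x, m ≤ x → s x = none

theorem Assignment.exists_eq_subst_iff {A : Type*} {s t : Assignment A} {x : ℕ} :
    (∃ a, t = s.subst a x) ↔ (∃ a, t x = some a) ∧ ∀ y ≠ x, t y = s y := by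
  simp only [Assignment.subst, Function.eq_update_iff, exists_and_right]

namespace SupportedIn

variable {A : Type*} {m n : ℕ}

theorem supplement {X : Set (Assignment A)} (hX : SupportedIn m X) (F : Assignment A → Set A)
    {x : ℕ} (hx : x < m) : SupportedIn m (supplement X F x) := by
  rintro _ ⟨s, hs, a, -, rfl⟩ y hy
  rw [Assignment.subst, Function.update_of_ne (hx.trans_le hy).ne', hX s hs y hy]

theorem duplicate {X : Set (Assignment A)} (hX : SupportedIn m X) {x : ℕ} (hx : x < m) :
    SupportedIn m (duplicate X x) := by
  rintro _ ⟨s, hs, a, rfl⟩ y hy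
  rw [Assignment.subst, Function.update_of_ne (hx.trans_le hy).ne', hX s hs y hy]

theorem union {X Y : Set (Assignment A)} (hX : SupportedIn m X) (hY : SupportedIn m Y) :
    SupportedIn m (X ∪ Y) :=
  fun s hs => hs.elim (hX s) (hY s)

variable {X Y : Set (Assignment (Fin n))}

theorem forall_mem_iff (hX : SupportedIn m X) {p : Assignment (Fin n) → Prop} :
    (∀ s ∈ X, p s) ↔ ∀ j < (n + 1) ^ m, codedAssignment n m j ∈ X → p (codedAssignment n m j) := by
  refine ⟨fun h j _ => h _, fun h s hs => ?_⟩
  obtain ⟨j, hj, rfl⟩ := exists_codedAssignment_eq (hX s hs)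
  exact h j hj hs

theorem exists_mem_iff (hX : SupportedIn m X) {p : Assignment (Fin n) → Prop} :
    (∃ s ∈ X, p s) ↔ ∃ j < (n + 1) ^ m, codedAssignment n m j ∈ X ∧ p (codedAssignment n m j) := by
  refine ⟨fun ⟨s, hs, h⟩ => ?_, fun ⟨j, _, h⟩ => ⟨_, h⟩⟩
  obtain ⟨j, hj, rfl⟩ := exists_codedAssignment_eq (hX s hs)
  exact ⟨j, hj, hs, h⟩

theorem eq_iff (hX : SupportedIn m X) (hY : SupportedIn m Y) :
    X = Y ↔ ∀ j < (n + 1) ^ m, (codedAssignment n m j ∈ X ↔ codedAssignment n m j ∈ Y) := by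
  refine ⟨fun h j _ => h ▸ Iff.rfl, fun h => Set.Subset.antisymm ?_ ?_⟩
  · exact hX.forall_mem_iff.2 fun j hj => (h j hj).1
  · exact hY.forall_mem_iff.2 fun j hj => (h j hj).2

end SupportedIn

/-- The team of the assignments whose codes are marked in `w`. -/
def codedTeam {n m : ℕ} (w : Fin ((n + 1) ^ m) → Bool) : Set (Assignment (Fin n)) :=
  {s | ∃ j, w j = true ∧ codedAssignment n m j = s}

section

variable {n m : ℕ}

theorem supportedIn_codedTeam (w : Fin ((n + 1) ^ m) → Bool) : SupportedIn m (codedTeam w) := by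
  rintro _ ⟨j, -, rfl⟩ x hx
  exact codedAssignment_of_le hx

theorem codedAssignment_mem_codedTeam {w : Fin ((n + 1) ^ m) → Bool} {j : ℕ}
    (hj : j < (n + 1) ^ m) : codedAssignment n m j ∈ codedTeam w ↔ w ⟨j, hj⟩ = true := by
  refine ⟨?_, fun h => ⟨⟨j, hj⟩, h, rfl⟩⟩
  rintro ⟨i, hi, h⟩
  obtain rfl : i = ⟨j, hj⟩ := Fin.ext (injOn_codedAssignment i.2 hj h)
  exact hi

end

/-! ## Certificates for satisfaction -/

section

variable {σ : Vocabulary}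

/-- All variables of a formula, free or bound. -/
def Formula.vars : Formula σ → Finset ℕ
  | .and φ ψ => φ.vars ∪ ψ.vars
  | .or φ ψ => φ.vars ∪ ψ.vars
  | .ex x φ => insert x φ.vars
  | .all x φ => insert x φ.vars
  | φ => φ.free

theorem Formula.free_subset_vars (φ : Formula σ) : φ.free ⊆ φ.vars := by
  induction φ with
  | and φ ψ ih ih' => exact Finset.union_subset_union ih ih'
  | or φ ψ ih ih' => exact Finset.union_subset_union ih ih'
  | ex x φ ih => exact (Finset.erase_subset x _).trans (ih.trans (Finset.subset_insert x _))
  | all x φ ih => exact (Finset.erase_subset x _).trans (ih.trans (Finset.subset_insert x _))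
  | _ => exact subset_rfl

/-- The number of occurrences of subformulas. -/
def Formula.numNodes : Formula σ → ℕ
  | .and φ ψ => 1 + φ.numNodes + ψ.numNodes
  | .or φ ψ => 1 + φ.numNodes + ψ.numNodes
  | .ex _ φ => 1 + φ.numNodes
  | .all _ φ => 1 + φ.numNodes
  | _ => 1

theorem Formula.numNodes_pos (φ : Formula σ) : 0 < φ.numNodes := by
  cases φ <;> simp only [numNodes] <;> omega

variable {A : Type*}

theorem exists_eq_supplement_iff {X Y : Set (Assignment A)} {x : ℕ} :
    (∃ F : Assignment A → Set A, (∀ s ∈ X, (F s).Nonempty) ∧ Y = supplement X F x) ↔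
      (∀ s ∈ X, ∃ t ∈ Y, ∃ a, t = s.subst a x) ∧ ∀ t ∈ Y, ∃ s ∈ X, ∃ a, t = s.subst a x := by
  constructor
  · rintro ⟨F, hF, rfl⟩
    refine ⟨fun s hs => ?_, fun t ⟨s, hs, a, _, hst⟩ => ⟨s, hs, a, hst⟩⟩
    obtain ⟨a, ha⟩ := hF s hs
    exact ⟨_, ⟨s, hs, a, ha, rfl⟩, a, rfl⟩
  · rintro ⟨forth, back⟩
    refine ⟨fun s => {a | s.subst a x ∈ Y}, fun s hs => ?_, Set.Subset.antisymm ?_ ?_⟩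
    · obtain ⟨_, ht, a, rfl⟩ := forth s hs
      exact ⟨a, ht⟩
    · intro t ht
      obtain ⟨s, hs, a, rfl⟩ := back t ht
      exact ⟨s, hs, a, ht, rfl⟩
    · rintro _ ⟨s, -, a, ha, rfl⟩
      exact ha

/-- The teams `X o, X (o + 1), …` certify that `X o` satisfies the formula: the subformulas are
numbered in preorder, starting from `o`, and each of them is satisfied by the team of its number as
the semantics of its outermost connective requires. -/
def Certifies (𝔄 : Structure σ A) (X : ℕ → Set (Assignment A)) : Formula σ → ℕ → Prop
  | .and φ ψ, o => (X (o + 1) = X o ∧ X (o + 1 + φ.numNodes) = X o) ∧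
      Certifies 𝔄 X φ (o + 1) ∧ Certifies 𝔄 X ψ (o + 1 + φ.numNodes)
  | .or φ ψ, o => X (o + 1) ∪ X (o + 1 + φ.numNodes) = X o ∧
      Certifies 𝔄 X φ (o + 1) ∧ Certifies 𝔄 X ψ (o + 1 + φ.numNodes)
  | .ex x φ, o => (∃ F, (∀ s ∈ X o, (F s).Nonempty) ∧ X (o + 1) = supplement (X o) F x) ∧
      Certifies 𝔄 X φ (o + 1)
  | .all x φ, o => X (o + 1) = duplicate (X o) x ∧ Certifies 𝔄 X φ (o + 1)
  | φ, o => Sat 𝔄 φ (X o)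

variable {𝔄 : Structure σ A} {X Y Z : ℕ → Set (Assignment A)} {φ ψ : Formula σ} {m o : ℕ}

theorem Certifies.sat (h : Certifies 𝔄 X φ o) : Sat 𝔄 φ (X o) := by
  induction φ generalizing o with
  | and φ ψ ih ih' =>
    obtain ⟨⟨eq, eq'⟩, hφ, hψ⟩ := h
    exact ⟨eq ▸ ih hφ, eq' ▸ ih' hψ⟩
  | or φ ψ ih ih' => exact ⟨_, _, h.1, ih h.2.1, ih' h.2.2⟩
  | ex x φ ih =>
    obtain ⟨⟨F, hF, eq⟩, hφ⟩ := h
    exact ⟨F, hF, eq ▸ ih hφ⟩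
  | all x φ ih => exact cast (congrArg (Sat 𝔄 φ) h.1) (ih h.2)
  | _ => exact h

theorem Certifies.congr (h : Certifies 𝔄 X φ o) (eq : ∀ μ, o ≤ μ → μ < o + φ.numNodes → X μ = Y μ) :
    Certifies 𝔄 Y φ o := by
  induction φ generalizing o with
  | and φ ψ ih ih' =>
    have pos := φ.numNodes_pos
    have pos' := ψ.numNodes_pos
    simp only [Formula.numNodes] at eq
    refine ⟨?_, ih h.2.1 fun μ _ _ => eq μ (by omega) (by omega),
      ih' h.2.2 fun μ _ _ => eq μ (by omega) (by omega)⟩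
    rw [← eq o le_rfl (by omega), ← eq (o + 1) (by omega) (by omega),
      ← eq (o + 1 + φ.numNodes) (by omega) (by omega)]
    exact h.1
  | or φ ψ ih ih' =>
    have pos := φ.numNodes_pos
    have pos' := ψ.numNodes_pos
    simp only [Formula.numNodes] at eq
    refine ⟨?_, ih h.2.1 fun μ _ _ => eq μ (by omega) (by omega),
      ih' h.2.2 fun μ _ _ => eq μ (by omega) (by omega)⟩
    rw [← eq o le_rfl (by omega), ← eq (o + 1) (by omega) (by omega),
      ← eq (o + 1 + φ.numNodes) (by omega) (by omega)]
    exact h.1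
  | ex x φ ih =>
    have pos := φ.numNodes_pos
    simp only [Formula.numNodes] at eq
    refine ⟨?_, ih h.2 fun μ _ _ => eq μ (by omega) (by omega)⟩
    rw [← eq o le_rfl (by omega), ← eq (o + 1) (by omega) (by omega)]
    exact h.1
  | all x φ ih =>
    have pos := φ.numNodes_pos
    simp only [Formula.numNodes] at eq
    refine ⟨?_, ih h.2 fun μ _ _ => eq μ (by omega) (by omega)⟩
    rw [← eq o le_rfl (by omega), ← eq (o + 1) (by omega) (by omega)]
    exact h.1
  | _ =>
    have atom := eq o le_rfl (Nat.lt_succ_self o)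
    unfold Certifies at h ⊢
    rwa [← atom]

/-- The sequence of teams consisting of `X` up to number `o`, then of `Y` up to number `o + k`, and
then of `Z`. -/
def glue (X : Set (Assignment A)) (Y Z : ℕ → Set (Assignment A)) (o k μ : ℕ) :
    Set (Assignment A) :=
  if μ ≤ o then X else if μ ≤ o + k then Y μ else Z μ

theorem supportedIn_glue {X : Set (Assignment A)} (hX : SupportedIn m X)
    (hY : ∀ μ, SupportedIn m (Y μ)) (hZ : ∀ μ, SupportedIn m (Z μ)) (o k μ : ℕ) :
    SupportedIn m (glue X Y Z o k μ) := by
  unfold glue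
  split_ifs
  exacts [hX, hY μ, hZ μ]

theorem glue_self (X : Set (Assignment A)) {k : ℕ} : glue X Y Z o k o = X := if_pos le_rfl

theorem glue_succ (X : Set (Assignment A)) {k : ℕ} (hk : 0 < k) :
    glue X Y Z o k (o + 1) = Y (o + 1) := by
  rw [glue, if_neg (by omega), if_pos (by omega)]

theorem glue_succ_add (X : Set (Assignment A)) {k : ℕ} :
    glue X Y Z o k (o + 1 + k) = Z (o + 1 + k) := by
  rw [glue, if_neg (by omega), if_neg (by omega)]

theorem Certifies.glue_left (h : Certifies 𝔄 Y φ (o + 1)) (X : Set (Assignment A)) :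
    Certifies 𝔄 (glue X Y Z o φ.numNodes) φ (o + 1) :=
  h.congr fun μ _ _ => by rw [glue, if_neg (by omega), if_pos (by omega)]

theorem Certifies.glue_right {k : ℕ} (h : Certifies 𝔄 Z ψ (o + 1 + k)) (X : Set (Assignment A)) :
    Certifies 𝔄 (glue X Y Z o k) ψ (o + 1 + k) :=
  h.congr fun μ _ _ => by rw [glue, if_neg (by omega), if_neg (by omega)]

theorem exists_certifies (hφ : φ.vars ⊆ Finset.range m) {X : Set (Assignment A)}
    (hX : SupportedIn m X) (h : Sat 𝔄 φ X) (o : ℕ) :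
    ∃ Y : ℕ → Set (Assignment A), (∀ μ, SupportedIn m (Y μ)) ∧ Y o = X ∧ Certifies 𝔄 Y φ o := by
  induction φ generalizing X o with
  | and φ ψ ih ih' =>
    obtain ⟨hφ, hψ⟩ := Finset.union_subset_iff.1 hφ
    obtain ⟨Y, hY, Y_eq, certY⟩ := ih hφ hX h.1 (o + 1)
    obtain ⟨Z, hZ, Z_eq, certZ⟩ := ih' hψ hX h.2 (o + 1 + φ.numNodes)
    refine ⟨glue X Y Z o φ.numNodes, supportedIn_glue hX hY hZ o _, glue_self X, ?_,
      certY.glue_left X, certZ.glue_right X⟩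
    rw [glue_self, glue_succ X φ.numNodes_pos, glue_succ_add]
    exact ⟨Y_eq, Z_eq⟩
  | or φ ψ ih ih' =>
    obtain ⟨hφ, hψ⟩ := Finset.union_subset_iff.1 hφ
    obtain ⟨Y₀, Z₀, rfl, sat, sat'⟩ := h
    obtain ⟨Y, hY, rfl, certY⟩ := ih hφ (fun s hs => hX s (.inl hs)) sat (o + 1)
    obtain ⟨Z, hZ, rfl, certZ⟩ := ih' hψ (fun s hs => hX s (.inr hs)) sat' (o + 1 + φ.numNodes)
    refine ⟨glue _ Y Z o φ.numNodes, supportedIn_glue hX hY hZ o _, glue_self _, ?_,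
      certY.glue_left _, certZ.glue_right _⟩
    rw [glue_self, glue_succ _ φ.numNodes_pos, glue_succ_add]
  | ex x φ ih =>
    obtain ⟨hx, hφ⟩ := Finset.insert_subset_iff.1 hφ
    obtain ⟨F, hF, sat⟩ := h
    obtain ⟨Y, hY, Y_eq, certY⟩ := ih hφ (hX.supplement F (Finset.mem_range.1 hx)) sat (o + 1)
    refine ⟨glue X Y Y o φ.numNodes, supportedIn_glue hX hY hY o _, glue_self X, ⟨F, ?_⟩,
      certY.glue_left X⟩
    rw [glue_self, glue_succ X φ.numNodes_pos]
    exact ⟨hF, Y_eq⟩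
  | all x φ ih =>
    obtain ⟨hx, hφ⟩ := Finset.insert_subset_iff.1 hφ
    obtain ⟨Y, hY, Y_eq, certY⟩ := ih hφ (hX.duplicate (Finset.mem_range.1 hx)) h (o + 1)
    refine ⟨glue X Y Y o φ.numNodes, supportedIn_glue hX hY hY o _, glue_self X, ?_,
      certY.glue_left X⟩
    rw [glue_self, glue_succ X φ.numNodes_pos]
    exact Y_eq
  | _ => exact ⟨fun _ => X, fun _ => hX, rfl, h⟩

end

/-! ## Words that encode structures -/

section

variable {m n k : ℕ}

theorem getElem?_flatten_ofFn (f : Fin m → List Bool) (i : Fin m) (hk : k < (f i).length) :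
    (List.ofFn f).flatten[∑ j with j < i, (f j).length + k]? = (f i)[k]? := by
  induction m with
  | zero => exact i.elim0
  | succ m ih =>
    rw [List.ofFn_succ, List.flatten_cons, Finset.sum_filter, Fin.sum_univ_succ]
    cases i using Fin.cases with
    | zero =>
      simp only [Fin.not_lt_zero, if_false, Finset.sum_const_zero, zero_add]
      exact List.getElem?_append_left hk
    | succ i =>
      simp only [Fin.succ_pos, if_true, Fin.succ_lt_succ_iff, ← Finset.sum_filter, add_assoc]
      rw [List.getElem?_append_right (Nat.le_add_right _ _), Nat.add_sub_cancel_left]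
      exact ih (fun i => f i.succ) i hk

theorem exists_flatten_ofFn_eq {l : Fin m → ℕ} {x : List Bool} (hx : x.length = ∑ i, l i) :
    ∃ f : Fin m → List Bool, (∀ i, (f i).length = l i) ∧ (List.ofFn f).flatten = x := by
  induction m generalizing x with
  | zero =>
    rw [Fin.sum_univ_zero] at hx
    exact ⟨fun _ => [], fun i => i.elim0, (List.length_eq_zero_iff.1 hx).symm⟩
  | succ m ih =>
    rw [Fin.sum_univ_succ] at hx
    obtain ⟨f, hf, h⟩ := ih (l := fun i => l i.succ) (x := x.drop (l 0))
      (by rw [List.length_drop, hx, Nat.add_sub_cancel_left])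
    refine ⟨Fin.cons (x.take (l 0)) f, Fin.cases ?_ hf, ?_⟩
    · simp only [List.ofFn_succ, List.flatten_cons, Fin.cons_zero, Fin.cons_succ, h,
        List.take_append_drop]
    · rw [Fin.cons_zero, List.length_take, hx, min_eq_left (Nat.le_add_right _ _)]

theorem replicate_append_drop {x : List Bool} (h : ∀ j < n, x[j]? = some true)
    (hn : x[n]? = some false) : List.replicate n true ++ [false] ++ x.drop (n + 1) = x := by
  induction n generalizing x with
  | zero => cases x <;> simp_all
  | succ n ih =>
    cases x with
    | nil => simp at hn
    | cons b x =>
      obtain rfl : b = true := by simpa using h 0 n.succ_pos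
      have tail := ih (fun j hj => h (j + 1) (Nat.succ_lt_succ hj)) hn
      rw [List.replicate_succ, List.cons_append, List.cons_append, List.drop_succ_cons, tail]

theorem encodeRel_getElem? (R : Set (Fin k → Fin n)) (a : Fin k → Fin n) :
    (encodeRel R)[(finFunctionFinEquiv a : ℕ)]? = some true ↔ a ∈ R := by
  simp only [encodeRel, List.getElem?_ofFn, dif_pos (finFunctionFinEquiv a).isLt, Option.some_inj,
    decide_eq_true_iff, Fin.eta, Equiv.symm_apply_apply]

theorem exists_encodeRel_eq {x : List Bool} (hx : x.length = n ^ k) :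
    ∃ R : Set (Fin k → Fin n), encodeRel R = x := by
  refine ⟨{a | x[(finFunctionFinEquiv a : ℕ)]? = some true}, ?_⟩
  refine List.ext_getElem ((encodeRel_length _).trans hx.symm) fun i _ hi => ?_
  simp only [encodeRel, List.getElem_ofFn, Set.mem_ofPred_eq, Equiv.apply_symm_apply,
    List.getElem?_eq_getElem hi, Option.some_inj, Bool.decide_eq_true]

end

/-- The position at which the encoding of the `i`-th relation of a structure on `{0, …, n - 1}`
starts. -/
def relOffset (σ : Vocabulary) (n : ℕ) (i : Fin σ.numRel) : ℕ :=
  n + 1 + ∑ j with j < i, n ^ σ.arity j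

/-- The length of the encoding of a structure on `{0, …, n - 1}`. -/
def structureLength (σ : Vocabulary) (n : ℕ) : ℕ := n + 1 + ∑ i, n ^ σ.arity i

/-- The structure on `{0, …, n - 1}` whose relations are read off the bits `b`, at the positions at
which `encodeStructure` puts them. -/
def structureOf (σ : Vocabulary) (n : ℕ) (b : ℕ → Prop) : Structure σ (Fin n) :=
  ⟨fun i => {a | b (relOffset σ n i + finFunctionFinEquiv a)}⟩

section

variable {σ : Vocabulary} {n : ℕ} (𝔄 : Structure σ (Fin n))

theorem length_encodeStructure : (encodeStructure 𝔄).length = structureLength σ n := by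
  simp [encodeStructure, structureLength, List.length_flatten, List.map_ofFn, List.sum_ofFn,
    encodeRel_length]
  ring

theorem encodeStructure_rel (i : Fin σ.numRel) (a : Fin (σ.arity i) → Fin n) :
    (encodeStructure 𝔄)[relOffset σ n i + finFunctionFinEquiv a]? = some true ↔ a ∈ 𝔄.rel i := by
  have head_length : (List.replicate n true ++ [false]).length = n + 1 := by
    rw [List.length_append, List.length_replicate, List.length_singleton]
  have bit := getElem?_flatten_ofFn (fun i => encodeRel (𝔄.rel i)) i
    ((finFunctionFinEquiv a).isLt.trans_eq (encodeRel_length _).symm)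
  simp only [encodeRel_length] at bit
  rw [encodeStructure, relOffset, add_assoc, List.getElem?_append_right (by omega), head_length,
    Nat.add_sub_cancel_left, bit, encodeRel_getElem?]

theorem encodeStructure_getElem?_of_lt {j : ℕ} (hj : j < n) :
    (encodeStructure 𝔄)[j]? = some true := by
  rw [encodeStructure, List.append_assoc,
    List.getElem?_append_left (hj.trans_eq List.length_replicate.symm), List.getElem?_replicate,
    if_pos hj]

theorem encodeStructure_getElem?_self : (encodeStructure 𝔄)[n]? = some false := by
  rw [encodeStructure, List.append_assoc, List.getElem?_append_right List.length_replicate.le,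
    List.length_replicate, Nat.sub_self]
  rfl

theorem relOffset_add_lt (i : Fin σ.numRel) (a : Fin (σ.arity i) → Fin n) :
    relOffset σ n i + finFunctionFinEquiv a < structureLength σ n := by
  have full := (encodeStructure_rel (⟨fun _ => Set.univ⟩ : Structure σ (Fin n)) i a).2 trivial
  rw [← length_encodeStructure]
  exact (List.getElem?_eq_some_iff.1 full).1

theorem structureOf_eq {b : ℕ → Prop}
    (hb : ∀ j < structureLength σ n, b j ↔ (encodeStructure 𝔄)[j]? = some true) :
    structureOf σ n b = 𝔄 :=
  congrArg Structure.mk <| funext fun i => Set.ext fun a =>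
    (hb _ (relOffset_add_lt i a)).trans (encodeStructure_rel 𝔄 i a)

theorem leadingLength_encodeStructure {b : ℕ} (hb : n < b) {p : ℕ → Prop}
    (hp : ∀ j ≤ n, p j ↔ (encodeStructure 𝔄)[j]? = some true) : leadingLength b p = n := by
  refine leadingLength_eq hb (fun j hj => (hp j hj.le).2 (encodeStructure_getElem?_of_lt 𝔄 hj)) ?_
  rw [hp n le_rfl, encodeStructure_getElem?_self]
  simp

theorem lt_structureLength (n : ℕ) : n < structureLength σ n := by
  unfold structureLength
  omega

/-- The size of the universe of the structure that is encoded by a word. -/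
noncomputable def universeSize (x : List Bool) : ℕ :=
  leadingLength x.length fun j => x[j]? = some true

theorem universeSize_encodeStructure : universeSize (encodeStructure 𝔄) = n :=
  leadingLength_encodeStructure 𝔄
    ((lt_structureLength n).trans_eq (length_encodeStructure 𝔄).symm) fun _ _ => Iff.rfl

theorem exists_eq_encodeStructure {x : List Bool}
    (hx : x.length = structureLength σ (universeSize x)) :
    ∃ 𝔄 : Structure σ (Fin (universeSize x)), x = encodeStructure 𝔄 := by
  have size_lt : universeSize x < x.length := (lt_structureLength _).trans_eq hx.symm
  obtain ⟨ones, zero⟩ := leadingLength_spec size_lt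
  change ∀ j < universeSize x, _ at ones
  change ¬ x[universeSize x]? = some true at zero
  generalize universeSize x = n at *
  have zero : x[n]? = some false := by
    rw [List.getElem?_eq_getElem size_lt] at zero ⊢
    simpa only [Option.some_inj, Bool.not_eq_true] using zero
  obtain ⟨f, hf, flatten_eq⟩ := exists_flatten_ofFn_eq (l := fun i => n ^ σ.arity i)
    (x := x.drop (n + 1)) (by rw [List.length_drop, hx, structureLength, Nat.add_sub_cancel_left])
  choose R hR using fun i => exists_encodeRel_eq (hf i)
  refine ⟨⟨R⟩, ?_⟩
  simp only [encodeStructure, hR, flatten_eq, replicate_append_drop ones zero]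

end

/-! ## Words that encode teams -/

/-- The assignment with domain `D` whose values, in the increasing order of the variables, are
`a`. -/
noncomputable def tupleAssignment {n : ℕ} (D : Finset ℕ) (a : Fin D.card → Fin n) :
    Assignment (Fin n) :=
  Function.extend (D.orderEmbOfFin rfl) (some ∘ a) fun _ => none

/-- The team with domain `D` and characteristic word `z`. -/
def teamOf {n : ℕ} (D : Finset ℕ) (z : Fin (n ^ D.card) → Bool) : Set (Assignment (Fin n)) :=
  tupleAssignment D '' {a | z (finFunctionFinEquiv a) = true}

section

variable {n : ℕ} {D : Finset ℕ} {z z' : Fin (n ^ D.card) → Bool}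

theorem tupleAssignment_comp (a : Fin D.card → Fin n) :
    tupleAssignment D a ∘ D.orderEmbOfFin rfl = some ∘ a :=
  funext fun i => (D.orderEmbOfFin rfl).injective.extend_apply (some ∘ a) (fun _ => none) i

theorem tupleAssignment_of_notMem (a : Fin D.card → Fin n) {x : ℕ} (hx : x ∉ D) :
    tupleAssignment D a x = none :=
  Function.extend_apply' _ _ _ fun ⟨i, hi⟩ => hx (hi ▸ Finset.orderEmbOfFin_mem D rfl i)

theorem eq_tupleAssignment_iff {s : Assignment (Fin n)} {a : Fin D.card → Fin n} :
    s = tupleAssignment D a ↔ s ∘ D.orderEmbOfFin rfl = some ∘ a ∧ ∀ x ∉ D, s x = none := by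
  constructor
  · rintro rfl
    exact ⟨tupleAssignment_comp a, fun x => tupleAssignment_of_notMem a⟩
  · rintro ⟨values, outside⟩
    funext x
    by_cases hx : x ∈ D
    · obtain ⟨i, rfl⟩ : x ∈ Set.range (D.orderEmbOfFin rfl) := by
        rwa [Finset.range_orderEmbOfFin]
      exact congrFun (values.trans (tupleAssignment_comp a).symm) i
    · rw [outside x hx, tupleAssignment_of_notMem a hx]

theorem tupleAssignment_injective :
    Function.Injective (tupleAssignment D : (Fin D.card → Fin n) → Assignment (Fin n)) := by
  intro a b h
  have values_eq : some ∘ a = some ∘ b := by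
    rw [← tupleAssignment_comp a, h, tupleAssignment_comp]
  exact (Option.some_injective _).comp_left values_eq

theorem isTeam_teamOf (z : Fin (n ^ D.card) → Bool) : IsTeam D (teamOf D z) := by
  rintro _ ⟨a, -, rfl⟩ x
  by_cases hx : x ∈ D
  · obtain ⟨i, rfl⟩ : x ∈ Set.range (D.orderEmbOfFin rfl) := by rwa [Finset.range_orderEmbOfFin]
    simp only [iff_true_right hx, congrFun (tupleAssignment_comp a) i, Function.comp_apply,
      Option.isSome_some, ← Function.comp_apply (f := tupleAssignment D a)]
  · simp only [hx, tupleAssignment_of_notMem a hx, Option.isSome_none, Bool.false_eq_true]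

theorem tupleAssignment_mem_teamOf {a : Fin D.card → Fin n} :
    tupleAssignment D a ∈ teamOf D z ↔ z (finFunctionFinEquiv a) = true :=
  tupleAssignment_injective.mem_set_image

theorem ncard_teamOf (z : Fin (n ^ D.card) → Bool) : (teamOf D z).ncard = weight z := by
  have image_eq : {a : Fin D.card → Fin n | z (finFunctionFinEquiv a) = true} =
      finFunctionFinEquiv.symm '' {j | z j = true} := by
    rw [Equiv.image_symm_eq_preimage]
    rfl
  rw [teamOf, Set.ncard_image_of_injective _ tupleAssignment_injective, image_eq,
    Set.ncard_image_of_injective _ finFunctionFinEquiv.symm.injective,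
    Set.ncard_eq_toFinset_card', Set.toFinset_ofPred, Finset.card_filter]
  exact Finset.sum_congr rfl fun j _ => by cases z j <;> rfl

theorem teamOf_eq_empty_iff : teamOf D z = ∅ ↔ z = ⊥ := by
  rw [teamOf, Set.image_eq_empty, Set.eq_empty_iff_forall_notMem, funext_iff,
    finFunctionFinEquiv.surjective.forall]
  exact forall_congr' fun a => (Bool.not_eq_true _).to_iff

theorem encodeTeam_teamOf (z : Fin (n ^ D.card) → Bool) :
    encodeTeam D (teamOf D z) = List.ofFn z := by
  have tuples_eq : {a : Fin D.card → Fin n | ∃ s ∈ teamOf D z, s ∘ D.orderEmbOfFin rfl = some ∘ a} =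
      {a | z (finFunctionFinEquiv a) = true} := by
    ext a
    refine ⟨?_, fun ha => ⟨_, tupleAssignment_mem_teamOf.2 ha, tupleAssignment_comp a⟩⟩
    rintro ⟨_, ⟨b, hb, rfl⟩, h⟩
    obtain rfl : b = a :=
      (Option.some_injective _).comp_left ((tupleAssignment_comp b).symm.trans h)
    exact hb
  rw [encodeTeam, tuples_eq, encodeRel]
  congr 1
  funext j
  simp only [Set.mem_ofPred_eq, Equiv.apply_symm_apply, Bool.decide_eq_true]

theorem IsTeam.exists_eq_teamOf {X : Set (Assignment (Fin n))} (hX : IsTeam D X) :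
    ∃ z : Fin (n ^ D.card) → Bool, X = teamOf D z := by
  classical
  refine ⟨fun j => decide (tupleAssignment D (finFunctionFinEquiv.symm j) ∈ X), ?_⟩
  have mem_iff (a : Fin D.card → Fin n) : tupleAssignment D a ∈ X ↔ tupleAssignment D a ∈
      teamOf D fun j => decide (tupleAssignment D (finFunctionFinEquiv.symm j) ∈ X) := by
    rw [tupleAssignment_mem_teamOf, decide_eq_true_iff, Equiv.symm_apply_apply]
  ext s
  constructor
  · intro hs
    choose a ha using fun i =>
      Option.isSome_iff_exists.1 ((hX s hs _).2 (Finset.orderEmbOfFin_mem D rfl i))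
    obtain rfl : s = tupleAssignment D a := eq_tupleAssignment_iff.2 ⟨funext ha, fun x hx =>
      Option.not_isSome_iff_eq_none.1 (mt (hX s hs x).1 hx)⟩
    exact (mem_iff a).1 hs
  · rintro ⟨a, ha, rfl⟩
    exact (mem_iff a).2 ⟨a, ha, rfl⟩

theorem codedAssignment_mem_teamOf {m : ℕ} (hD : D ⊆ Finset.range m) {f : ℕ → Bool} {j : ℕ} :
    codedAssignment n m j ∈ teamOf D (fun i : Fin (n ^ D.card) => f i) ↔
      (∀ x ∈ Finset.range m \ D, ¬ 1 ≤ digit (n + 1) j x) ∧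
      (∀ l, 1 ≤ digit (n + 1) j (D.orderEmbOfFin rfl l)) ∧
        f (∑ l, (digit (n + 1) j (D.orderEmbOfFin rfl l) - 1) * n ^ (l : ℕ)) = true := by
  have none_iff : (∀ x ∉ D, codedAssignment n m j x = none) ↔
      ∀ x ∈ Finset.range m \ D, ¬ 1 ≤ digit (n + 1) j x := by
    simp only [Finset.mem_sdiff, Finset.mem_range, and_imp]
    refine ⟨fun h x hx hxD => ?_, fun h x hxD => ?_⟩
    · rw [← exists_codedAssignment_eq_some_iff hx, h x hxD]
      exact fun ⟨_, h⟩ => Option.some_ne_none _ h.symm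
    · obtain hx | hx := lt_or_ge x m
      · refine Option.eq_none_iff_forall_ne_some.2 fun a ha => h x hx hxD ?_
        exact (exists_codedAssignment_eq_some_iff hx).1 ⟨a, ha⟩
      · exact codedAssignment_of_le hx
  rw [← none_iff, ← exists_codedAssignment_comp_eq_iff
    (fun l => Finset.mem_range.1 (hD (Finset.orderEmbOfFin_mem D rfl l))) (f · = true)]
  simp only [teamOf, Set.mem_image, Set.mem_ofPred_eq, eq_comm (b := codedAssignment n m j),
    eq_tupleAssignment_iff]
  tauto

variable {σ : Vocabulary} (φ : Formula σ) (𝔄 : Structure σ (Fin n))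

/-- The characteristic words of the teams that satisfy a formula. -/
def satWords : Set (Fin (n ^ φ.free.card) → Bool) :=
  {z | Sat 𝔄 φ (teamOf φ.free z)}

theorem isMaxCardTeam_teamOf_iff {z : Fin (n ^ φ.free.card) → Bool} :
    IsMaxCardTeam φ 𝔄 (teamOf φ.free z) ↔
      z ∈ satWords φ 𝔄 ∧ z ≠ ⊥ ∧ ∀ z' ∈ satWords φ 𝔄, weight z' ≤ weight z := by
  rw [IsMaxCardTeam, and_iff_right (isTeam_teamOf z), ne_eq, teamOf_eq_empty_iff]
  refine and_congr_right fun _ => and_congr_right fun _ => ⟨fun h z' hz' => ?_, fun h X' hX' => ?_⟩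
  · by_contra! hlt
    rw [← ncard_teamOf, ← ncard_teamOf] at hlt
    exact h _ (isTeam_teamOf z') hlt hz'
  · obtain ⟨z', rfl⟩ := hX'.exists_eq_teamOf
    rw [ncard_teamOf, ncard_teamOf]
    exact fun hlt hz' => (h z' hz').not_gt hlt

theorem mem_ECardMaxSat_encodeStructure {y : List Bool} :
    y ∈ ECardMaxSat φ (encodeStructure 𝔄) ↔
      ∃ z ∈ satWords φ 𝔄, z ≠ ⊥ ∧ (∀ z' ∈ satWords φ 𝔄, weight z' ≤ weight z) ∧
        y = List.ofFn z := by
  constructor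
  · rintro ⟨n', 𝔅, X, h, hX, rfl⟩
    obtain ⟨rfl, h⟩ := Sigma.mk.inj (encodeStructure_injective (a₁ := ⟨n, 𝔄⟩) (a₂ := ⟨n', 𝔅⟩) h)
    obtain rfl := eq_of_heq h
    obtain ⟨z, rfl⟩ := hX.1.exists_eq_teamOf
    obtain ⟨hz, ne, max⟩ := (isMaxCardTeam_teamOf_iff φ 𝔄).1 hX
    exact ⟨z, hz, ne, max, encodeTeam_teamOf z⟩
  · rintro ⟨z, hz, ne, max, rfl⟩
    exact ⟨n, 𝔄, _, rfl, (isMaxCardTeam_teamOf_iff φ 𝔄).2 ⟨hz, ne, max⟩, (encodeTeam_teamOf z).symm⟩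

end

/-! ## Checking certificates in polynomial time -/

theorem PolyTime.digit {Γ : Type} [Context Γ] {b f : Γ → ℕ} (hb : PolyTime b) (hf : PolyTime f)
    (x : ℕ) : PolyTime fun c => digit (b c) (f c) x :=
  (hf.div (hb.pow x)).mod hb

/-- A number that can be computed from the input word in polynomial time, in every context. -/
def InputPolyTime (n : List Bool → ℕ) : Prop :=
  ∀ (Γ : Type) [Context Γ], PolyTime fun c : Γ => n (input c)

/-- A set of numbers, depending on the input word, to which membership of computed numbers can be
decided in polynomial time, in every context. -/
def InputPolyDecidable (b : List Bool → ℕ → Prop) : Prop :=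
  ∀ ⦃Γ : Type⦄ [Context Γ] ⦃f : Γ → ℕ⦄, PolyTime f → PolyDecidable fun c => b (input c) (f c)

namespace InputPolyDecidable

variable {b : List Bool → ℕ → Prop}

theorem not (hb : InputPolyDecidable b) : InputPolyDecidable fun v j => ¬ b v j :=
  fun _ _ _ hf => (hb hf).not

theorem shift (hb : InputPolyDecidable b) {r : List Bool → ℕ} (hr : InputPolyTime r) :
    InputPolyDecidable fun v j => b v (r v + j) :=
  fun _ _ _ hf => hb ((hr _).add hf)

end InputPolyDecidable

/-- A team, depending on the input word, to which membership of coded assignments can be decided in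
polynomial time, in every context. -/
structure PolyTeam (n : List Bool → ℕ) (m : ℕ) (X : ∀ v, Set (Assignment (Fin (n v)))) : Prop where
  supportedIn (v : List Bool) : SupportedIn m (X v)
  polyDecidable {Γ : Type} [Context Γ] {f : Γ → ℕ} : PolyTime f →
    PolyDecidable fun c => codedAssignment (n (input c)) m (f c) ∈ X (input c)

namespace InputPolyTime

variable {n : List Bool → ℕ} {Γ : Type} [Context Γ] {f g : Γ → ℕ} {m k x y : ℕ} {xs ys : Fin k → ℕ}

theorem digit (hn : InputPolyTime n) (hf : PolyTime f) (x : ℕ) :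
    PolyTime fun c => digit (n (input c) + 1) (f c) x :=
  ((hn Γ).add (.const 1)).digit hf x

theorem digit_eq (hn : InputPolyTime n) (hf : PolyTime f) (hg : PolyTime g) (x y : ℕ) :
    PolyDecidable fun c =>
      TeamEnum.digit (n (input c) + 1) (f c) x = TeamEnum.digit (n (input c) + 1) (g c) y :=
  .eq (hn.digit hf x) (hn.digit hg y)

theorem codedAssignment_eq (hn : InputPolyTime n) (hf : PolyTime f) (hg : PolyTime g) (hx : x < m)
    (hy : y < m) : PolyDecidable fun c =>
      codedAssignment (n (input c)) m (f c) x = codedAssignment (n (input c)) m (g c) y :=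
  (hn.digit_eq hf hg x y).congr fun _ => codedAssignment_eq_iff hx hy

theorem codedAssignment_comp_eq (hn : InputPolyTime n) (hf : PolyTime f) (hg : PolyTime g)
    (hx : ∀ l, xs l < m) (hy : ∀ l, ys l < m) : PolyDecidable fun c =>
      codedAssignment (n (input c)) m (f c) ∘ xs = codedAssignment (n (input c)) m (g c) ∘ ys :=
  (PolyDecidable.forall_fin fun l => hn.digit_eq hf hg (xs l) (ys l)).congr fun _ =>
    codedAssignment_comp_eq_iff hx hy

theorem exists_codedAssignment_comp_eq (hn : InputPolyTime n) (hf : PolyTime f)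
    (hx : ∀ l, xs l < m) {b : List Bool → ℕ → Prop} (hb : InputPolyDecidable b) :
    PolyDecidable fun c => ∃ a : Fin k → Fin (n (input c)), b (input c) (finFunctionFinEquiv a) ∧
      codedAssignment (n (input c)) m (f c) ∘ xs = some ∘ a := by
  refine ((PolyDecidable.forall_fin fun l => .le (.const 1) (hn.digit hf (xs l))).and (hb ?_)).congr
    fun c => exists_codedAssignment_comp_eq_iff hx (b (input c))
  exact .finset_sum _ fun l _ => ((hn.digit hf (xs l)).sub (.const 1)).mul ((hn Γ).pow l)

theorem exists_eq_subst (hn : InputPolyTime n) (hf : PolyTime f) (hg : PolyTime g) (hx : x < m) :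
    PolyDecidable fun c => ∃ a, codedAssignment (n (input c)) m (g c) =
      (codedAssignment (n (input c)) m (f c)).subst a x := by
  refine ((PolyDecidable.le (.const 1) (hn.digit hg x)).and <| .finset_forall
    ((Finset.range m).erase x) fun y _ => hn.digit_eq hg hf y y).congr fun c => ?_
  rw [Assignment.exists_eq_subst_iff, exists_codedAssignment_eq_some_iff hx]
  refine and_congr_right fun _ => forall_congr' fun y => ?_
  obtain hy | hy := lt_or_ge y m
  · simp only [Finset.mem_erase, Finset.mem_range, hy, and_true, codedAssignment_eq_iff hy hy]
  · simp only [Finset.mem_erase, Finset.mem_range, hy.not_gt, and_false, false_implies,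
      codedAssignment_of_le hy, implies_true]

end InputPolyTime

namespace PolyTeam

variable {n : List Bool → ℕ} {m : ℕ} {X Y : ∀ v, Set (Assignment (Fin (n v)))} {Γ : Type}
  [Context Γ] {p : ∀ c : Γ, Assignment (Fin (n (input c))) → Prop}

theorem forall_mem (hX : PolyTeam n m X) (hn : InputPolyTime n)
    (hp : PolyDecidable fun c : Γ × ℕ => p c.1 (codedAssignment (n (input c.1)) m c.2)) :
    PolyDecidable fun c => ∀ s ∈ X (input c), p c s :=
  (PolyDecidable.forall_lt (((hn Γ).add (.const 1)).pow m)
    ((hX.polyDecidable .var).imp hp)).congr fun c => (hX.supportedIn (input c)).forall_mem_iff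

theorem exists_mem (hX : PolyTeam n m X) (hn : InputPolyTime n)
    (hp : PolyDecidable fun c : Γ × ℕ => p c.1 (codedAssignment (n (input c.1)) m c.2)) :
    PolyDecidable fun c => ∃ s ∈ X (input c), p c s :=
  (PolyDecidable.exists_lt (((hn Γ).add (.const 1)).pow m)
    ((hX.polyDecidable .var).and hp)).congr fun c => (hX.supportedIn (input c)).exists_mem_iff

theorem eq (hX : PolyTeam n m X) (hY : PolyTeam n m Y) (hn : InputPolyTime n) :
    PolyDecidable fun c : Γ => X (input c) = Y (input c) :=
  (PolyDecidable.forall_lt (((hn Γ).add (.const 1)).pow m)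
    ((hX.polyDecidable .var).iff (hY.polyDecidable .var))).congr fun c =>
      (hX.supportedIn (input c)).eq_iff (hY.supportedIn (input c))

theorem union (hX : PolyTeam n m X) (hY : PolyTeam n m Y) : PolyTeam n m fun v => X v ∪ Y v where
  supportedIn v := (hX.supportedIn v).union (hY.supportedIn v)
  polyDecidable hf := (hX.polyDecidable hf).or (hY.polyDecidable hf)

theorem duplicate (hX : PolyTeam n m X) (hn : InputPolyTime n) {x : ℕ} (hx : x < m) :
    PolyTeam n m fun v => duplicate (X v) x where
  supportedIn v := (hX.supportedIn v).duplicate hx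
  polyDecidable hf := hX.exists_mem hn (hn.exists_eq_subst .var hf.weaken hx)

theorem exists_eq_supplement (hX : PolyTeam n m X) (hY : PolyTeam n m Y) (hn : InputPolyTime n)
    {x : ℕ} (hx : x < m) : PolyDecidable fun c : Γ =>
      ∃ F, (∀ s ∈ X (input c), (F s).Nonempty) ∧ Y (input c) = supplement (X (input c)) F x :=
  ((hX.forall_mem hn (hY.exists_mem hn (hn.exists_eq_subst .var₁ .var hx))).and
    (hY.forall_mem hn (hX.exists_mem hn (hn.exists_eq_subst .var .var₁ hx)))).congr fun _ =>
      exists_eq_supplement_iff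

theorem forall_comp_eq_imp (hX : PolyTeam n m X) (hn : InputPolyTime n) {k l : ℕ}
    {xs : Fin k → ℕ} {ys : Fin l → ℕ} (hxs : ∀ i, xs i < m) (hys : ∀ i, ys i < m) :
    PolyDecidable fun c : Γ =>
      ∀ s ∈ X (input c), ∀ t ∈ X (input c), s ∘ xs = t ∘ xs → s ∘ ys = t ∘ ys :=
  hX.forall_mem hn <| hX.forall_mem hn <|
    (hn.codedAssignment_comp_eq .var₁ .var hxs hxs).imp
      (hn.codedAssignment_comp_eq .var₁ .var hys hys)

theorem forall_comp_eq_imp_exists (hX : PolyTeam n m X) (hn : InputPolyTime n) {k l r : ℕ}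
    {xs : Fin k → ℕ} {ys : Fin l → ℕ} {zs : Fin r → ℕ} (hxs : ∀ i, xs i < m)
    (hys : ∀ i, ys i < m) (hzs : ∀ i, zs i < m) :
    PolyDecidable fun c : Γ => ∀ s ∈ X (input c), ∀ t ∈ X (input c), s ∘ zs = t ∘ zs →
      ∃ u ∈ X (input c), u ∘ xs = s ∘ xs ∧ u ∘ ys = t ∘ ys ∧ u ∘ zs = s ∘ zs :=
  hX.forall_mem hn <| hX.forall_mem hn <|
    (hn.codedAssignment_comp_eq .var₁ .var hzs hzs).imp <| hX.exists_mem hn <|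
      (hn.codedAssignment_comp_eq .var .var₂ hxs hxs).and <|
        (hn.codedAssignment_comp_eq .var .var₁ hys hys).and <|
          hn.codedAssignment_comp_eq .var .var₂ hzs hzs

end PolyTeam

section

variable {σ : Vocabulary} {n : List Bool → ℕ} {b : List Bool → ℕ → Prop}

theorem InputPolyTime.relOffset (hn : InputPolyTime n) (i : Fin σ.numRel) :
    InputPolyTime fun v => relOffset σ (n v) i := fun Γ _ =>
  ((hn Γ).add (.const 1)).add <| .finset_sum _ fun j _ => (hn Γ).pow (σ.arity j)

theorem InputPolyTime.structureLength (hn : InputPolyTime n) :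
    InputPolyTime fun v => structureLength σ (n v) := fun Γ _ =>
  ((hn Γ).add (.const 1)).add <| .finset_sum _ fun j _ => (hn Γ).pow (σ.arity j)

theorem forall_lt_of_tupleVars_subset {k m : ℕ} {xs : Fin k → ℕ}
    (h : tupleVars xs ⊆ Finset.range m) (l : Fin k) : xs l < m :=
  Finset.mem_range.1 (h (Finset.mem_image_of_mem xs (Finset.mem_univ l)))

variable {m : ℕ} {X : ∀ v, ℕ → Set (Assignment (Fin (n v)))}

theorem PolyDecidable.certifies (hn : InputPolyTime n)
    (hb : InputPolyDecidable b) (hX : ∀ μ, PolyTeam n m fun v => X v μ) {φ : Formula σ}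
    (hφ : φ.vars ⊆ Finset.range m) (o : ℕ) {Γ : Type} [Context Γ] :
    PolyDecidable fun c : Γ =>
      Certifies (structureOf σ (n (input c)) (b (input c))) (X (input c)) φ o := by
  induction φ generalizing o with
  | eq x y =>
    simp only [Formula.vars, Formula.free, Finset.insert_subset_iff, Finset.singleton_subset_iff,
      Finset.mem_range] at hφ
    exact (hX o).forall_mem hn (hn.codedAssignment_eq .var .var hφ.1 hφ.2)
  | neq x y =>
    simp only [Formula.vars, Formula.free, Finset.insert_subset_iff, Finset.singleton_subset_iff,
      Finset.mem_range] at hφ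
    exact (hX o).forall_mem hn (hn.codedAssignment_eq .var .var hφ.1 hφ.2).not
  | rel i xs =>
    exact (hX o).forall_mem hn <| hn.exists_codedAssignment_comp_eq .var
      (forall_lt_of_tupleVars_subset hφ) (hb.shift (hn.relOffset i))
  | nrel i xs =>
    exact (hX o).forall_mem hn <| hn.exists_codedAssignment_comp_eq .var
      (forall_lt_of_tupleVars_subset hφ) (hb.shift (hn.relOffset i)).not
  | and φ ψ ih ih' =>
    obtain ⟨hφ, hψ⟩ := Finset.union_subset_iff.1 hφ
    exact (((hX _).eq (hX _) hn).and ((hX _).eq (hX _) hn)).and ((ih hφ _).and (ih' hψ _))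
  | or φ ψ ih ih' =>
    obtain ⟨hφ, hψ⟩ := Finset.union_subset_iff.1 hφ
    exact (((hX _).union (hX _)).eq (hX _) hn).and ((ih hφ _).and (ih' hψ _))
  | ex x φ ih =>
    obtain ⟨hx, hφ⟩ := Finset.insert_subset_iff.1 hφ
    exact ((hX _).exists_eq_supplement (hX _) hn (Finset.mem_range.1 hx)).and (ih hφ _)
  | all x φ ih =>
    obtain ⟨hx, hφ⟩ := Finset.insert_subset_iff.1 hφ
    exact ((hX _).eq ((hX _).duplicate hn (Finset.mem_range.1 hx)) hn).and (ih hφ _)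
  | dep xs ys =>
    obtain ⟨hxs, hys⟩ := Finset.union_subset_iff.1 hφ
    exact (hX o).forall_comp_eq_imp hn (forall_lt_of_tupleVars_subset hxs)
      (forall_lt_of_tupleVars_subset hys)
  | inc xs ys =>
    obtain ⟨hxs, hys⟩ := Finset.union_subset_iff.1 hφ
    exact (hX o).forall_mem hn <| (hX o).exists_mem hn <| hn.codedAssignment_comp_eq .var₁ .var
      (forall_lt_of_tupleVars_subset hxs) (forall_lt_of_tupleVars_subset hys)
  | indep xs ys zs =>
    obtain ⟨hxys, hzs⟩ := Finset.union_subset_iff.1 hφ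
    obtain ⟨hxs, hys⟩ := Finset.union_subset_iff.1 hxys
    exact (hX o).forall_comp_eq_imp_exists hn (forall_lt_of_tupleVars_subset hxs)
      (forall_lt_of_tupleVars_subset hys) (forall_lt_of_tupleVars_subset hzs)

end

theorem Supports.congr {N i : ℕ} {a a' : ℕ → Bool} {z : Fin N → Bool} (h : Supports a i z)
    (eq : ∀ j < 3 * N, a j = a' j) : Supports a' i z := by
  have block_eq (k : ℕ) (hk : k < 3) : block N a k = block N a' k := by
    funext j
    exact eq _ (by have := j.2; interval_cases k <;> omega)
  refine h.imp_right (Or.imp (fun h => ⟨h.1, ?_⟩) ?_)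
  · rw [← eq (i + N) (by omega)]
    exact h.2
  · rw [block_eq 0 (by decide), block_eq 1 (by decide), block_eq 2 (by decide)]
    exact id

section

variable {Γ : Type} [Context Γ] {N : Γ → ℕ} {z : Γ → ℕ → Bool}

theorem PolyTime.weight (hN : PolyTime N) (hz : PolyDecidable fun c : Γ × ℕ => z c.1 c.2 = true) :
    PolyTime fun c => weight fun j : Fin (N c) => z c j := by
  have bit : PolyTime fun c : Γ × ℕ => (z c.1 c.2).toNat :=
    hz.polyTime_ite_one.congr fun c => Bool.cond_eq_ite ..
  exact (PolyTime.sum hN bit).congr fun c => (Finset.sum_range fun j => (z c j).toNat).symm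

theorem PolyDecidable.eq_bot (hN : PolyTime N)
    (hz : PolyDecidable fun c : Γ × ℕ => z c.1 c.2 = true) :
    PolyDecidable fun c => (fun j : Fin (N c) => z c j) = ⊥ :=
  (PolyDecidable.forall_lt (p := fun c j => ¬ z c j = true) hN hz.not).congr fun c => by
    simp only [funext_iff, Fin.forall_iff, Bool.not_eq_true]
    rfl

end

section

variable {N i : List Bool → ℕ} {a y z : List Bool → ℕ → Bool} {Γ : Type} [Context Γ]

theorem toLex_lt_toLex_iff {N : ℕ} {z y : ℕ → Bool} :
    toLex (fun j : Fin N => z j) < toLex (fun j : Fin N => y j) ↔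
      ∃ p < N, (∀ q < p, (z q = true ↔ y q = true)) ∧ ¬ z p = true ∧ y p = true := by
  change (∃ p : Fin N, (∀ q < p, z q = y q) ∧ z p < y p) ↔ _
  simp only [Fin.exists_iff, Fin.forall_iff, Fin.mk_lt_mk, Bool.lt_iff, Bool.not_eq_true,
    ← Bool.eq_iff_iff, exists_prop]
  exact exists_congr fun p => and_congr_right fun hp => and_congr_left fun _ =>
    forall_congr' fun q => ⟨fun h hq => h (hq.trans hp) hq, fun h _ => h⟩

theorem PolyDecidable.toLex_lt (hN : InputPolyTime N)
    (hz : InputPolyDecidable fun v j => z v j = true)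
    (hy : InputPolyDecidable fun v j => y v j = true) :
    PolyDecidable fun c : Γ => toLex (fun j : Fin (N (input c)) => z (input c) j) <
      toLex fun j : Fin (N (input c)) => y (input c) j :=
  (PolyDecidable.exists_lt (p := fun c p => (∀ q < p, (z (input c) q = true ↔
    y (input c) q = true)) ∧ ¬ z (input c) p = true ∧ y (input c) p = true) (hN Γ) <|
      (PolyDecidable.forall_lt .var (.iff (hz .var) (hy .var))).and
        ((hz .var).not.and (hy .var))).congr fun _ => toLex_lt_toLex_iff

theorem supports_iff {N i : ℕ} {a z : ℕ → Bool} :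
    Supports (N := N) a i (fun j => z j) ↔
      i < N ∧ i < weight (fun j : Fin N => z j) ∨
      (N ≤ i ∧ i < 2 * N) ∧ a (i + N) = true ∨
      ∃ p < N, i = 2 * N + p ∧ z p = true ∧ (∀ q < p, (z q = true ↔ a (2 * N + q) = true)) ∧
        (∀ j < N, a (0 * N + j) = true → j < weight fun j : Fin N => z j) ∧
        (block N a 1 = ⊥ ∨ toLex (fun j : Fin N => z j) < toLex (block N a 1)) := by
  refine or_congr_right (or_congr_right ?_)
  simp only [Fin.exists_iff, Fin.forall_iff, block, Fin.mk_lt_mk, ← Bool.eq_iff_iff, exists_prop]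
  exact exists_congr fun p => and_congr_right fun hp => and_congr_right fun _ =>
    and_congr_right fun _ => and_congr_left fun _ => forall_congr' fun q =>
      ⟨fun h hq => h (hq.trans hp) hq, fun h _ => h⟩

theorem PolyDecidable.supports (hN : InputPolyTime N) (hi : InputPolyTime i)
    (ha : InputPolyDecidable fun v j => a v j = true)
    (hz : InputPolyDecidable fun v j => z v j = true) :
    PolyDecidable fun c : Γ =>
      Supports (N := N (input c)) (a (input c)) (i (input c)) fun j => z (input c) j := by
  have multiple (k : ℕ) : InputPolyTime fun v => k * N v := fun Γ _ => (PolyTime.const k).mul (hN Γ)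
  have block (k : ℕ) : InputPolyDecidable fun v j => a v (k * N v + j) = true :=
    ha.shift (multiple k)
  refine PolyDecidable.congr (.or ?_ (.or ?_ (.exists_lt (hN Γ) ?_))) fun c => supports_iff
  · exact (PolyDecidable.lt (hi Γ) (hN Γ)).and (.lt (hi Γ) (.weight (hN Γ) (hz .var)))
  · exact ((PolyDecidable.le (hN Γ) (hi Γ)).and (.lt (hi Γ) (multiple 2 Γ))).and
      (ha ((hi Γ).add (hN Γ)))
  · have last : PolyDecidable fun c : Γ × ℕ =>
        TeamEnum.block (N (input c.1)) (a (input c.1)) 1 = ⊥ :=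
      .eq_bot (hN _) (z := fun c j => a (input c) (1 * N (input c) + j)) (block 1 .var)
    exact (PolyDecidable.eq (hi _) ((multiple 2 _).add .var)).and <| (hz .var).and <|
      (PolyDecidable.forall_lt .var ((hz .var).iff (block 2 .var))).and <|
        (PolyDecidable.forall_lt (hN _)
          ((block 0 .var).imp (.lt .var (.weight (hN _) (hz .var))))).and <|
          last.or (.toLex_lt hN hz (block 1))

end

/-! ## Certificates as bit sequences -/

section

variable {σ : Vocabulary} {D : Finset ℕ} {n m : ℕ}

/-- The team for the node `μ` of a formula, as it is read off a sequence of bits: the sequence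
starts with the characteristic word of a team with domain `D`, the team of the root; the nodes
`μ ≥ 1` use the bits from `μ * (n + 1) ^ m` on. -/
def certificateTeam (D : Finset ℕ) (n m : ℕ) (f : ℕ → Bool) : ℕ → Set (Assignment (Fin n))
  | 0 => teamOf D fun j : Fin (n ^ D.card) => f j
  | μ + 1 => codedTeam fun j : Fin ((n + 1) ^ m) => f ((μ + 1) * (n + 1) ^ m + j)

theorem pow_card_le_of_subset_range (n : ℕ) (hD : D ⊆ Finset.range m) :
    n ^ D.card ≤ (n + 1) ^ m := by
  have card_le : D.card ≤ m := by simpa only [Finset.card_range] using Finset.card_le_card hD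
  exact (Nat.pow_le_pow_left n.le_succ _).trans (Nat.pow_le_pow_right n.succ_pos card_le)

theorem certificateTeam_congr (hD : D ⊆ Finset.range m) {f g : ℕ → Bool} {μ : ℕ}
    (h : ∀ k < (μ + 1) * (n + 1) ^ m, f k = g k) :
    certificateTeam D n m f μ = certificateTeam D n m g μ := by
  cases μ with
  | zero =>
    refine congrArg (teamOf D) (funext fun j => h j ?_)
    simpa only [zero_add, one_mul] using j.2.trans_le (pow_card_le_of_subset_range n hD)
  | succ μ =>
    refine congrArg codedTeam (funext fun j => h _ ?_)
    rw [add_one_mul (μ + 1)]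
    exact Nat.add_lt_add_left j.2 _

theorem supportedIn_teamOf (hD : D ⊆ Finset.range m) (z : Fin (n ^ D.card) → Bool) :
    SupportedIn m (teamOf D z) := by
  intro s hs x hx
  have notMem : x ∉ D := fun h => hx.not_gt (Finset.mem_range.1 (hD h))
  exact Option.not_isSome_iff_eq_none.1 (mt (isTeam_teamOf z s hs x).1 notMem)

theorem supportedIn_certificateTeam (hD : D ⊆ Finset.range m) (f : ℕ → Bool) (μ : ℕ) :
    SupportedIn m (certificateTeam D n m f μ) := by
  cases μ with
  | zero => exact supportedIn_teamOf hD fun j => f j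
  | succ μ => exact supportedIn_codedTeam fun j => f (_ + j)

theorem exists_certifies_certificateTeam {φ : Formula σ} (hφ : φ.vars ⊆ Finset.range m)
    {𝔄 : Structure σ (Fin n)} {z : Fin (n ^ φ.free.card) → Bool} (hz : z ∈ satWords φ 𝔄) :
    ∃ f : ℕ → Bool, (∀ j : Fin (n ^ φ.free.card), f j = z j) ∧
      Certifies 𝔄 (certificateTeam φ.free n m f) φ 0 := by
  classical
  have hD := φ.free_subset_vars.trans hφ
  obtain ⟨Y, supported, root, certifies⟩ := exists_certifies hφ (supportedIn_teamOf hD z) hz 0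
  let f (k : ℕ) : Bool := if h : k < n ^ φ.free.card then z ⟨k, h⟩ else
    decide (codedAssignment n m k ∈ Y (k / (n + 1) ^ m))
  have prefix_eq (j : Fin (n ^ φ.free.card)) : f j = z j := dif_pos j.2
  refine ⟨f, prefix_eq, certifies.congr fun μ _ _ => ?_⟩
  cases μ with
  | zero => exact root.trans (congrArg _ (funext prefix_eq)).symm
  | succ μ =>
    refine (SupportedIn.eq_iff (supported _) (supportedIn_codedTeam _)).2 fun j hj => ?_
    have block_le : (n + 1) ^ m ≤ (μ + 1) * (n + 1) ^ m := Nat.le_mul_of_pos_left _ μ.succ_pos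
    have outside : ¬ (μ + 1) * (n + 1) ^ m + j < n ^ φ.free.card := by
      have := pow_card_le_of_subset_range n hD
      omega
    have index_div : ((μ + 1) * (n + 1) ^ m + j) / (n + 1) ^ m = μ + 1 := by
      rw [mul_comm, Nat.mul_add_div (by positivity), Nat.div_eq_of_lt hj, add_zero]
    rw [codedAssignment_mem_codedTeam hj]
    simp only [f, dif_neg outside, index_div, decide_eq_true_iff]
    rw [← codedAssignment_mod (j := _ + j), Nat.mul_add_mod', codedAssignment_mod]

theorem PolyTeam.certificateTeam {n : List Bool → ℕ} (hn : InputPolyTime n)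
    {f : List Bool → ℕ → Bool} (hf : InputPolyDecidable fun v j => f v j = true)
    (hD : D ⊆ Finset.range m) (μ : ℕ) :
    PolyTeam n m fun v => certificateTeam D (n v) m (f v) μ where
  supportedIn v := supportedIn_certificateTeam hD _ μ
  polyDecidable {Γ _ g} hg := by
    have power (Γ : Type) [Context Γ] : PolyTime fun c : Γ => (n (input c) + 1) ^ m :=
      ((hn Γ).add (.const 1)).pow m
    cases μ with
    | zero =>
      have digit_ne_zero (x : ℕ) := PolyDecidable.le (.const 1) (hn.digit hg x)
      refine PolyDecidable.congr (.and (.finset_forall _ fun x _ => (digit_ne_zero x).not)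
        (.and (.forall_fin fun l => digit_ne_zero _) (hf ?_)))
          fun c => codedAssignment_mem_teamOf hD
      exact .finset_sum _ fun l _ => ((hn.digit hg _).sub (.const 1)).mul ((hn Γ).pow l)
    | succ μ =>
      have index := ((PolyTime.const (μ + 1)).mul (power Γ)).add (hg.mod (power Γ))
      refine (hf index).congr fun c => ?_
      rw [← codedAssignment_mod]
      exact codedAssignment_mem_codedTeam (Nat.mod_lt _ (by positivity))

end

/-! ## The oracle -/

section

variable (q w : List Bool)

theorem pairWord_getElem?_two_mul {j : ℕ} (hj : j < q.length) :
    (pairWord q w)[2 * j]? = q[j]? := by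
  induction q generalizing j with
  | nil => exact absurd hj j.not_lt_zero
  | cons b q ih =>
    have cons_eq : pairWord (b :: q) w = b :: b :: pairWord q w := rfl
    cases j with
    | zero => rw [cons_eq, mul_zero, List.getElem?_cons_zero, List.getElem?_cons_zero]
    | succ j =>
      rw [cons_eq, mul_add_one, List.getElem?_cons_succ, List.getElem?_cons_succ,
        List.getElem?_cons_succ, ih (Nat.lt_of_succ_lt_succ hj)]

theorem length_pairWord : (pairWord q w).length = 2 * q.length + 2 + w.length := by
  rw [pairWord, List.length_append, List.length_append, List.length_flatMap]
  simp only [List.length_cons, List.length_nil, List.map_const', List.sum_replicate, smul_eq_mul,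
    mul_comm q.length]

theorem pairWord_getElem?_add (k : ℕ) : (pairWord q w)[2 * q.length + 2 + k]? = w[k]? := by
  have length_eq := length_pairWord q w
  rw [pairWord, List.length_append] at length_eq
  rw [pairWord, List.getElem?_append_right (by omega)]
  congr 1
  omega

end

/-- The oracle question number `i` about the input word `x`, for an array `a` of `3 * N` bits: the
input word, the array, and `i` in unary, padded to the length `3 * N`. -/
def question (x : List Bool) (N : ℕ) (a : ℕ → Bool) (i : ℕ) : List Bool :=
  x ++ ((List.range (3 * N)).map a ++ (List.range (3 * N)).map fun j => decide (j < i))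

section

variable (x : List Bool) (N : ℕ) (a : ℕ → Bool) (i : ℕ) {j : ℕ}

theorem length_question : (question x N a i).length = x.length + 2 * (3 * N) := by
  simp only [question, List.length_append, List.length_map, List.length_range, two_mul]

theorem question_getElem?_of_lt (hj : j < x.length) : (question x N a i)[j]? = x[j]? :=
  List.getElem?_append_left hj

theorem question_getElem?_array (hj : j < 3 * N) :
    (question x N a i)[x.length + j]? = some (a j) := by
  rw [question, List.getElem?_append_right (Nat.le_add_right _ _), Nat.add_sub_cancel_left,
    List.getElem?_append_left (by simpa only [List.length_map, List.length_range] using hj),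
    List.getElem?_map, List.getElem?_range hj, Option.map_some]

theorem question_getElem?_index (hj : j < 3 * N) :
    (question x N a i)[x.length + (3 * N + j)]? = some (decide (j < i)) := by
  rw [question, List.getElem?_append_right (Nat.le_add_right _ _), Nat.add_sub_cancel_left,
    List.getElem?_append_right (by
      simp only [List.length_map, List.length_range, Nat.le_add_right]),
    List.length_map, List.length_range, Nat.add_sub_cancel_left, List.getElem?_map,
    List.getElem?_range hj, Option.map_some]

theorem question_getElem?_eq_some_true_iff :
    (question x N a i)[j]? = some true ↔ x[j]? = some true ∨
      (x.length ≤ j ∧ j < x.length + 3 * N) ∧ a (j - x.length) = true ∨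
      (x.length + 3 * N ≤ j ∧ j < x.length + 2 * (3 * N)) ∧ j < x.length + 3 * N + i := by
  rcases lt_or_ge j x.length with hj | hj
  · rw [question_getElem?_of_lt x N a i hj, iff_self_or]
    omega
  have none_of_le : x[j]? = none := List.getElem?_eq_none hj
  obtain ⟨k, rfl⟩ := Nat.exists_eq_add_of_le hj
  rw [none_of_le, Nat.add_sub_cancel_left]
  rcases lt_or_ge k (3 * N) with hk | hk
  · rw [question_getElem?_array x N a i hk, Option.some_inj]
    grind
  obtain ⟨k, rfl⟩ := Nat.exists_eq_add_of_le hk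
  rcases lt_or_ge k (3 * N) with hk' | hk'
  · rw [question_getElem?_index x N a i hk', Option.some_inj, decide_eq_true_iff]
    grind
  · rw [List.getElem?_eq_none (by rw [length_question]; omega)]
    grind

end

section

variable {σ : Vocabulary}

/-- Bit number `j` of the first word of a pair. -/
def firstBit (v : List Bool) (j : ℕ) : Bool := v.getD (2 * j) false

/-- The size of the universe of the structure that a pair of an oracle question and a certificate
starts with. -/
noncomputable def pairSize (v : List Bool) : ℕ :=
  leadingLength v.length fun j => firstBit v j = true

/-- Bit number `j` of the array in the oracle question of a pair. -/
noncomputable def pairArray (σ : Vocabulary) (v : List Bool) (j : ℕ) : Bool :=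
  firstBit v (structureLength σ (pairSize v) + j)

variable (φ : Formula σ) (m : ℕ)

/-- The number of the oracle question of a pair. -/
noncomputable def pairIndex (v : List Bool) : ℕ :=
  leadingLength (3 * pairSize v ^ φ.free.card) fun j =>
    pairArray σ v (3 * pairSize v ^ φ.free.card + j) = true

/-- Bit number `k` of the certificate of a pair. -/
noncomputable def pairCertificate (v : List Bool) (k : ℕ) : Bool :=
  v.getD (2 * (structureLength σ (pairSize v) + 2 * (3 * pairSize v ^ φ.free.card)) + 2 + k) false

/-- The pair `v` consists of an oracle question, a solution that supports the answer `yes`, and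
a certificate that the solution satisfies `φ`. -/
def Accepts (v : List Bool) : Prop :=
  Certifies (structureOf σ (pairSize v) fun j => firstBit v j = true)
    (certificateTeam φ.free (pairSize v) m (pairCertificate φ v)) φ 0 ∧
  Supports (N := pairSize v ^ φ.free.card) (pairArray σ v) (pairIndex φ v)
    fun j => pairCertificate φ v j

/-- The oracle of the enumeration algorithm. -/
def oracle : Language Bool :=
  {q | ∃ w : List Bool, w.length ≤ φ.numNodes * (q.length + 1) ^ m ∧ Accepts φ m (pairWord q w)}

end

section

variable {v w : List Bool} {j : ℕ}

theorem getD_false_eq_true_iff : v.getD j false = true ↔ v[j]? = some true := by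
  rw [List.getD_eq_getElem?_getD]
  cases v[j]? <;> simp

theorem firstBit_pairWord {q : List Bool} (hj : j < q.length) :
    firstBit (pairWord q w) j = q.getD j false := by
  rw [firstBit, List.getD_eq_getElem?_getD, pairWord_getElem?_two_mul q w hj,
    List.getD_eq_getElem?_getD]

end

section

variable {σ : Vocabulary} {n : ℕ} (𝔄 : Structure σ (Fin n)) (N : ℕ) (a : ℕ → Bool) (i : ℕ)
  (w : List Bool) {j : ℕ}

theorem firstBit_question_of_lt (hj : j < structureLength σ n) :
    firstBit (pairWord (question (encodeStructure 𝔄) N a i) w) j = true ↔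
      (encodeStructure 𝔄)[j]? = some true := by
  rw [← length_encodeStructure 𝔄] at hj
  rw [firstBit_pairWord (by rw [length_question]; omega), getD_false_eq_true_iff,
    question_getElem?_of_lt _ _ _ _ hj]

theorem pairSize_question :
    pairSize (pairWord (question (encodeStructure 𝔄) N a i) w) = n := by
  have lt_length := lt_structureLength (σ := σ) n
  refine leadingLength_encodeStructure 𝔄 ?_ fun j hj =>
    firstBit_question_of_lt 𝔄 N a i w (by omega)
  rw [length_pairWord, length_question, length_encodeStructure]
  omega

theorem pairArray_question (hj : j < 3 * N) :
    pairArray σ (pairWord (question (encodeStructure 𝔄) N a i) w) j = a j := by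
  rw [pairArray, pairSize_question, ← length_encodeStructure 𝔄,
    firstBit_pairWord (by rw [length_question]; omega), List.getD_eq_getElem?_getD,
    question_getElem?_array _ _ _ _ hj, Option.getD_some]

theorem pairIndex_question (φ : Formula σ) {i : ℕ} (hi : i < 3 * n ^ φ.free.card) :
    pairIndex φ (pairWord (question (encodeStructure 𝔄) (n ^ φ.free.card) a i) w) = i := by
  have index_bit {j : ℕ} (hj : j < 3 * n ^ φ.free.card) :
      pairArray σ (pairWord (question (encodeStructure 𝔄) (n ^ φ.free.card) a i) w)
        (3 * n ^ φ.free.card + j) = true ↔ j < i := by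
    rw [pairArray, pairSize_question, ← length_encodeStructure 𝔄,
      firstBit_pairWord (by rw [length_question]; omega), List.getD_eq_getElem?_getD,
      question_getElem?_index _ _ _ _ hj, Option.getD_some, decide_eq_true_iff]
  rw [pairIndex, pairSize_question]
  exact leadingLength_eq hi (fun j hj => (index_bit (hj.trans hi)).2 hj)
    ((index_bit hi).not.2 (lt_irrefl i))

theorem pairCertificate_question (φ : Formula σ) (k : ℕ) :
    pairCertificate φ (pairWord (question (encodeStructure 𝔄) (n ^ φ.free.card) a i) w) k =
      w.getD k false := by
  rw [pairCertificate, pairSize_question, ← length_encodeStructure 𝔄,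
    ← length_question (encodeStructure 𝔄) (n ^ φ.free.card) a i, List.getD_eq_getElem?_getD,
    pairWord_getElem?_add, List.getD_eq_getElem?_getD]

variable {φ : Formula σ} {m : ℕ} {i : ℕ}

theorem accepts_question_iff (hi : i < 3 * n ^ φ.free.card) :
    Accepts φ m (pairWord (question (encodeStructure 𝔄) (n ^ φ.free.card) a i) w) ↔
      Certifies 𝔄 (certificateTeam φ.free n m fun k => w.getD k false) φ 0 ∧
      Supports a i fun j : Fin (n ^ φ.free.card) => w.getD j false := by
  have array_eq (j : ℕ) (hj : j < 3 * n ^ φ.free.card) :=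
    pairArray_question 𝔄 (n ^ φ.free.card) a i w hj
  rw [Accepts, pairIndex_question 𝔄 a w φ hi, funext (pairCertificate_question 𝔄 a i w φ),
    pairSize_question, structureOf_eq 𝔄 fun j => firstBit_question_of_lt 𝔄 _ a i w]
  exact and_congr_right fun _ => ⟨fun h => h.congr array_eq, fun h =>
    h.congr fun j hj => (array_eq j hj).symm⟩

theorem question_mem_oracle_iff (hφ : φ.vars ⊆ Finset.range m) (hi : i < 3 * n ^ φ.free.card) :
    question (encodeStructure 𝔄) (n ^ φ.free.card) a i ∈ oracle φ m ↔
      ∃ z ∈ satWords φ 𝔄, Supports a i z := by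
  constructor
  · rintro ⟨w, -, accepts⟩
    obtain ⟨certifies, supports⟩ := (accepts_question_iff 𝔄 a w hi).1 accepts
    exact ⟨_, certifies.sat, supports⟩
  · rintro ⟨z, hz, supports⟩
    obtain ⟨f, prefix_eq, certifies⟩ := exists_certifies_certificateTeam hφ hz
    have hD := φ.free_subset_vars.trans hφ
    set l := φ.numNodes * (n + 1) ^ m
    have getD_eq {k : ℕ} (hk : k < l) : ((List.range l).map f).getD k false = f k := by
      rw [List.getD_eq_getElem?_getD, List.getElem?_map, List.getElem?_range hk]
      rfl
    refine ⟨(List.range l).map f, ?_, (accepts_question_iff 𝔄 a _ hi).2 ⟨?_, ?_⟩⟩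
    · rw [List.length_map, List.length_range, length_question, length_encodeStructure]
      have := lt_structureLength (σ := σ) n
      exact Nat.mul_le_mul_left _ (Nat.pow_le_pow_left (by omega) m)
    · refine certifies.congr fun μ _ hμ => certificateTeam_congr hD fun k hk => (getD_eq ?_).symm
      exact hk.trans_le (Nat.mul_le_mul_right _ (by omega))
    · convert supports using 2 with j
      have le_l : n ^ φ.free.card ≤ l := (pow_card_le_of_subset_range n hD).trans
        (Nat.le_mul_of_pos_left _ φ.numNodes_pos)
      rw [getD_eq (j.2.trans_le le_l), prefix_eq]

end

section

variable {σ : Vocabulary}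

theorem inputPolyDecidable_getD : InputPolyDecidable fun v j => v.getD j false = true :=
  fun _ _ _ hf => (PolyDecidable.input_bit hf).congr fun _ => getD_false_eq_true_iff

theorem inputPolyDecidable_firstBit : InputPolyDecidable fun v j => firstBit v j = true :=
  fun _ _ _ hf => inputPolyDecidable_getD ((PolyTime.const 2).mul hf)

theorem inputPolyTime_pairSize : InputPolyTime pairSize := fun _ _ =>
  .leadingLength (p := fun c j => firstBit (input c) j = true) .length
    (inputPolyDecidable_firstBit .var)

theorem inputPolyDecidable_pairArray :
    InputPolyDecidable fun v j => pairArray σ v j = true :=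
  inputPolyDecidable_firstBit.shift inputPolyTime_pairSize.structureLength

variable (φ : Formula σ) (m : ℕ)

theorem inputPolyTime_arrayLength : InputPolyTime fun v => 3 * pairSize v ^ φ.free.card :=
  fun _ _ => (PolyTime.const 3).mul ((inputPolyTime_pairSize _).pow _)

theorem inputPolyTime_pairIndex : InputPolyTime (pairIndex φ) := fun _ _ =>
  .leadingLength (p := fun c j =>
      pairArray σ (input c) (3 * pairSize (input c) ^ φ.free.card + j) = true)
    (inputPolyTime_arrayLength φ _)
    (inputPolyDecidable_pairArray.shift (inputPolyTime_arrayLength φ) .var)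

theorem inputPolyDecidable_pairCertificate :
    InputPolyDecidable fun v k => pairCertificate φ v k = true :=
  inputPolyDecidable_getD.shift fun _ _ =>
    .add (.mul (.const 2) (.add (inputPolyTime_pairSize.structureLength _)
      (.mul (.const 2) (inputPolyTime_arrayLength φ _)))) (.const 2)

variable {φ m}

theorem PolyDecidable.accepts (hφ : φ.vars ⊆ Finset.range m) {Γ : Type} [Context Γ] :
    PolyDecidable fun c : Γ => Accepts φ m (input c) :=
  .and
    (.certifies (b := fun v j => firstBit v j = true)
      (X := fun v => certificateTeam φ.free (pairSize v) m (pairCertificate φ v))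
      inputPolyTime_pairSize inputPolyDecidable_firstBit
      (.certificateTeam inputPolyTime_pairSize (inputPolyDecidable_pairCertificate φ)
        (φ.free_subset_vars.trans hφ)) hφ 0)
    (.supports (N := fun v => pairSize v ^ φ.free.card)
      (fun _ _ => (inputPolyTime_pairSize _).pow _) (inputPolyTime_pairIndex φ)
      inputPolyDecidable_pairArray (inputPolyDecidable_pairCertificate φ))

theorem setOf_accepts_mem_PTIME (hφ : φ.vars ⊆ Finset.range m) :
    ({v | Accepts φ m v} : Language Bool) ∈ PTIME := by
  classical
  have mem := (PolyDecidable.accepts (Γ := State) hφ).polyTime_ite_one.setOf_ne_zero_mem_PTIME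
  simp only [ne_eq, ite_eq_right_iff, one_ne_zero, imp_false, not_not] at mem
  exact mem

theorem oracle_mem_NP (hφ : φ.vars ⊆ Finset.range m) : oracle φ m ∈ NP := by
  refine ⟨_, setOf_accepts_mem_PTIME hφ, .C φ.numNodes * (.X + 1) ^ m, fun q => ?_⟩
  simp only [Polynomial.eval_mul, Polynomial.eval_pow, Polynomial.eval_add, Polynomial.eval_C,
    Polynomial.eval_X, Polynomial.eval_one]
  rfl

/-! ## The enumeration algorithm -/

variable (φ)

/-- The length of the words that encode the teams of the structure encoded by `x` over the free
variables of `φ`; it is `0` if `x` does not encode a structure. -/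
noncomputable def solutionLength (x : List Bool) : ℕ :=
  if x.length = structureLength σ (universeSize x) then universeSize x ^ φ.free.card else 0

theorem inputPolyTime_universeSize : InputPolyTime universeSize := fun _ _ =>
  .leadingLength (p := fun c j => (input c)[j]? = some true) .length (.input_bit .var)

theorem inputPolyTime_solutionLength : InputPolyTime (solutionLength φ) := fun _ _ =>
  .ite (p := fun c => (input c).length = structureLength σ (universeSize (input c)))
    (.eq .length (inputPolyTime_universeSize.structureLength _))
    ((inputPolyTime_universeSize _).pow _) (.const 0)

theorem solutionLength_encodeStructure {n : ℕ} (𝔄 : Structure σ (Fin n)) :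
    solutionLength φ (encodeStructure 𝔄) = n ^ φ.free.card := by
  rw [solutionLength, universeSize_encodeStructure, length_encodeStructure, if_pos rfl]

theorem polyWritable_question :
    PolyWritable fun c : State × ℕ => question c.1.1 (solutionLength φ c.1.1) c.1.2 c.2 := by
  have numBits {Γ : Type} [Context Γ] : PolyTime fun c : Γ => 3 * solutionLength φ (input c) :=
    (PolyTime.const 3).mul (inputPolyTime_solutionLength φ Γ)
  constructor
  · exact (PolyTime.length.add (.mul (.const 2) numBits)).congr fun c => length_question ..
  · refine PolyDecidable.congr (.or (.input_bit .var) (.or ?_ ?_))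
      fun c => question_getElem?_eq_some_true_iff ..
    · exact .and (.and (.le .length .var) (.lt .var (.add .length numBits)))
        (.array_bit (.sub .var .length))
    · exact .and (.and (.le (.add .length numBits) .var)
        (.lt .var (.add .length (.mul (.const 2) numBits))))
        (.lt .var (.add (.add .length numBits) .var₁))

theorem polyWritable_ofFn_block (k : ℕ) :
    PolyWritable fun c : State => List.ofFn (block (solutionLength φ c.1) c.2 k) := by
  have length {Γ : Type} [Context Γ] := inputPolyTime_solutionLength φ Γ
  refine ⟨length.congr fun c => List.length_ofFn, ?_⟩
  refine PolyDecidable.congr (.and (.lt .var length)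
    (.array_bit (.add (.mul (.const k) length) .var))) fun c => ?_
  rw [List.getElem?_ofFn]
  split_ifs with h
  · exact Option.some_inj.trans (and_iff_right h).symm
  · exact iff_of_false not_false fun bit => h bit.1

/-- The enumeration algorithm for the teams of maximal cardinality that satisfy `φ`. -/
noncomputable def enumScheme : RoundScheme where
  numBits c := 3 * solutionLength φ c.1
  question c := question c.1.1 (solutionLength φ c.1.1) c.1.2 c.2
  continues c := block (solutionLength φ c.1) c.2 2 ≠ ⊥
  output c := List.ofFn (block (solutionLength φ c.1) c.2 2)
  polyTime_numBits := (PolyTime.const 3).mul (inputPolyTime_solutionLength φ _)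
  polyWritable_question := polyWritable_question φ
  polyDecidable_continues := by
    refine (PolyDecidable.eq_bot (inputPolyTime_solutionLength φ State)
      (z := fun c j => c.2 (2 * solutionLength φ c.1 + j)) ?_).not
    exact .array_bit (.add (.mul (.const 2) (inputPolyTime_solutionLength φ _)) .var)
  polyWritable_output := polyWritable_ofFn_block φ 2

variable {φ}

theorem exists_yields_ECardMaxSat (hφ : φ.vars ⊆ Finset.range m) (x : List Bool) :
    ∃ ws : List (List Bool), ws.Nodup ∧ (∀ y, y ∈ ECardMaxSat φ x ↔ y ∈ ws) ∧
      (enumScheme φ).Yields (oracle φ m) x (fun _ => false) ws := by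
  by_cases hx : ∃ (n : ℕ) (𝔄 : Structure σ (Fin n)), x = encodeStructure 𝔄
  · obtain ⟨n, 𝔄, rfl⟩ := hx
    have length_eq := solutionLength_encodeStructure φ 𝔄
    obtain ⟨ws, nodup, yields, mem⟩ := RoundScheme.exists_yields (R := enumScheme φ)
      (L := oracle φ m) (x := encodeStructure 𝔄) (N := n ^ φ.free.card) (S := satWords φ 𝔄)
      (fun a => congrArg (3 * ·) length_eq)
      (fun a i hi => by
        simp only [enumScheme, length_eq]
        exact question_mem_oracle_iff 𝔄 a hφ hi)
      (fun a => by simp only [enumScheme]; rw [length_eq])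
      (fun a => by simp only [enumScheme]; rw [length_eq])
    exact ⟨ws, nodup, fun y => (mem_ECardMaxSat_encodeStructure φ 𝔄).trans (mem y).symm, yields⟩
  · have length_eq : solutionLength φ x = 0 :=
      if_neg fun h => hx ⟨_, exists_eq_encodeStructure h⟩
    refine ⟨[], List.nodup_nil, fun y => iff_of_false ?_ List.not_mem_nil, ?_⟩
    · rintro ⟨n, 𝔄, X, rfl, -⟩
      exact hx ⟨n, 𝔄, rfl⟩
    · change ¬ block (solutionLength φ x) _ 2 ≠ ⊥
      rw [length_eq]
      exact not_not.2 (Subsingleton.elim _ _)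

end

end TeamEnum

/-- For every vocabulary `σ` and every fixed formula `φ` of `FO(⊥, dep, ⊆)` over `σ`, the problem of
enumerating the nonempty satisfying teams of maximum cardinality is in `DelNP`. -/
theorem mainTheorem7 (σ : TeamEnum.Vocabulary) (φ : TeamEnum.Formula σ) :
    TeamEnum.ECardMaxSat φ ∈ TeamEnum.Del TeamEnum.NP := by
  obtain ⟨m, hφ⟩ := φ.vars.exists_nat_subset_range
  exact (TeamEnum.enumScheme φ).mem_Del (TeamEnum.oracle_mem_NP hφ)
    (TeamEnum.exists_yields_ECardMaxSat hφ)
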